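/- Algorithms run on the word RAM: memory cells and registers hold integers of $O(\log N)$ bits, where $N$ is the size parameter of the instance; arithmetic, bitwise and comparison operations, indirect reads and writes and jumps take unit time, and a randomized algorithm may also draw a uniformly random element of $\{0,\dots,s\}$, $s$ being the content of a register, in unit time. All input numbers are integers of absolute value at most polynomial in the size parameter, with an arbitrary fixed exponent. A randomized algorithm has running time $f$ if for every constant $c$ it can be made to solve every instance of size parameter $N$ correctly within $O(f(N))$ steps with probability at least $1-(N+1)^{-c}$; a deterministic algorithm has running time $f$ if it always solves such instances correctly within $O(f(N))$ steps. The constants (word length, time, the program itself) may depend on $c$ and on the exponent of the polynomial, but not on the instance. Consider the following two problems. (i) Range-restricted counting 3SUM, with size parameter $N\ge 1$: given two sets $A,B$ of $N$ integers each, compute for every $c\in C=\{0,\dots,N-1\}$ the number of pairs $(a,b)\in A\times B$ with $a+b=c$. (ii) Text-to-Pattern Hamming Distances with $n=O(m)$, that is with $m\le n\le \kappa m$ for a constant integer $\kappa\ge 2$, with size parameter $m\ge 1$: given a pattern $P$ of length $m$ and a text $T$ of length $n$ whose characters are natural numbers, compute for every shift $i\in\{0,\dots,n-m\}$ the number of $j\in\{0,\dots,m-1\}$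 with $P[j]\ne T[i+j]$. Theorem. Let $f:\mathbb N\to\mathbb R$ and let $\kappa\ge 2$ be an integer constant. (1) If (i) has a randomized algorithm with running time $f(N)$, then (ii) has a randomized algorithm with running time $f(m)\,(\log (m+2))^{O(1)}$. The same holds with "deterministic" in place of "randomized" in both places. (2) If (ii) has a randomized (in particular, if it has a deterministic) algorithm with running time $f(m)$, then (i) has a randomized algorithm with running time $f(N)\,(\log (N+2))^{O(1)}$. -/

import Mathlib

/-! ### A randomized word RAM -/

/-- The arithmetic, bitwise and comparison operations of the word RAM (all of unit cost). -/
inductive BinOp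
  | add | sub | mul | div | mod | and | or | xor | shl | shr | lt | eq

/-- The value of an operation on two (signed) integers. Division rounds down for a positive
divisor; comparisons return `0` or `1`. -/
def BinOp.eval : BinOp → ℤ → ℤ → ℤ
  | .add, x, y => x + y
  | .sub, x, y => x - y
  | .mul, x, y => x * y
  | .div, x, y => x / y
  | .mod, x, y => x % y
  | .and, x, y => Int.land x y
  | .or, x, y => Int.lor x y
  | .xor, x, y => Int.xor x y
  | .shl, x, y => x * 2 ^ y.toNat
  | .shr, x, y => x / 2 ^ y.toNat
  | .lt, x, y => if x < y then 1 else 0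
  | .eq, x, y => if x = y then 1 else 0

/-- Word RAM programs: unit-cost instructions on registers and on an array of memory cells,
with structured control flow. (A program with jumps is one loop around a case distinction on its
program counter, which costs a constant factor.) -/
inductive Prog
  /-- do nothing -/
  | skip
  /-- `reg r := z` -/
  | const (r : ℕ) (z : ℤ)
  /-- `reg r := reg a ∘ reg b` -/
  | op (o : BinOp) (r a b : ℕ)
  /-- `reg r := mem[reg a]` -/
  | load (r a : ℕ)
  /-- `mem[reg a] := reg r` -/
  | store (a r : ℕ)
  /-- `reg r :=` a fresh uniformly random element of `{0, …, reg a}` -/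
  | rand (r a : ℕ)
  /-- first `p`, then `q` -/
  | seq (p q : Prog)
  /-- if `reg r ≠ 0` then `p` else `q` -/
  | ite (r : ℕ) (p q : Prog)
  /-- while `reg r ≠ 0` do `p` -/
  | loop (r : ℕ) (p : Prog)

/-- A program is deterministic when it contains no random instruction. -/
def Prog.Deterministic : Prog → Prop
  | .rand _ _ => False
  | .seq p q => p.Deterministic ∧ q.Deterministic
  | .ite _ p q => p.Deterministic ∧ q.Deterministic
  | .loop _ p => p.Deterministic
  | _ => True

/-- Contents of the registers and of the memory; memory addresses are (signed) words. -/
structure State where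
  reg : ℕ → ℤ
  mem : ℤ → ℤ

/-- Put the value `v` into register `r` of a machine whose words are the integers of absolute
value less than `2 ^ w`. A value that does not fit into a word makes the machine crash. -/
def State.write (w : ℕ) (s : State) (r : ℕ) (v : ℤ) : Option State :=
  if |v| < 2 ^ w then some { s with reg := Function.update s.reg r v } else none

/-- A configuration: the stack of the programs that are still to be executed (the next one
first; the machine has halted when it is empty), and the state. -/
abbrev Config := List Prog × State

/-- One step of the machine with word length `w`, as a probability distribution on the next
configuration; `none` is the crashed machine. Halted machines do not change any more. -/
noncomputable def step (w : ℕ) : Config → PMF (Option Config)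
  | ([], s) => PMF.pure (some ([], s))
  | (.skip :: K, s) => PMF.pure (some (K, s))
  | (.const r z :: K, s) => PMF.pure ((s.write w r z).map (Prod.mk K))
  | (.op o r a b :: K, s) =>
      PMF.pure ((s.write w r (o.eval (s.reg a) (s.reg b))).map (Prod.mk K))
  | (.load r a :: K, s) => PMF.pure ((s.write w r (s.mem (s.reg a))).map (Prod.mk K))
  | (.store a r :: K, s) =>
      PMF.pure (some (K, { s with mem := Function.update s.mem (s.reg a) (s.reg r) }))
  | (.rand r a :: K, s) =>
      (PMF.uniformOfFintype (Fin ((s.reg a).toNat + 1))).map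
        fun v => (s.write w r ((v : ℕ) : ℤ)).map (Prod.mk K)
  | (.seq p q :: K, s) => PMF.pure (some (p :: q :: K, s))
  | (.ite r p q :: K, s) => PMF.pure (some (if s.reg r ≠ 0 then p :: K else q :: K, s))
  | (.loop r p :: K, s) =>
      PMF.pure (some (if s.reg r ≠ 0 then p :: .loop r p :: K else K, s))

/-- The distribution of the configuration after `t` steps. -/
noncomputable def run (w : ℕ) : ℕ → Config → PMF (Option Config)
  | 0, c => PMF.pure (some c)
  | t + 1, c => (step w c).bind fun
      | none => PMF.pure none
      | some c' => run w t c'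

/-! ### Computational problems and algorithms -/

/-- A problem whose instances and answers are sequences of integers. -/
structure Problem where
  /-- the instances -/
  Inst : Type
  /-- the parameter in which running times are measured -/
  size : Inst → ℕ
  /-- the lengths of the parts of the input; they are given in the registers `0, 1, …` -/
  args : Inst → List ℤ
  /-- the input; it is given in the memory cells `0, 1, …` -/
  data : Inst → List ℤ
  /-- the answer; it has to be written to the memory cells that follow the input -/
  answer : Inst → List ℤ

/-- The start of program `p` on instance `x`: all other registers and cells hold `0`. -/
def Problem.start (Q : Problem) (p : Prog) (x : Q.Inst) : Config :=
  ([p], { reg := fun r => (Q.args x).getD r 0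
          mem := fun i => if 0 ≤ i then (Q.data x).getD i.toNat 0 else 0 })

/-- The machine has halted (without a crash) and has written the answer to `x`. -/
def Problem.Solved (Q : Problem) (x : Q.Inst) (o : Option Config) : Prop :=
  ∃ s : State, o = some ([], s) ∧
    ∀ i, (h : i < (Q.answer x).length) → s.mem ((Q.data x).length + i) = (Q.answer x)[i]

/-- The probability that `p`, run with word length `w`, has not solved `x` within `t` steps. -/
noncomputable def Problem.failProb (Q : Problem) (p : Prog) (w t : ℕ) (x : Q.Inst) :
    ENNReal :=
  (run w t (Q.start p x)).toOuterMeasure {o | ¬ Q.Solved x o}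

/-- All input numbers are bounded by the `u`-th power of the size parameter (plus one). -/
def Problem.PolyBounded (Q : Problem) (u : ℕ) (x : Q.Inst) : Prop :=
  ∀ z ∈ Q.data x, |z| ≤ ((Q.size x : ℤ) + 1) ^ u

/-- `Q` has a randomized algorithm with running time `O(f)`, correct with high probability:
for all exponents `u` and `c` there is a program that, on a word RAM whose word length is a
constant `k` times the bit length of the size parameter `N`, solves every instance with numbers
bounded by `(N + 1) ^ u` within `C * f N` steps, except with probability at most
`(N + 1) ^ (-c)`. -/
def Problem.HasRandomizedAlgorithm (Q : Problem) (f : ℕ → ℝ) : Prop :=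
  ∀ u c : ℕ, ∃ (p : Prog) (k C : ℕ), ∀ x : Q.Inst, Q.PolyBounded u x →
    Q.failProb p (k * Nat.size (Q.size x)) ⌊C * f (Q.size x)⌋₊ x ≤
      (((Q.size x : ENNReal) + 1) ^ c)⁻¹

/-- `Q` has a deterministic algorithm with running time `O(f)` on numbers that are polynomially
bounded in the size parameter. -/
def Problem.HasDeterministicAlgorithm (Q : Problem) (f : ℕ → ℝ) : Prop :=
  ∀ u : ℕ, ∃ (p : Prog) (k C : ℕ), p.Deterministic ∧ ∀ x : Q.Inst, Q.PolyBounded u x →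
    Q.failProb p (k * Nat.size (Q.size x)) ⌊C * f (Q.size x)⌋₊ x = 0

/-! ### The two problems -/

/-- Two sets of `N ≥ 1` integers, listed in an arbitrary order without repetition. -/
structure ThreeSumInst where
  N : ℕ
  N_pos : 1 ≤ N
  a : Fin N ↪ ℤ
  b : Fin N ↪ ℤ

/-- Range-restricted counting 3SUM: for each `c ∈ {0, …, N - 1}`, the number of pairs
`(x, y) ∈ A × B` with `x + y = c`. -/
def rangeThreeSum : Problem where
  Inst := ThreeSumInst
  size I := I.N
  args I := [I.N]
  data I := List.ofFn I.a ++ List.ofFn I.b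
  answer I := List.ofFn fun c : Fin I.N =>
    ((((Finset.univ.map I.a) ×ˢ (Finset.univ.map I.b)).filter
      fun z => z.1 + z.2 = (c : ℤ)).card : ℤ)

/-- A pattern of length `m ≥ 1` and a text of length `n`, where `m ≤ n ≤ κ * m`; the characters
are natural numbers. -/
structure MatchingInst (κ : ℕ) where
  m : ℕ
  n : ℕ
  m_pos : 1 ≤ m
  m_le_n : m ≤ n
  n_le : n ≤ κ * m
  P : Fin m → ℕ
  T : Fin n → ℕ

/-- Text-to-Pattern Hamming Distances for texts that are at most `κ` times as long as the
pattern: for each shift `i`, the Hamming distance of `P` and `T[i], …, T[i + m - 1]`. -/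
def hammingDistances (κ : ℕ) : Problem where
  Inst := MatchingInst κ
  size I := I.m
  args I := [I.m, I.n]
  data I := List.ofFn (fun j => (I.P j : ℤ)) ++ List.ofFn (fun j => (I.T j : ℤ))
  answer I := List.ofFn fun i : Fin (I.n - I.m + 1) =>
    (hammingDist I.P fun j : Fin I.m => I.T ⟨i + j, by
      have := i.isLt; have := j.isLt; have := I.m_le_n; omega⟩ : ℤ)

/-! Hamming distances from 3SUM. A character and a position are packed into two digits: position `k`
of a text window with character `u` becomes `u * 2m + k`, and position `j` of the pattern with
character `v` becomes `-(v * 2m + j)`. The sum is a shift `c` in `[0, m)` exactly when `u = v` and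
`k - j = c`, because the lower digits and `c` cannot make up for a multiple of `2m`. Cutting the
shifts into at most `κ` blocks of length `m`, and the text window of each block into two halves of
length `m`, gives `2κ` instances whose sets have exactly `m` elements. The distance is `m` minus the
two counts of its block (`MatchingInst.blockCount_add_blockCount_add_hammingDist`). No random choice
is made, so determinism is inherited, and only a constant factor is lost.

3SUM from Hamming distances. Divide all numbers by `N` with remainder. If `a + b = c < N`, then the
quotients add up to `-d` and the remainders to `c + N * d` for exactly one carry `d ∈ {0, 1}`, so
for given `d` the quotient of `b` determines the block of length `N` in which its partner must lie.
The name of that block serves as a character, and the remainders serve as positions. Elements of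
different blocks would crowd on the same positions; therefore every named block receives a uniformly
random shift in `{0, …, N - 1}`, applied to both sides, which cancels whenever the characters agree.
Elements of one block never collide and different blocks are shifted independently, so some position
receives `L` elements with probability of order `N / L!` (`card_crowded_mul_factorial_le`). For `L`
a large multiple of `log N` this is below any prescribed inverse polynomial. Every array then splits
into `L` layers with at most one element per position (`sum_charMatch_layer`). Two carries, two
windows of pattern positions and `L * L` pairs of layers give `4 * L ^ 2` instances whose match
counts add up to the answer (`ThreeSumInst.sum_callMatches`); this costs two logarithmic factors.

The machine. A failure probability is an expected penalty, and programs are analysed backwards: the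
bound for the rest of a program is the penalty for its beginning. The given algorithm runs as a
subroutine on an untouched stretch of memory, at most three steps for one (`Simulates.expPen_le`);
the stretches are separated by powers of two that exceed all addresses of the subroutine but stay
polynomial. Failure probabilities add up over the calls and are paid for by a larger exponent.
Nothing is assumed about `f`, but an algorithm that succeeds with positive probability must write
linearly many nonzero cells on a suitable instance (`length_answer_le_of_failProb_lt_one`), so its
time bound pays for linear bookkeeping. -/

open scoped Classical in
/-- Indicator of the complement of a set of good outcomes. -/
noncomputable def failInd {α : Type*} (G : α → Prop) (x : α) : ENNReal := if G x then 0 else 1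

/-! ### Expected penalty of a run -/

/-- The penalty of an outcome: at most one, and equal to one for a machine that crashed or has
not halted. -/
noncomputable def penalty (Φ : State → ENNReal) : Option Config → ENNReal
  | some ([], s) => min (Φ s) 1
  | _ => 1

/-- The expectation of a function under a probability mass function. -/
noncomputable def PMF.expect {α : Type*} (q : PMF α) (g : α → ENNReal) : ENNReal :=
  ∑' a, q a * g a

theorem PMF.expect_pure {α : Type*} (a : α) (g : α → ENNReal) : (PMF.pure a).expect g = g a := by
  unfold PMF.expect
  rw [tsum_eq_single a]
  · simp
  · intro b hb; simp [PMF.pure_apply, hb]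

theorem PMF.expect_bind {α β : Type*} (q : PMF α) (k : α → PMF β) (g : β → ENNReal) :
    (q.bind k).expect g = q.expect fun a => (k a).expect g := by
  simp only [PMF.expect, PMF.bind_apply, ← ENNReal.tsum_mul_left, ← ENNReal.tsum_mul_right]
  rw [ENNReal.tsum_comm]
  simp only [mul_assoc]

theorem PMF.expect_map {α β : Type*} (q : PMF α) (k : α → β) (g : β → ENNReal) :
    (q.map k).expect g = q.expect fun a => g (k a) := by
  rw [← PMF.bind_pure_comp, PMF.expect_bind]
  simp [PMF.expect_pure]

theorem PMF.expect_mono {α : Type*} (q : PMF α) {g h : α → ENNReal} (H : ∀ a, g a ≤ h a) :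
    q.expect g ≤ q.expect h :=
  ENNReal.tsum_le_tsum fun a => mul_le_mul_right (H a) _

theorem PMF.expect_const {α : Type*} (q : PMF α) (c : ENNReal) : q.expect (fun _ => c) = c := by
  simp [PMF.expect, ENNReal.tsum_mul_right, q.tsum_coe]

theorem PMF.expect_add {α : Type*} (q : PMF α) (g h : α → ENNReal) :
    (q.expect fun a => g a + h a) = q.expect g + q.expect h := by
  simp [PMF.expect, mul_add, ENNReal.tsum_add]

/-- The expected penalty after `t` steps. -/
noncomputable def expPen (w t : ℕ) (c : Config) (Φ : State → ENNReal) : ENNReal :=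
  (run w t c).expect (penalty Φ)

theorem penalty_le_one (Φ : State → ENNReal) (o : Option Config) : penalty Φ o ≤ 1 := by
  unfold penalty; split <;> simp

theorem expPen_le_one (w t : ℕ) (c : Config) (Φ : State → ENNReal) : expPen w t c Φ ≤ 1 :=
  (PMF.expect_mono _ (penalty_le_one Φ)).trans_eq (PMF.expect_const _ _)

theorem expPen_zero (w : ℕ) (c : Config) (Φ : State → ENNReal) :
    expPen w 0 c Φ = penalty Φ (some c) := by
  simp [expPen, run, PMF.expect_pure]

/-- The expected penalty of a possibly crashed machine. -/
noncomputable def expPenOpt (w t : ℕ) (Φ : State → ENNReal) : Option Config → ENNReal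
  | none => 1
  | some c => expPen w t c Φ

theorem expPenOpt_le_one (w t : ℕ) (o : Option Config) (Φ : State → ENNReal) :
    expPenOpt w t Φ o ≤ 1 := by
  cases o
  · simp [expPenOpt]
  · exact expPen_le_one _ _ _ _

theorem expPen_succ (w t : ℕ) (c : Config) (Φ : State → ENNReal) :
    expPen w (t + 1) c Φ = (step w c).expect (expPenOpt w t Φ) := by
  rw [expPen, run, PMF.expect_bind]
  congr 1
  funext o
  cases o <;> simp [expPenOpt, expPen, PMF.expect_pure, penalty]

theorem expPen_succ_of_pure {w t : ℕ} {c : Config} {o : Option Config} (Φ : State → ENNReal)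
    (h : step w c = PMF.pure o) : expPen w (t + 1) c Φ = expPenOpt w t Φ o := by
  rw [expPen_succ, h, PMF.expect_pure]

theorem expPen_halted (w t : ℕ) (s : State) (Φ : State → ENNReal) :
    expPen w t ([], s) Φ = min (Φ s) 1 := by
  induction t with
  | zero => simp [expPen_zero, penalty]
  | succ t ih => rw [expPen_succ_of_pure Φ (o := some ([], s)) (by simp [step]), expPenOpt, ih]

/-- A halted configuration does not move, and one that has not halted already has the maximal
penalty, so waiting cannot hurt. Time bounds may therefore be rounded up freely. -/
theorem expPen_succ_le (w t : ℕ) (c : Config) (Φ : State → ENNReal) :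
    expPen w (t + 1) c Φ ≤ expPen w t c Φ := by
  induction t generalizing c with
  | zero =>
    obtain ⟨K, s⟩ := c
    cases K with
    | nil => simp [expPen_halted]
    | cons q K => rw [expPen_zero w (q :: K, s)]; exact expPen_le_one _ _ _ _
  | succ t ih =>
    rw [expPen_succ, expPen_succ w t]
    refine PMF.expect_mono _ fun o => ?_
    cases o
    · simp [expPenOpt]
    · exact ih _

theorem expPen_antitone {w t t' : ℕ} (h : t ≤ t') (c : Config) (Φ : State → ENNReal) :
    expPen w t' c Φ ≤ expPen w t c Φ := by
  induction h with
  | refl => exact le_rfl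
  | step _ ih => exact (expPen_succ_le _ _ _ _).trans ih

theorem penalty_mono {Φ Ψ : State → ENNReal} (h : ∀ s, Φ s ≤ Ψ s) (o : Option Config) :
    penalty Φ o ≤ penalty Ψ o := by
  unfold penalty
  split
  · exact min_le_min_right _ (h _)
  · exact le_rfl

theorem expPen_mono {Φ Ψ : State → ENNReal} (h : ∀ s, Φ s ≤ Ψ s) (w t : ℕ) (c : Config) :
    expPen w t c Φ ≤ expPen w t c Ψ :=
  PMF.expect_mono _ (penalty_mono h)

theorem expPen_le_add {Φ Ψ : State → ENNReal} {ε : ENNReal} (h : ∀ s, Φ s ≤ Ψ s + ε)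
    (w t : ℕ) (c : Config) : expPen w t c Φ ≤ expPen w t c Ψ + ε := by
  rw [expPen, expPen, ← PMF.expect_const (run w t c) ε, ← PMF.expect_add]
  refine PMF.expect_mono _ fun o => ?_
  unfold penalty
  split
  · rename_i s
    rcases le_total (Ψ s) 1 with h1 | h1
    · rw [min_eq_left h1]; exact (min_le_left _ _).trans (h s)
    · rw [min_eq_right h1]; exact (min_le_right _ _).trans le_self_add
  · exact le_self_add

/-- Crashed and unfinished runs do not solve the instance and have penalty one, so nothing is lost
by passing to expected penalties. -/
theorem failProb_eq_expPen (Q : Problem) (p : Prog) (w t : ℕ) (x : Q.Inst) :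
    Q.failProb p w t x =
      expPen w t (Q.start p x) (failInd fun s => Q.Solved x (some ([], s))) := by
  rw [Problem.failProb, PMF.toOuterMeasure_apply, expPen, PMF.expect]
  congr 1
  funext o
  by_cases h : Q.Solved x o
  · rw [Set.indicator_of_notMem (by simpa using h)]
    obtain ⟨s, rfl, hs⟩ := h
    have : Q.Solved x (some ([], s)) := ⟨s, rfl, hs⟩
    simp [penalty, failInd, this]
  · rw [Set.indicator_of_mem (by simpa using h)]
    rcases o with _ | ⟨K, s⟩
    · simp [penalty]
    · cases K with
      | nil => simp [penalty, failInd, h]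
      | cons => simp [penalty]

/-- Push programs under the stack of a configuration. -/
def Config.under (K : List Prog) (c : Config) : Config := (c.1 ++ K, c.2)

/-- A step inspects only the top of the stack; whatever lies below is carried along. -/
theorem step_append (w : ℕ) (q : Prog) (K₁ K : List Prog) (s : State) :
    step w (q :: (K₁ ++ K), s) = (step w (q :: K₁, s)).map (Option.map (Config.under K)) := by
  have key (o : Option State) : Option.map (Prod.mk (K₁ ++ K)) o =
      Option.map (Config.under K) (Option.map (Prod.mk K₁) o) := by
    cases o <;> rfl
  cases q <;> simp only [step, PMF.pure_map, PMF.map_comp] <;>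
    first
    | (congr 1; funext v; exact key _)
    | (rw [key])
    | (simp only [Option.map, Config.under]; split_ifs <;> rfl)
    | rfl

/-- The moment at which the upper part of the stack halts is random, but if it comes within `t`
steps then at least `t'` steps remain for `K`, and surplus steps do no harm. -/
theorem expPen_append {w t t' : ℕ} {K : List Prog} {Φ Ψ : State → ENNReal}
    (h : ∀ s, expPen w t' (K, s) Φ ≤ Ψ s) (K₁ : List Prog) (s : State) :
    expPen w (t + t') (K₁ ++ K, s) Φ ≤ expPen w t (K₁, s) Ψ := by
  induction t generalizing K₁ s with
  | zero =>
    cases K₁ with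
    | nil => rw [expPen_halted, Nat.zero_add]; exact le_min (h s) (expPen_le_one _ _ _ _)
    | cons q K₁ => rw [expPen_zero]; exact expPen_le_one _ _ _ _
  | succ t ih =>
    cases K₁ with
    | nil =>
      rw [expPen_halted, List.nil_append]
      exact le_min ((expPen_antitone (by omega) _ _).trans (h s)) (expPen_le_one _ _ _ _)
    | cons q K₁ =>
      rw [Nat.add_right_comm, expPen_succ, List.cons_append, step_append, PMF.expect_map,
        expPen_succ]
      refine PMF.expect_mono _ fun o => ?_
      rcases o with _ | ⟨K₂, s₂⟩
      · simp [expPenOpt]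
      · exact ih K₂ s₂

/-! ### Quantitative Hoare triples on the visible part of the state -/

/-- The number of registers that a calling program keeps; higher registers are scratch space. -/
abbrev numLocals : ℕ := 20

/-- The visible part of a state. -/
@[ext] structure AState where
  reg : Fin numLocals → ℤ
  mem : ℤ → ℤ

/-- Forget the scratch registers. -/
def State.abs (s : State) : AState := ⟨fun r => s.reg r, s.mem⟩

/-- Assign a visible register. -/
def AState.set (σ : AState) (r : Fin numLocals) (v : ℤ) : AState :=
  ⟨Function.update σ.reg r v, σ.mem⟩

/-- Assign a memory cell. -/
def AState.put (σ : AState) (a v : ℤ) : AState := ⟨σ.reg, Function.update σ.mem a v⟩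

/-- Started in a state that looks like `σ`, the program `p` has expected penalty at most `β`
after `t` steps. -/
def Triple (w t : ℕ) (p : Prog) (σ : AState) (Φ : AState → ENNReal) (β : ENNReal) : Prop :=
  ∀ s : State, s.abs = σ → expPen w t ([p], s) (fun s => Φ s.abs) ≤ β

/-- Started in a state that looks like `σ`, the program `p` halts within `t` steps in a state
that satisfies `Q`, except with probability at most `ε`. -/
def Achieves (w t : ℕ) (ε : ENNReal) (p : Prog) (σ : AState) (Q : AState → Prop) : Prop :=
  Triple w t p σ (failInd Q) ε

/-! ### Composition rules for triples. -/

section rules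

variable {w t t₁ t₂ : ℕ} {ε ε₁ ε₂ β : ENNReal} {p q : Prog} {σ : AState}
  {Φ Ψ : AState → ENNReal} {P Q : AState → Prop}

theorem Triple.of_one_le (h : 1 ≤ β) : Triple w t p σ Φ β :=
  fun _ _ => (expPen_le_one _ _ _ _).trans h

theorem Triple.mono (h : Triple w t₁ p σ Φ ε₁) (ht : t₁ ≤ t₂) (hε : ε₁ ≤ ε₂)
    (hΦ : ∀ σ, Ψ σ ≤ Φ σ) : Triple w t₂ p σ Ψ ε₂ := fun s hs =>
  ((expPen_mono (fun _ => hΦ _) _ _ _).trans (expPen_antitone ht _ _)).trans ((h s hs).trans hε)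

theorem failInd_le {α β : Type*} {P : α → Prop} {Q : β → Prop} {x : α} {y : β} (h : P x → Q y) :
    failInd Q y ≤ failInd P x := by
  unfold failInd
  split_ifs <;> simp_all

theorem Achieves.mono (h : Achieves w t₁ ε₁ p σ P) (ht : t₁ ≤ t₂) (hε : ε₁ ≤ ε₂)
    (hPQ : ∀ σ, P σ → Q σ) : Achieves w t₂ ε₂ p σ Q :=
  Triple.mono h ht hε fun _ => failInd_le (hPQ _)

theorem expPen_seq (s : State) (K : List Prog) (F : State → ENNReal) :
    expPen w (t + 1) (.seq p q :: K, s) F = expPen w t (p :: q :: K, s) F :=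
  expPen_succ_of_pure (o := some (p :: q :: K, s)) F (by simp [step])

theorem Triple.seq (hp : Triple w t₁ p σ Ψ β) (hq : ∀ σ, Triple w t₂ q σ Φ (Ψ σ)) :
    Triple w (t₁ + t₂ + 1) (.seq p q) σ Φ β := fun s hs => by
  rw [expPen_seq]
  exact (expPen_append (K := [q]) (Ψ := fun s => Ψ s.abs) (fun s => hq _ s rfl) [p] s).trans
    (hp s hs)

-- The union bound in the form required by `Triple.seq`: a good outcome leaves the error `ε₂` to the
-- rest of the program, a bad one is charged one.
open scoped Classical in
theorem Achieves.triple (h : Achieves w t ε₁ p σ P) :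
    Triple w t p σ (fun σ => if P σ then ε₂ else 1) (ε₁ + ε₂) := fun s hs => by
  refine (expPen_le_add (Ψ := fun s => failInd P s.abs) (ε := ε₂) (fun s => ?_) _ _ _).trans
    (add_le_add_left (h s hs) _)
  by_cases hP : P s.abs <;> simp [failInd, hP]

theorem Achieves.seq (hp : Achieves w t₁ ε₁ p σ P) (hq : ∀ σ, P σ → Achieves w t₂ ε₂ q σ Q) :
    Achieves w (t₁ + t₂ + 1) (ε₁ + ε₂) (.seq p q) σ Q := by
  classical
  refine Triple.seq hp.triple fun σ => ?_
  split_ifs with h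
  · exact hq σ h
  · exact Triple.of_one_le le_rfl

theorem Achieves.seq_eq {τ : AState} (hp : Achieves w t₁ 0 p σ (· = τ))
    (hq : Achieves w t₂ ε q τ Q) : Achieves w (t₁ + t₂ + 1) ε (.seq p q) σ Q := by
  have := Achieves.seq hp (q := q) (Q := Q) (t₂ := t₂) (ε₂ := ε) (fun σ h => h ▸ hq)
  rwa [zero_add] at this

theorem Achieves.seq_det (hp : Achieves w t₁ 0 p σ P) (hq : ∀ σ, P σ → Achieves w t₂ ε q σ Q) :
    Achieves w (t₁ + t₂ + 1) ε (.seq p q) σ Q := by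
  have := Achieves.seq hp hq
  rwa [zero_add] at this

end rules

/-! ### Deterministic runs -/

/-- From `s`, the program `p` deterministically takes `n` steps to reach `s₁`. -/
def Runs (w n : ℕ) (p : Prog) (s s₁ : State) : Prop :=
  ∀ (K : List Prog) (t : ℕ) (Φ : State → ENNReal),
    expPen w (t + n) (p :: K, s) Φ = expPen w t (K, s₁) Φ

theorem Runs.seq {w n₁ n₂ : ℕ} {p q : Prog} {s s₁ s₂ : State} (hp : Runs w n₁ p s s₁)
    (hq : Runs w n₂ q s₁ s₂) : Runs w (n₁ + n₂ + 1) (.seq p q) s s₂ := fun K t Φ => by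
  rw [← Nat.add_assoc, expPen_seq, Nat.add_comm n₁, ← Nat.add_assoc, hp, hq]

theorem Runs.of_step {w : ℕ} {p : Prog} {s s₁ : State}
    (h : ∀ K, step w (p :: K, s) = PMF.pure (some (K, s₁))) : Runs w 1 p s s₁ := fun K _ Φ =>
  expPen_succ_of_pure Φ (h K)

/-- Put a value into a register. -/
def State.setReg (s : State) (r : ℕ) (v : ℤ) : State := ⟨Function.update s.reg r v, s.mem⟩

theorem State.write_of_lt {w : ℕ} {s : State} {r : ℕ} {v : ℤ} (h : |v| < 2 ^ w) :
    s.write w r v = some (s.setReg r v) := by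
  simp [State.write, h, State.setReg]

theorem Runs.const {w r : ℕ} {z : ℤ} {s : State} (h : |z| < 2 ^ w) :
    Runs w 1 (.const r z) s (s.setReg r z) :=
  Runs.of_step fun K => by simp [step, State.write_of_lt h]

theorem Runs.op {w r a b : ℕ} {o : BinOp} {s : State}
    (h : |o.eval (s.reg a) (s.reg b)| < 2 ^ w) :
    Runs w 1 (.op o r a b) s (s.setReg r (o.eval (s.reg a) (s.reg b))) :=
  Runs.of_step fun K => by simp [step, State.write_of_lt h]

theorem Runs.load {w r a : ℕ} {s : State} (h : |s.mem (s.reg a)| < 2 ^ w) :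
    Runs w 1 (.load r a) s (s.setReg r (s.mem (s.reg a))) :=
  Runs.of_step fun K => by simp [step, State.write_of_lt h]

theorem Runs.store {w a r : ℕ} {s : State} :
    Runs w 1 (.store a r) s ⟨s.reg, Function.update s.mem (s.reg a) (s.reg r)⟩ :=
  Runs.of_step fun K => by simp [step]

theorem Runs.expPen_single {w n : ℕ} {p : Prog} {s s₁ : State} (h : Runs w n p s s₁)
    (Φ : State → ENNReal) : expPen w n ([p], s) Φ = min (Φ s₁) 1 := by
  have := h [] 0 Φ
  rwa [Nat.zero_add, expPen_halted] at this

theorem Achieves.of_runs {w n : ℕ} {p : Prog} {σ τ : AState}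
    (h : ∀ s : State, s.abs = σ → ∃ s₁, Runs w n p s s₁ ∧ s₁.abs = τ) :
    Achieves w n 0 p σ (· = τ) := fun s hs => by
  obtain ⟨s₁, h₁, h₂⟩ := h s hs
  rw [h₁.expPen_single]
  simp [failInd, h₂]

@[simp] theorem State.setReg_self (s : State) (r : ℕ) (v : ℤ) : (s.setReg r v).reg r = v := by
  simp [State.setReg]

theorem State.setReg_ne (s : State) {r r' : ℕ} (v : ℤ) (h : r' ≠ r) :
    (s.setReg r v).reg r' = s.reg r' := by
  simp [State.setReg, h]

@[simp] theorem State.setReg_mem (s : State) (r : ℕ) (v : ℤ) : (s.setReg r v).mem = s.mem := rfl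

theorem State.abs_setReg_of_le (s : State) {r : ℕ} (v : ℤ) (h : numLocals ≤ r) :
    (s.setReg r v).abs = s.abs := by
  ext x
  · exact s.setReg_ne v (by have := x.isLt; omega)
  · rfl

theorem State.abs_setReg_local (s : State) (r : Fin numLocals) (v : ℤ) :
    (s.setReg r v).abs = s.abs.set r v := by
  ext x
  · by_cases h : x = r
    · subst h; simp [State.abs, AState.set]
    · have : (x : ℕ) ≠ r := fun h' => h (Fin.ext h')
      simp [State.abs, AState.set, State.setReg_ne _ _ this, h]
  · rfl

theorem State.abs_reg (s : State) (r : Fin numLocals) : s.abs.reg r = s.reg r := rfl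

/-! ### Expressions -/

/-- Expressions over registers and memory cells. -/
inductive Expr
  | reg (r : Fin numLocals)
  | lit (z : ℤ)
  | bin (o : BinOp) (a b : Expr)
  | load (a : Expr)

namespace Expr

instance : Add Expr := ⟨bin .add⟩
instance : Sub Expr := ⟨bin .sub⟩
instance : Mul Expr := ⟨bin .mul⟩
instance : Div Expr := ⟨bin .div⟩
instance : Mod Expr := ⟨bin .mod⟩

/-- The value of an expression. -/
def eval (σ : AState) : Expr → ℤ
  | reg r => σ.reg r
  | lit z => z
  | bin o a b => o.eval (a.eval σ) (b.eval σ)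
  | load a => σ.mem (a.eval σ)

/-- The expression can be evaluated on a machine with word length `w`. -/
def Fits (w : ℕ) (σ : AState) : Expr → Prop
  | reg r => |σ.reg r| < 2 ^ w
  | lit z => |z| < 2 ^ w
  | bin o a b => a.Fits w σ ∧ b.Fits w σ ∧ |o.eval (a.eval σ) (b.eval σ)| < 2 ^ w
  | load a => a.Fits w σ ∧ |σ.mem (a.eval σ)| < 2 ^ w

/-- A program that evaluates an expression into register `d`, with scratch registers above. -/
def compile : Expr → ℕ → Prog
  | reg r, d => .seq (.const d 0) (.op .add d d r)
  | lit z, d => .const d z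
  | bin o a b, d => .seq (a.compile d) (.seq (b.compile (d + 1)) (.op o d d (d + 1)))
  | load a, d => .seq (a.compile d) (.load d d)

/-- The time for evaluating an expression. -/
def time : Expr → ℕ
  | reg _ => 3
  | lit _ => 1
  | bin _ a b => a.time + b.time + 3
  | load a => a.time + 2

theorem compile_deterministic (e : Expr) (d : ℕ) : (e.compile d).Deterministic := by
  induction e generalizing d <;> simp [compile, Prog.Deterministic, *]

/-- Evaluation into `d` touches only registers from `d` upward. So a left operand in `d` survives
the evaluation of the right operand into `d + 1`, and the visible registers are not affected. -/
theorem compile_runs {w : ℕ} (e : Expr) {d : ℕ} (hd : numLocals ≤ d) {s : State}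
    (h : e.Fits w s.abs) : ∃ s₁, Runs w e.time (e.compile d) s s₁ ∧ s₁.abs = s.abs ∧
      s₁.reg d = e.eval s.abs ∧ ∀ r < d, s₁.reg r = s.reg r := by
  induction e generalizing d s with
  | reg r =>
    have hr : (r : ℕ) ≠ d := by have := r.isLt; omega
    -- There is no move instruction; a register is copied by adding it to zero.
    have h0 : BinOp.add.eval ((s.setReg d 0).reg d) ((s.setReg d 0).reg r) = s.reg r := by
      rw [State.setReg_self, State.setReg_ne _ _ hr, BinOp.eval, zero_add]
    refine ⟨_, (Runs.const (by simp)).seq (Runs.op (h0 ▸ h)), ?_, ?_, ?_⟩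
    · rw [State.abs_setReg_of_le _ _ hd, State.abs_setReg_of_le _ _ hd]
    · rw [h0, State.setReg_self]; rfl
    · intro r' hr'
      rw [State.setReg_ne _ _ hr'.ne, State.setReg_ne _ _ hr'.ne]
  | lit z =>
    exact ⟨_, Runs.const h, State.abs_setReg_of_le _ _ hd, State.setReg_self _ _ _,
      fun r' hr' => State.setReg_ne _ _ hr'.ne⟩
  | bin o a b iha ihb =>
    obtain ⟨s₁, h₁, h₂, h₃, h₄⟩ := iha hd h.1
    obtain ⟨s₂, g₁, g₂, g₃, g₄⟩ := ihb (d := d + 1) (by omega) (h₂.symm ▸ h.2.1)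
    have e1 : s₂.reg d = a.eval s.abs := by rw [g₄ d (by omega), h₃]
    have e2 : s₂.reg (d + 1) = b.eval s.abs := by rw [g₃, h₂]
    have hT : time (bin o a b) = a.time + (b.time + 1 + 1) + 1 := by simp [time]; ring
    rw [hT]
    refine ⟨_, h₁.seq (g₁.seq (Runs.op (by rw [e1, e2]; exact h.2.2))), ?_, ?_, ?_⟩
    · rw [State.abs_setReg_of_le _ _ hd, g₂, h₂]
    · rw [State.setReg_self, e1, e2]; rfl
    · intro r' hr'
      rw [State.setReg_ne _ _ hr'.ne, g₄ _ (by omega), h₄ _ hr']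
  | load a iha =>
    obtain ⟨s₁, h₁, h₂, h₃, h₄⟩ := iha hd h.1
    have hm : s₁.mem = s.abs.mem := by rw [← h₂]; rfl
    refine ⟨_, h₁.seq (Runs.load (by rw [h₃, hm]; exact h.2)), ?_, ?_, ?_⟩
    · rw [State.abs_setReg_of_le _ _ hd, h₂]
    · rw [State.setReg_self, h₃, hm]; rfl
    · intro r' hr'
      rw [State.setReg_ne _ _ hr'.ne, h₄ _ hr']

/-- The operations under which values grow at most like a product. -/
def _root_.BinOp.Tame : BinOp → Prop
  | .add | .sub | .mul | .div | .mod | .lt | .eq => True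
  | _ => False

/-- The leaves of the expression are at most `X` in absolute value, and it uses only operations
that let the values grow at most like a product. -/
def Bounded (X : ℤ) (σ : AState) : Expr → Prop
  | reg r => |σ.reg r| ≤ X
  | lit z => |z| ≤ X
  | bin o a b => o.Tame ∧ a.Bounded X σ ∧
      b.Bounded X σ
  | load a => a.Bounded X σ ∧ |σ.mem (a.eval σ)| ≤ X

theorem add_eq (a b : Expr) : a + b = bin .add a b := rfl
theorem sub_eq (a b : Expr) : a - b = bin .sub a b := rfl
theorem mul_eq (a b : Expr) : a * b = bin .mul a b := rfl
theorem div_eq (a b : Expr) : a / b = bin .div a b := rfl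
theorem mod_eq (a b : Expr) : a % b = bin .mod a b := rfl

/-- The number of leaves. -/
def leaves : Expr → ℕ
  | reg _ => 1
  | lit _ => 1
  | bin _ a b => a.leaves + b.leaves
  | load a => a.leaves

theorem one_le_leaves (e : Expr) : 1 ≤ e.leaves := by
  induction e <;> simp [leaves] <;> omega

theorem abs_emod_le (x y : ℤ) : |x % y| ≤ max |x| |y| := by
  by_cases hy : y = 0
  · simp [hy]
  · rw [abs_of_nonneg (Int.emod_nonneg x hy)]
    exact (Int.emod_lt_abs x hy).le.trans (le_max_right _ _)

/-- The bounds for the two operands are at least two, and the sum of two such numbers is at most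
their product. So every tame operation multiplies the bounds at worst. -/
theorem abs_eval_le {X : ℤ} (hX : 2 ≤ X) {σ : AState} (e : Expr) (h : e.Bounded X σ) :
    |e.eval σ| ≤ X ^ e.leaves := by
  induction e with
  | reg r => rw [leaves, pow_one]; exact h
  | lit z => rw [leaves, pow_one]; exact h
  | load a iha =>
    refine h.2.trans ?_
    exact le_self_pow₀ (by omega) (by have := a.one_le_leaves; simp [leaves]; omega)
  | bin o a b iha ihb =>
    have ha := iha h.2.1
    have hb := ihb h.2.2
    have h1 : X ≤ X ^ a.leaves := le_self_pow₀ (by omega) (by have := a.one_le_leaves; omega)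
    have h2 : X ≤ X ^ b.leaves := le_self_pow₀ (by omega) (by have := b.one_le_leaves; omega)
    simp only [leaves, pow_add, eval]
    generalize X ^ a.leaves = x at *
    generalize X ^ b.leaves = y at *
    generalize eval σ a = u at *
    generalize eval σ b = v at *
    have hsum : x + y ≤ x * y := by nlinarith
    have hx : x ≤ x * y := by nlinarith
    have hy : y ≤ x * y := by nlinarith
    have ho := h.1
    cases o <;> simp only [BinOp.Tame] at ho <;> simp only [BinOp.eval]
    · exact (abs_add_le _ _).trans (by linarith)
    · exact (abs_sub _ _).trans (by linarith)
    · rw [abs_mul]; exact mul_le_mul ha hb (abs_nonneg _) (by linarith)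
    · exact (Int.abs_ediv_le_abs _ _).trans (by linarith)
    · exact (abs_emod_le u v).trans (max_le (by linarith) (by linarith))
    · split_ifs <;> simp <;> linarith
    · split_ifs <;> simp <;> linarith

theorem Bounded.fits {X : ℤ} (hX : 2 ≤ X) {σ : AState} {e : Expr} (h : e.Bounded X σ) {w : ℕ}
    (hw : X ^ e.leaves < 2 ^ w) : e.Fits w σ := by
  have h0 := (abs_eval_le hX e h).trans_lt hw
  have mono {a b : ℕ} (hab : a ≤ b) : X ^ a ≤ X ^ b := pow_le_pow_right₀ (by omega) hab
  induction e with
  | reg r => exact h0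
  | lit z => exact h0
  | load a iha =>
    exact ⟨iha h.1 hw ((abs_eval_le hX a h.1).trans_lt hw), h0⟩
  | bin o a b iha ihb =>
    have wa := (mono (Nat.le_add_right a.leaves b.leaves)).trans_lt hw
    have wb := (mono (Nat.le_add_left b.leaves a.leaves)).trans_lt hw
    exact ⟨iha h.2.1 wa ((abs_eval_le hX a h.2.1).trans_lt wa),
      ihb h.2.2 wb ((abs_eval_le hX b h.2.2).trans_lt wb), h0⟩

end Expr

/-! ### Statements -/

/-- `reg r := e` -/
def assignReg (r : Fin numLocals) (e : Expr) : Prog :=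
  .seq (e.compile numLocals) (.seq (.const r 0) (.op .add r r numLocals))

/-- `mem[a] := e` -/
def writeMem (a e : Expr) : Prog :=
  .seq (a.compile numLocals) (.seq (e.compile (numLocals + 1)) (.store numLocals (numLocals + 1)))

/-- `for i in {0, …, reg n - 1} do p` -/
def forDo (i n : Fin numLocals) (p : Prog) : Prog :=
  .seq (assignReg i (.lit 0)) (.seq ((Expr.bin .lt (.reg i) (.reg n)).compile numLocals)
    (.loop numLocals (.seq p (.seq (assignReg i (.reg i + .lit 1))
      ((Expr.bin .lt (.reg i) (.reg n)).compile numLocals)))))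

theorem assignReg_deterministic (r : Fin numLocals) (e : Expr) : (assignReg r e).Deterministic := by
  simp [assignReg, Prog.Deterministic, Expr.compile_deterministic]

theorem writeMem_deterministic (a e : Expr) : (writeMem a e).Deterministic := by
  simp [writeMem, Prog.Deterministic, Expr.compile_deterministic]

theorem forDo_deterministic {i n : Fin numLocals} {p : Prog} (h : p.Deterministic) :
    (forDo i n p).Deterministic := by
  simp [forDo, Prog.Deterministic, Expr.compile_deterministic, assignReg_deterministic, h]

theorem assignReg_runs {w : ℕ} (r : Fin numLocals) (e : Expr) {s : State} (h : e.Fits w s.abs) :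
    ∃ s₁, Runs w (e.time + 4) (assignReg r e) s s₁ ∧ s₁.abs = s.abs.set r (e.eval s.abs) := by
  obtain ⟨s₁, h₁, h₂, h₃, h₄⟩ := e.compile_runs le_rfl h
  have hr : numLocals ≠ (r : ℕ) := by have := r.isLt; omega
  have h0 : BinOp.add.eval ((s₁.setReg r 0).reg r) ((s₁.setReg r 0).reg numLocals) =
      e.eval s.abs := by
    rw [State.setReg_self, State.setReg_ne _ _ hr, BinOp.eval, zero_add, h₃]
  have hb : |e.eval s.abs| < 2 ^ w := by
    cases e <;> first | exact h | exact h.2 | exact h.2.2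
  refine ⟨_, h₁.seq ((Runs.const (by simp)).seq (Runs.op (h0 ▸ hb))), ?_⟩
  rw [h0, State.abs_setReg_local, State.abs_setReg_local, h₂]
  simp [AState.set]

theorem Achieves.assign {w : ℕ} {r : Fin numLocals} {e : Expr} {σ : AState} (h : e.Fits w σ) :
    Achieves w (e.time + 4) 0 (assignReg r e) σ (· = σ.set r (e.eval σ)) :=
  Achieves.of_runs fun _ hs => by subst hs; exact assignReg_runs r e h

theorem Achieves.assignMem {w : ℕ} {a e : Expr} {σ : AState} (ha : a.Fits w σ)
    (h : e.Fits w σ) :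
    Achieves w (a.time + e.time + 3) 0 (writeMem a e) σ (· = σ.put (a.eval σ) (e.eval σ)) :=
  Achieves.of_runs fun s hs => by
    subst hs
    obtain ⟨s₁, h₁, h₂, h₃, h₄⟩ := a.compile_runs le_rfl ha
    obtain ⟨s₂, g₁, g₂, g₃, g₄⟩ := e.compile_runs (d := numLocals + 1) (by omega) (h₂.symm ▸ h)
    have hT : a.time + e.time + 3 = a.time + (e.time + 1 + 1) + 1 := by ring
    rw [hT]
    refine ⟨_, h₁.seq (g₁.seq Runs.store), ?_⟩
    rw [g₃, g₄ _ (by omega), h₃, h₂]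
    have hm : s₂.mem = s.mem := by
      have : s₂.abs.mem = s.abs.mem := by rw [g₂, h₂]
      exact this
    ext x
    · show s₂.abs.reg x = _
      rw [g₂, h₂]; rfl
    · show Function.update s₂.mem _ _ x = _
      rw [hm]; rfl

theorem AState.set_reg_self (σ : AState) (r : Fin numLocals) (v : ℤ) : (σ.set r v).reg r = v := by
  simp [AState.set]

theorem AState.set_reg (σ : AState) (r r' : Fin numLocals) (v : ℤ) :
    (σ.set r v).reg r' = if r' = r then v else σ.reg r' := by
  simp [AState.set, Function.update_apply]

/-- The time that a loop needs per iteration besides the body. -/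
abbrev loopOverhead : ℕ := 24

-- `Φ j` bounds the expected penalty at the head of round `j`. A body that tampers with the counter
-- or the limit is charged one; otherwise the guard is recomputed correctly and induction on the
-- number `m` of remaining rounds applies.
open scoped Classical in
theorem loop_expPen {w tb nn : ℕ} {i n : Fin numLocals} (hin : i ≠ n) {p : Prog}
    {Φ : ℕ → AState → ENNReal} (hw : (nn : ℤ) + 1 < 2 ^ w)
    (h : ∀ j < nn, ∀ σ : AState, σ.reg i = j → σ.reg n = nn →
      Triple w tb p σ (fun τ => if τ.reg i = j ∧ τ.reg n = nn then Φ (j + 1) (τ.set i (j + 1 : ℕ))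
        else 1) (Φ j σ)) (m : ℕ) {j : ℕ} (hj : j + m = nn) {s : State}
    (hi : s.abs.reg i = j) (hn : s.abs.reg n = nn)
    (hc : s.reg numLocals = if j < nn then 1 else 0) :
    expPen w (m * (tb + loopOverhead) + 1) ([.loop numLocals (.seq p (.seq (assignReg i
      (.reg i + .lit 1)) ((Expr.bin .lt (.reg i) (.reg n)).compile numLocals)))], s)
        (fun s => Φ nn s.abs) ≤ Φ j s.abs := by
  induction m generalizing j s with
  | zero =>
    obtain rfl : j = nn := by omega
    rw [Nat.zero_mul, Nat.zero_add, expPen_succ_of_pure (o := some ([], s)), expPenOpt,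
      expPen_halted]
    · exact min_le_left _ _
    · simp [step, hc]
  | succ m ih =>
    have hjn : j < nn := by omega
    rw [if_pos hjn] at hc
    rw [expPen_succ_of_pure (o := some ([_, _], s)) _ (by simp [step, hc]; rfl), expPenOpt]
    set L := Prog.loop numLocals (.seq p (.seq (assignReg i
      (.reg i + .lit 1)) ((Expr.bin .lt (.reg i) (.reg n)).compile numLocals))) with hL
    -- The overhead of 24 steps: one for the loop test, one for unfolding the sequence, 21 for the
    -- increment and the new guard, and one to spare.
    have e1 : (m + 1) * (tb + loopOverhead) = (tb + (22 + (m * (tb + loopOverhead) + 1))) + 1 := by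
      simp only [loopOverhead]; ring
    rw [e1, expPen_seq]
    refine le_trans ?_ (h j hjn s.abs hi hn s rfl)
    refine expPen_append (fun s₁ => ?_) [p] s
    dsimp only
    split_ifs with hs₁
    swap
    · exact expPen_le_one _ _ _ _
    have bd1 : |(j : ℤ)| < 2 ^ w := by rw [abs_of_nonneg (by positivity)]; linarith [hjn]
    have bd2 : |(j : ℤ) + 1| < 2 ^ w := by rw [abs_of_nonneg (by positivity)]; omega
    have bd4 : |(nn : ℤ)| < 2 ^ w := by rw [abs_of_nonneg (by positivity)]; omega
    have bd3 : (1 : ℤ) < 2 ^ w := by omega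
    obtain ⟨s₂, r₂, a₂⟩ := assignReg_runs (w := w) (s := s₁) i (.reg i + .lit 1) (by
      refine ⟨?_, ?_, ?_⟩
      · simpa [Expr.Fits, hs₁.1] using bd1
      · simpa [Expr.Fits] using bd3
      · simpa [Expr.eval, BinOp.eval, hs₁.1] using bd2)
    have v₂ : (Expr.reg i + Expr.lit 1).eval s₁.abs = (j + 1 : ℕ) := by
      show s₁.abs.reg i + 1 = _
      rw [hs₁.1]; push_cast; rfl
    rw [v₂] at a₂
    have i₂ : s₂.abs.reg i = (j + 1 : ℕ) := by rw [a₂, AState.set_reg_self]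
    have n₂ : s₂.abs.reg n = nn := by
      rw [a₂, AState.set_reg, if_neg hin.symm, hs₁.2]
    have v₃ : (Expr.bin .lt (.reg i) (.reg n)).eval s₂.abs = if j + 1 < nn then 1 else 0 := by
      simp only [Expr.eval, BinOp.eval, i₂, n₂, Nat.cast_lt]
    obtain ⟨s₃, r₃, a₃, h₃, -⟩ := Expr.compile_runs (w := w) (s := s₂)
      (.bin .lt (.reg i) (.reg n)) (d := numLocals) le_rfl (by
      refine ⟨?_, ?_, ?_⟩
      · simp only [Expr.Fits, i₂]; push_cast; exact bd2
      · simpa [Expr.Fits, n₂] using bd4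
      · show |(Expr.bin .lt (.reg i) (.reg n)).eval s₂.abs| < _
        rw [v₃]; split_ifs <;> simp [bd3])
    have R := r₂.seq r₃
    have T : (Expr.reg i + Expr.lit 1).time + 4 +
        (Expr.bin .lt (.reg i) (.reg n)).time + 1 = 21 := rfl
    rw [T] at R
    have hR := R [L] (m * (tb + loopOverhead) + 1) (fun s => Φ nn s.abs)
    have e2 : 22 + (m * (tb + loopOverhead) + 1) = (m * (tb + loopOverhead) + 1) + 21 + 1 := by ring
    rw [e2]
    refine (expPen_succ_le _ _ _ _).trans ?_
    rw [hR, ← a₂, ← a₃]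
    exact ih (by omega) (a₃.symm ▸ i₂) (a₃.symm ▸ n₂) (by rw [h₃, v₃])

open scoped Classical in
theorem Triple.forLoop {w tb nn : ℕ} {i n : Fin numLocals} (hin : i ≠ n) {p : Prog}
    {Φ : ℕ → AState → ENNReal} (hw : (nn : ℤ) + 1 < 2 ^ w)
    (h : ∀ j < nn, ∀ σ : AState, σ.reg i = j → σ.reg n = nn →
      Triple w tb p σ (fun τ => if τ.reg i = j ∧ τ.reg n = nn then Φ (j + 1) (τ.set i (j + 1 : ℕ))
        else 1) (Φ j σ)) {σ : AState} (hn : σ.reg n = nn) :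
    Triple w (nn * (tb + loopOverhead) + loopOverhead) (forDo i n p) σ (Φ nn)
      (Φ 0 (σ.set i 0)) := fun s hs => by
  subst hs
  have bd3 : (1 : ℤ) < 2 ^ w ∨ nn = 0 := by omega
  obtain ⟨s₂, r₂, a₂⟩ := assignReg_runs (w := w) (s := s) i (.lit 0) (by simp [Expr.Fits])
  have i₂ : s₂.abs.reg i = (0 : ℕ) := by rw [a₂, AState.set_reg_self]; rfl
  have n₂ : s₂.abs.reg n = nn := by
    rw [a₂, AState.set_reg, if_neg hin.symm, hn]
  have v₃ : (Expr.bin .lt (.reg i) (.reg n)).eval s₂.abs = if 0 < nn then 1 else 0 := by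
    simp only [Expr.eval, BinOp.eval, i₂, n₂, Nat.cast_lt]
  obtain ⟨s₃, r₃, a₃, h₃, -⟩ := Expr.compile_runs (w := w) (s := s₂)
    (.bin .lt (.reg i) (.reg n)) (d := numLocals) le_rfl (by
    refine ⟨?_, ?_, ?_⟩
    · simp [Expr.Fits, i₂]
    · simp only [Expr.Fits, n₂]; rw [abs_of_nonneg (by positivity)]; omega
    · show |(Expr.bin .lt (.reg i) (.reg n)).eval s₂.abs| < _
      rw [v₃]; split_ifs with hnn
      · rw [abs_one]; omega
      · simp)
  have T1 : (Expr.lit 0).time + 4 = 5 := rfl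
  have T2 : (Expr.bin .lt (.reg i) (.reg n)).time = 9 := rfl
  rw [T1] at r₂
  rw [T2] at r₃
  refine (expPen_antitone (t := nn * (tb + loopOverhead) + 1 + 9 + 1 + 5 + 1)
    (by simp only [loopOverhead]; omega) _ _).trans ?_
  unfold forDo
  rw [expPen_seq, r₂, expPen_seq, r₃]
  have e : Φ 0 (s.abs.set i 0) = Φ 0 s₃.abs := by rw [a₃, a₂]; rfl
  rw [e]
  exact loop_expPen hin hw h nn (by omega) (a₃.symm ▸ i₂) (a₃.symm ▸ n₂) (by rw [h₃, v₃])

/-- Union bound over the rounds: the potential is `(nn - j) * ε` while the invariant holds before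
round `j`, and one when it is violated. -/
theorem Achieves.forLoop {w tb nn : ℕ} {ε : ENNReal} {i n : Fin numLocals} (hin : i ≠ n)
    {p : Prog} {Inv : ℕ → AState → Prop} (hw : (nn : ℤ) + 1 < 2 ^ w)
    (h : ∀ j < nn, ∀ σ : AState, σ.reg i = j → σ.reg n = nn → Inv j σ →
      Achieves w tb ε p σ (fun τ => τ.reg i = j ∧ τ.reg n = nn ∧ Inv (j + 1) (τ.set i (j + 1 : ℕ))))
    {σ : AState} (hn : σ.reg n = nn) (h0 : Inv 0 (σ.set i 0)) :
    Achieves w (nn * (tb + loopOverhead) + loopOverhead) (nn * ε) (forDo i n p) σ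
      (Inv nn) := by
  classical
  have := Triple.forLoop (w := w) (tb := tb) (p := p)
    (Φ := fun j σ => if Inv j σ then ((nn - j : ℕ) : ENNReal) * ε else 1) hin hw
    (fun j hj σ hi hn' => ?_) hn
  · refine Triple.mono this le_rfl (by simp [h0]) fun σ => ?_
    unfold failInd; split_ifs <;> simp
  · split_ifs with hI
    · have e : ((nn - j : ℕ) : ENNReal) * ε = ε + ((nn - (j + 1) : ℕ) : ENNReal) * ε := by
        rw [show nn - j = 1 + (nn - (j + 1)) by omega]; push_cast; ring
      rw [e]
      refine Triple.mono (h j hj σ hi hn' hI).triple le_rfl le_rfl fun τ => ?_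
      split_ifs <;> simp_all
    · exact Triple.of_one_le le_rfl

/-! ### Loops that filled arrays -/

/-- Write `v 0, …, v (n - 1)` to the cells `base, …, base + n - 1`. -/
def filled (μ : ℤ → ℤ) (base : ℤ) (n : ℕ) (v : ℕ → ℤ) (x : ℤ) : ℤ :=
  if base ≤ x ∧ x < base + n then v (x - base).toNat else μ x

theorem filled_zero (μ : ℤ → ℤ) (base : ℤ) (v : ℕ → ℤ) : filled μ base 0 v = μ := by
  funext x; simp [filled]

theorem filled_succ (μ : ℤ → ℤ) (base : ℤ) (n : ℕ) (v : ℕ → ℤ) :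
    filled μ base (n + 1) v = Function.update (filled μ base n v) (base + n) (v n) := by
  funext x
  rcases eq_or_ne x (base + n) with rfl | hx
  · simp [filled]
  · rw [Function.update_of_ne hx]
    unfold filled
    congr 1
    push_cast
    simp only [eq_iff_iff]
    omega

theorem filled_congr {μ : ℤ → ℤ} {base : ℤ} {n : ℕ} {v v' : ℕ → ℤ} (h : ∀ j < n, v j = v' j) :
    filled μ base n v = filled μ base n v' := by
  funext x
  unfold filled
  split_ifs with hx
  · exact h _ (by omega)
  · rfl

theorem filled_mem (μ : ℤ → ℤ) {base : ℤ} {n : ℕ} (v : ℕ → ℤ) {j : ℕ} (hj : j < n) :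
    filled μ base n v (base + j) = v j := by
  simp [filled, hj]

theorem filled_not_mem (μ : ℤ → ℤ) {base : ℤ} {n : ℕ} (v : ℕ → ℤ) {x : ℤ}
    (h : x < base ∨ base + n ≤ x) : filled μ base n v x = μ x := by
  unfold filled; rw [if_neg]; omega

/-- Values up to `X` can be combined in expressions with word length `w`. -/
def Wide (X : ℤ) (w : ℕ) : Prop := 2 ≤ X ∧ X ^ 40 < 2 ^ w

/-- The expressions of the programs below have fixed shapes with at most 40 leaves, so one
comparison of `X ^ 40` with the word size settles all overflow questions. -/
theorem Expr.Bounded.fits_of_wide {X : ℤ} {w : ℕ} (hX : Wide X w) {σ : AState} {e : Expr}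
    (h : e.Bounded X σ) (hl : e.leaves ≤ 40 := by decide) : e.Fits w σ :=
  h.fits hX.1 ((pow_le_pow_right₀ (by have := hX.1; omega) hl).trans_lt hX.2)

theorem Wide.lt {X : ℤ} {w : ℕ} (hX : Wide X w) : 2 * X < 2 ^ w := by
  refine lt_of_le_of_lt ?_ hX.2
  calc 2 * X ≤ X ^ 2 := by nlinarith [hX.1]
    _ ≤ X ^ 40 := pow_le_pow_right₀ (by linarith [hX.1]) (by norm_num)

theorem Achieves.forLoop_assignMem {w nn : ℕ} {i n : Fin numLocals} (hin : i ≠ n) {a e : Expr}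
    {σ : AState} (hw : (nn : ℤ) + 1 < 2 ^ w) (hn : σ.reg n = nn) (μ : ℕ → ℤ → ℤ)
    (h0 : μ 0 = σ.mem)
    (h : ∀ j < nn, ∀ τ, τ = (⟨Function.update σ.reg i j, μ j⟩ : AState) →
      a.Fits w τ ∧ e.Fits w τ ∧
        μ (j + 1) = Function.update (μ j) (a.eval τ) (e.eval τ)) :
    Achieves w (nn * (a.time + e.time + 3 + loopOverhead) + loopOverhead) 0
      (forDo i n (writeMem a e)) σ (· = ⟨Function.update σ.reg i nn, μ nn⟩) := by
  have := Achieves.forLoop (w := w) (tb := a.time + e.time + 3) (ε := 0) (p := writeMem a e) hin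
    (Inv := fun j τ => τ = ⟨Function.update σ.reg i j, μ j⟩) hw (fun j hj τ _ hn' hτ => ?_) hn ?_
  · rwa [mul_zero] at this
  · obtain ⟨ha, he, hμ⟩ := h j hj τ hτ
    refine (Achieves.assignMem ha he).mono le_rfl le_rfl ?_
    rintro _ rfl
    subst hτ
    refine ⟨by simp [AState.put], ?_, ?_⟩
    · simpa [AState.put] using hn'
    · rw [hμ]; simp [AState.put, AState.set]
  · simp [AState.set, h0]

theorem Achieves.fill {w nn : ℕ} {i n : Fin numLocals} (hin : i ≠ n) {a e : Expr}
    {σ : AState} (hw : (nn : ℤ) + 1 < 2 ^ w) (hn : σ.reg n = nn) (base : ℤ) (v : ℕ → ℤ)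
    (h : ∀ j < nn, ∀ τ, τ = (⟨Function.update σ.reg i j, filled σ.mem base j v⟩ : AState) →
      a.Fits w τ ∧ e.Fits w τ ∧ a.eval τ = base + j ∧ e.eval τ = v j) :
    Achieves w (nn * (a.time + e.time + 3 + loopOverhead) + loopOverhead) 0
      (forDo i n (writeMem a e)) σ
      (· = ⟨Function.update σ.reg i nn, filled σ.mem base nn v⟩) := by
  refine Achieves.forLoop_assignMem hin hw hn (fun j => filled σ.mem base j v)
    (filled_zero _ _ _) fun j hj τ hτ => ?_
  obtain ⟨h1, h2, h3, h4⟩ := h j hj τ hτ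
  exact ⟨h1, h2, by rw [filled_succ, h3, h4]⟩

theorem Achieves.fill_of_bounded {X : ℤ} {w nn : ℕ} (hX : Wide X w) (c : ℕ)
    {i n : Fin numLocals} {a e : Expr} {σ : AState} (hn : σ.reg n = nn) (hnX : (nn : ℤ) ≤ X)
    (base : ℤ) (v : ℕ → ℤ)
    (h : ∀ j < nn, ∀ τ, τ = (⟨Function.update σ.reg i j, filled σ.mem base j v⟩ : AState) →
      a.Bounded X τ ∧ e.Bounded X τ ∧ a.eval τ = base + j ∧ e.eval τ = v j)
    (hin : i ≠ n := by decide) (hla : a.leaves ≤ 40 := by decide)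
    (hle : e.leaves ≤ 40 := by decide) (hc : a.time + e.time + 3 + loopOverhead ≤ c := by decide) :
    Achieves w (nn * c + loopOverhead) 0 (forDo i n (writeMem a e)) σ
      (· = ⟨Function.update σ.reg i nn, filled σ.mem base nn v⟩) := by
  refine (Achieves.fill hin ?_ hn base v fun j hj τ hτ => ?_).mono
    (Nat.add_le_add_right (Nat.mul_le_mul_left _ hc) _) le_rfl fun _ h => h
  · have := hX.lt; have := hX.1; omega
  · obtain ⟨h1, h2, h3⟩ := h j hj τ hτ
    exact ⟨h1.fits_of_wide hX hla, h2.fits_of_wide hX hle, h3⟩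

theorem Achieves.assign_of_bounded {X : ℤ} {w : ℕ} (hX : Wide X w) (c : ℕ) {r : Fin numLocals}
    {e : Expr} {σ : AState} {v : ℤ} (he : e.Bounded X σ) (hv : e.eval σ = v)
    (hle : e.leaves ≤ 40 := by decide) (hc : e.time + 4 ≤ c := by decide) :
    Achieves w c 0 (assignReg r e) σ (· = σ.set r v) := by
  refine (Achieves.assign (he.fits_of_wide hX hle)).mono hc le_rfl ?_
  rintro _ rfl
  rw [hv]

/-! ### Arrays of random numbers -/

/-- `mem[a] :=` a random element of `{0, …, reg r}` -/
def drawMem (a : Expr) (r : Fin numLocals) : Prog :=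
  .seq (a.compile numLocals) (.seq (.rand (numLocals + 1) r) (.store numLocals (numLocals + 1)))

theorem Triple.randMem {w N : ℕ} (hN : 1 ≤ N) {a : Expr} {r : Fin numLocals} {σ : AState}
    (hr : σ.reg r = (N : ℤ) - 1) (hw : (N : ℤ) < 2 ^ w) (ha : a.Fits w σ)
    {Φ : AState → ENNReal} :
    Triple w (a.time + 4) (drawMem a r) σ Φ
      ((∑ v : Fin N, Φ (σ.put (a.eval σ) (v : ℕ))) / N) := fun s hs => by
  subst hs
  obtain ⟨s₁, h₁, h₂, h₃, h₄⟩ := a.compile_runs le_rfl ha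
  have e1 : a.time + 4 = 3 + a.time + 1 := by ring
  rw [drawMem, e1, expPen_seq, h₁, expPen_seq, expPen_succ, step, PMF.expect_map]
  change PMF.expect (PMF.bind _ fun v => PMF.pure _) _ ≤ _
  simp only [PMF.expect_bind, PMF.expect_pure]
  have hr₁ : (s₁.reg r).toNat + 1 = N := by
    have : s₁.reg r = (N : ℤ) - 1 := by
      rw [← State.abs_reg, h₂, hr]
    omega
  have key (v : Fin N) : expPenOpt w 1 (fun s => Φ s.abs) (Option.map
      (Prod.mk [Prog.store numLocals (numLocals + 1)]) (s₁.write w (numLocals + 1) ((v : ℕ) : ℤ))) ≤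
        Φ (s.abs.put (a.eval s.abs) (v : ℕ)) := by
    have hv : |((v : ℕ) : ℤ)| < 2 ^ w := by
      rw [abs_of_nonneg (by positivity)]
      have := v.isLt
      omega
    rw [State.write_of_lt hv, Option.map, expPenOpt, Runs.store.expPen_single]
    refine (min_le_left _ _).trans (le_of_eq ?_)
    congr 1
    rw [← h₃, ← h₂, State.setReg_ne _ _ (by omega : numLocals ≠ numLocals + 1),
      State.setReg_self, State.setReg_mem]
    ext x
    · exact State.setReg_ne _ _ (by have := x.isLt; omega)
    · rfl
  -- The type of the drawn value depends on the content of a register, so its size is generalized to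
  -- `M` before it is identified with `N`.
  have : ∀ (M : ℕ) [Nonempty (Fin M)] (_ : M = N), (PMF.uniformOfFintype (Fin M)).expect (fun v =>
      expPenOpt w 1 (fun s => Φ s.abs) (Option.map
      (Prod.mk [Prog.store numLocals (numLocals + 1)]) (s₁.write w (numLocals + 1) ((v : ℕ) : ℤ)))) ≤
      ((∑ v : Fin N, Φ (s.abs.put (a.eval s.abs) (v : ℕ))) / N) := by
    rintro M _ rfl
    rw [PMF.expect, tsum_fintype, ENNReal.div_eq_inv_mul, Finset.mul_sum]
    refine Finset.sum_le_sum fun v _ => ?_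
    rw [PMF.uniformOfFintype_apply, Fintype.card_fin]
    exact mul_le_mul_right (key v) _
  exact this _ hr₁

/-- A function on `Fin N` as a function on the natural numbers. -/
def extendFin {N : ℕ} (F : Fin N → Fin N) (j : ℕ) : ℤ := if h : j < N then (F ⟨j, h⟩ : ℕ) else 0

open scoped Classical in
/-- The number of bad functions that agree with `F` on the first `j` arguments. -/
noncomputable def badExtensions {N : ℕ} (Good : (Fin N → Fin N) → Prop) (j : ℕ)
    (F : Fin N → Fin N) : ℕ :=
  (Finset.univ.filter fun G : Fin N → Fin N => ¬ Good G ∧ ∀ k : Fin N, k < j → G k = F k).card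

/-- Bad functions are sorted by their value at `j`. Divided by `N ^ (N - j)`, this says that the
conditional probability of ending badly is the average of its values after the next draw. -/
theorem badExtensions_eq_sum {N : ℕ} (Good : (Fin N → Fin N) → Prop) (j : Fin N)
    (F : Fin N → Fin N) :
    badExtensions Good j F = ∑ v : Fin N, badExtensions Good (j + 1) (Function.update F j v) := by
  classical
  unfold badExtensions
  rw [Finset.card_eq_sum_card_fiberwise (f := fun G => G j) (t := Finset.univ) (by simp)]
  refine Finset.sum_congr rfl fun v _ => ?_
  congr 1
  ext G
  simp only [Finset.mem_filter, Finset.mem_univ, true_and]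
  constructor
  · rintro ⟨⟨h1, h2⟩, h3⟩
    refine ⟨h1, fun k hk => ?_⟩
    by_cases hkj : k = j
    · subst hkj; simpa using h3
    · rw [Function.update_of_ne hkj]
      exact h2 k (by have : (k : ℕ) ≠ j := fun h => hkj (Fin.ext h); omega)
  · rintro ⟨h1, h2⟩
    refine ⟨⟨h1, fun k hk => ?_⟩, ?_⟩
    · have hkj : k ≠ j := by rintro rfl; omega
      rw [h2 k (by omega), Function.update_of_ne hkj]
    · rw [h2 j (by omega), Function.update_self]

-- The potential after `j` draws is the probability that a uniformly random completion is bad. By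
-- `badExtensions_eq_sum` its expectation does not change from draw to draw, so it can be bounded by
-- its value at the start, the proportion of bad functions.
open scoped Classical in
theorem Achieves.randFill {w N : ℕ} (hN : 1 ≤ N) {i n r : Fin numLocals} (hin : i ≠ n)
    (hir : i ≠ r) {a : Expr} {σ : AState} (hw : (N : ℤ) + 1 < 2 ^ w) (hn : σ.reg n = N)
    (hr : σ.reg r = (N : ℤ) - 1) (base : ℤ) (Good : (Fin N → Fin N) → Prop)
    (h : ∀ j < N, ∀ (v : ℕ → ℤ) (τ : AState),
      τ = (⟨Function.update σ.reg i j, filled σ.mem base j v⟩ : AState) →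
      a.Fits w τ ∧ a.eval τ = base + j) :
    Achieves w (N * (a.time + 4 + loopOverhead) + loopOverhead)
      ((Finset.univ.filter fun F => ¬ Good F).card / (N : ENNReal) ^ N)
      (forDo i n (drawMem a r)) σ (fun τ => ∃ F : Fin N → Fin N, Good F ∧
        τ = ⟨Function.update σ.reg i N, filled σ.mem base N (extendFin F)⟩) := by
  set st : ℕ → (Fin N → Fin N) → AState := fun j F =>
    ⟨Function.update σ.reg i j, filled σ.mem base j (extendFin F)⟩ with hst
  -- The state does not fix `F` beyond its first `j` values, hence the infimum over all
  -- representations; it is infinite for states without any.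
  set Φ : ℕ → AState → ENNReal := fun j τ => ⨅ F : Fin N → Fin N, ⨅ _ : τ = st j F,
    (badExtensions Good j F : ENNReal) / (N : ENNReal) ^ (N - j) with hΦ
  have hN0 : (N : ENNReal) ≠ 0 := by simp; omega
  have := Triple.forLoop (w := w) (tb := a.time + 4) (p := drawMem a r) (Φ := Φ) hin hw
    (fun j hj τ hi hn' => ?_) hn
  · refine Triple.mono this le_rfl ?_ fun τ => ?_
    · have F0 : Fin N → Fin N := fun _ => ⟨0, hN⟩
      refine (iInf₂_le F0 ?_).trans (le_of_eq ?_)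
      · simp [hst, AState.set, filled_zero]
      · simp [badExtensions]
    · refine le_iInf₂ fun F hF => ?_
      by_cases hG : Good F
      · rw [failInd, if_pos ⟨F, hG, hF⟩]; exact zero_le
      · refine (show _ ≤ (1 : ENNReal) by unfold failInd; split_ifs <;> simp).trans ?_
        -- A bad `F` is a bad extension of itself, so the final potential dominates the failure
        -- indicator.
        have : 1 ≤ badExtensions Good N F := by
          rw [badExtensions, Nat.one_le_iff_ne_zero, ← Nat.pos_iff_ne_zero, Finset.card_pos]
          exact ⟨F, by simp [hG]⟩
        simpa using this
  · intro s hs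
    refine le_iInf₂ fun F hF => ?_
    obtain ⟨h1, h2⟩ := h j hj _ τ hF
    have hr' : τ.reg r = (N : ℤ) - 1 := by rw [hF]; simp [hst, hir.symm, hr]
    refine (Triple.randMem (Φ := fun τ => if τ.reg i = j ∧ τ.reg n = N then
      Φ (j + 1) (τ.set i (j + 1 : ℕ)) else 1) hN hr' (by omega) h1 s hs).trans ?_
    rw [show (badExtensions Good j F : ENNReal) =
      ∑ v : Fin N, (badExtensions Good (j + 1) (Function.update F ⟨j, hj⟩ v) : ENNReal) by
        rw [← Nat.cast_sum]; exact_mod_cast badExtensions_eq_sum Good ⟨j, hj⟩ F]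
    rw [show N - j = (N - (j + 1)) + 1 by omega, pow_succ, ENNReal.div_eq_inv_mul,
      ENNReal.div_eq_inv_mul, ENNReal.mul_inv (by simp) (by simp), mul_comm (_ ^ _)⁻¹, mul_assoc]
    refine mul_le_mul_right ?_ _
    rw [Finset.mul_sum]
    refine Finset.sum_le_sum fun v _ => ?_
    have hτ : (τ.put (a.eval τ) (v : ℕ)).set i (j + 1 : ℕ) =
        st (j + 1) (Function.update F ⟨j, hj⟩ v) := by
      rw [hF] at h2 ⊢
      rw [h2]
      simp only [hst, AState.put, AState.set, Function.update_idem, filled_succ]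
      congr 1
      congr 1
      · refine filled_congr fun k hk => ?_
        have : k < N := by omega
        simp [extendFin, this, hk.ne]
      · simp [extendFin, hj]
    rw [if_pos]
    · rw [hτ]
      exact iInf₂_le_of_le _ rfl (le_of_eq ENNReal.div_eq_inv_mul)
    · exact ⟨hi, hn'⟩

/-! ### Subroutines -/

/-- All registers that occur in the program are below `R`. -/
def Prog.UsesBelow (R : ℕ) : Prog → Prop
  | .skip => True
  | .const r _ => r < R
  | .op _ r a b => r < R ∧ a < R ∧ b < R
  | .load r a => r < R ∧ a < R
  | .store a r => a < R ∧ r < R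
  | .rand r a => r < R ∧ a < R
  | .seq p q => p.UsesBelow R ∧ q.UsesBelow R
  | .ite r p q => r < R ∧ p.UsesBelow R ∧ q.UsesBelow R
  | .loop r p => r < R ∧ p.UsesBelow R

theorem Prog.UsesBelow.mono {R R' : ℕ} (h : R ≤ R') {p : Prog} (hp : p.UsesBelow R) :
    p.UsesBelow R' := by
  induction p <;> simp only [UsesBelow] at hp ⊢ <;> grind

theorem Prog.exists_usesBelow (p : Prog) : ∃ R, p.UsesBelow R := by
  induction p with
  | skip => exact ⟨0, trivial⟩
  | const r z => exact ⟨r + 1, by simp [UsesBelow]⟩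
  | op o r a b => exact ⟨r + a + b + 1, by simp only [UsesBelow]; omega⟩
  | load r a => exact ⟨r + a + 1, by simp only [UsesBelow]; omega⟩
  | store r a => exact ⟨r + a + 1, by simp only [UsesBelow]; omega⟩
  | rand r a => exact ⟨r + a + 1, by simp only [UsesBelow]; omega⟩
  | seq p q hp hq =>
    obtain ⟨R, hR⟩ := hp
    obtain ⟨R', hR'⟩ := hq
    exact ⟨R + R', hR.mono (by omega), hR'.mono (by omega)⟩
  | ite r p q hp hq =>
    obtain ⟨R, hR⟩ := hp
    obtain ⟨R', hR'⟩ := hq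
    exact ⟨R + R' + r + 1, by omega, hR.mono (by omega), hR'.mono (by omega)⟩
  | loop r p hp =>
    obtain ⟨R, hR⟩ := hp
    exact ⟨R + r + 1, by omega, hR.mono (by omega)⟩

/-- The register of a calling program that holds register `r` of a subroutine. -/
abbrev innerReg (r : ℕ) : ℕ := r + (numLocals + 1)

/-- The program as a subroutine, with its memory shifted by the content of register `b`. -/
def Prog.relocate (b : Fin numLocals) : Prog → Prog
  | .skip => .skip
  | .const r z => .const (innerReg r) z
  | .op o r x y => .op o (innerReg r) (innerReg x) (innerReg y)
  | .load r a => .seq (.op .add numLocals b (innerReg a)) (.load (innerReg r) numLocals)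
  | .store a r => .seq (.op .add numLocals b (innerReg a)) (.store numLocals (innerReg r))
  | .rand r a => .rand (innerReg r) (innerReg a)
  | .seq p q => .seq (p.relocate b) (q.relocate b)
  | .ite r p q => .ite (innerReg r) (p.relocate b) (q.relocate b)
  | .loop r p => .loop (innerReg r) (p.relocate b)

theorem Prog.relocate_deterministic {b : Fin numLocals} {p : Prog} (h : p.Deterministic) :
    (p.relocate b).Deterministic := by
  induction p <;> simp_all [relocate, Deterministic]

/-- The state `s` of a subroutine with addresses and words below `B` in absolute value, as a part
of the state `s'` of the calling program; `σ` is the state before the call. -/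
structure Simulates (R : ℕ) (O B : ℤ) (σ : AState) (s s' : State) : Prop where
  reg : ∀ r < R, s'.reg (innerReg r) = s.reg r
  lt : ∀ r < R, |s.reg r| < B
  locals : s'.abs.reg = σ.reg
  inside : ∀ a, |a| < B → s'.mem (O + a) = s.mem a
  outside : ∀ x, B ≤ |x - O| → s'.mem x = σ.mem x

theorem Simulates.setReg {R : ℕ} {O B : ℤ} {σ : AState} {s s' : State}
    (h : Simulates R O B σ s s') (r : ℕ) {v : ℤ} (hv : |v| < B) :
    Simulates R O B σ (s.setReg r v) (s'.setReg (innerReg r) v) where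
  reg r' hr' := by
    by_cases hrr : r' = r
    · subst hrr; simp
    · rw [State.setReg_ne _ _ hrr, State.setReg_ne _ _ (by simp [innerReg, hrr]), h.reg r' hr']
  lt r' hr' := by
    by_cases hrr : r' = r
    · subst hrr; simpa
    · rw [State.setReg_ne _ _ hrr]; exact h.lt r' hr'
  locals := by rw [State.abs_setReg_of_le _ _ (by simp [innerReg]; omega), h.locals]
  inside := h.inside
  outside := h.outside

theorem Simulates.scratch {R : ℕ} {O B : ℤ} {σ : AState} {s s' : State}
    (h : Simulates R O B σ s s') (v : ℤ) :
    Simulates R O B σ s (s'.setReg numLocals v) where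
  reg r' hr' := by rw [State.setReg_ne _ _ (by simp [innerReg]; omega), h.reg r' hr']
  lt := h.lt
  locals := by rw [State.abs_setReg_of_le _ _ le_rfl, h.locals]
  inside := h.inside
  outside := h.outside

theorem Simulates.store {R : ℕ} {O B : ℤ} {σ : AState} {s s' : State}
    (h : Simulates R O B σ s s') {a v : ℤ} (ha : |a| < B) :
    Simulates R O B σ ⟨s.reg, Function.update s.mem a v⟩
      ⟨s'.reg, Function.update s'.mem (O + a) v⟩ where
  reg := h.reg
  lt := h.lt
  locals := h.locals
  inside a' ha' := by
    by_cases haa : a' = a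
    · subst haa; simp
    · simp only
      rw [Function.update_of_ne haa, Function.update_of_ne (by omega), h.inside a' ha']
  outside x hx := by
    have : x ≠ O + a := by rintro rfl; rw [add_sub_cancel_left] at hx; omega
    simp only
    rw [Function.update_of_ne this, h.outside x hx]

/-- The two distributions live on different types and can be compared only after pushing them
forward to `ℕ`. -/
theorem uniform_expect_congr {z z' : ℤ} (h : z = z') (g : ℕ → ENNReal) :
    (do let a ← PMF.uniformOfFintype (Fin (z.toNat + 1)); pure (a : ℕ) : PMF ℕ).expect g =
      (do let a ← PMF.uniformOfFintype (Fin (z'.toNat + 1)); pure (a : ℕ) : PMF ℕ).expect g := by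
  subst h; rfl

/-- A memory access costs three steps (unfolding, adding the offset, accessing), every other
instruction one. As long as the simulated machine does not crash, its registers hold words below `2
^ w ≤ B`, so its addresses never leave the region around `O`. -/
theorem Simulates.expPen_le {R : ℕ} {O B : ℤ} {σ : AState} {b : Fin numLocals} {w w' : ℕ}
    (hb : σ.reg b = O) (hw : (2 : ℤ) ^ w ≤ B) (hw' : |O| + B ≤ 2 ^ w')
    {G : State → ENNReal} {G' : State → ENNReal}
    (hG : ∀ s s', Simulates R O B σ s s' → G' s' ≤ G s) {t : ℕ} {K : List Prog}
    (hK : ∀ p ∈ K, p.UsesBelow R) {s s' : State} (h : Simulates R O B σ s s') :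
    expPen w' (3 * t) (K.map (Prog.relocate b), s') G' ≤ expPen w t (K, s) G := by
  have hww : (2 : ℤ) ^ w ≤ 2 ^ w' := by have := abs_nonneg O; linarith
  have hB : 0 < B := lt_of_lt_of_le (by positivity) hw
  induction t generalizing K s s' with
  | zero =>
    cases K with
    | nil =>
      rw [expPen_halted, List.map_nil, expPen_halted]
      exact min_le_min_right _ (hG s s' h)
    | cons q K => rw [expPen_zero w (q :: K, s)]; exact expPen_le_one _ _ _ _
  | succ t ih =>
    cases K with
    | nil =>
      rw [expPen_halted, List.map_nil, expPen_halted]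
      exact min_le_min_right _ (hG s s' h)
    | cons q K =>
      have hKK : ∀ p ∈ K, p.UsesBelow R := fun p hp => hK p (List.mem_cons_of_mem _ hp)
      have hq : q.UsesBelow R := hK q List.mem_cons_self
      have slow (n : ℕ) (hn : n ≤ 3) {c : Config} :
          expPen w' (3 * (t + 1)) c G' ≤ expPen w' (3 * t + n) c G' :=
        expPen_antitone (by omega) _ _
      have write (r : ℕ) (v : ℤ) (s₂ : State) (hs₂ : Simulates R O B σ s s₂) :
          expPenOpt w' (3 * t) G' ((s₂.write w' (innerReg r) v).map
            (Prod.mk (K.map (Prog.relocate b)))) ≤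
          expPenOpt w t G ((s.write w r v).map (Prod.mk K)) := by
        by_cases hv : |v| < 2 ^ w
        · rw [State.write_of_lt hv, State.write_of_lt (hv.trans_le hww)]
          exact ih hKK (hs₂.setReg r (hv.trans_le hw))
        -- A crash of the simulated machine has penalty one, so nothing is required of the calling
        -- machine from here on.
        · rw [show s.write w r v = none from if_neg hv]
          exact expPenOpt_le_one _ _ _ _
      have address (a : ℕ) (ha : a < R) : BinOp.add.eval (s'.reg b) (s'.reg (innerReg a)) =
          O + s.reg a := by
        rw [h.reg a ha, ← State.abs_reg, h.locals, hb]; rfl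
      have addr_lt (a : ℕ) (ha : a < R) : |O + s.reg a| < 2 ^ w' :=
        (abs_add_le _ _).trans_lt (by have := h.lt a ha; linarith)
      rw [List.map_cons]
      cases q with
      | skip =>
        refine (slow 1 (by omega)).trans ?_
        rw [expPen_succ_of_pure (o := some (K.map (Prog.relocate b), s')) _ (by simp [step, Prog.relocate]),
          expPen_succ_of_pure (o := some (K, s)) _ (by simp [step])]
        exact ih hKK h
      | const r z =>
        refine (slow 1 (by omega)).trans ?_
        rw [expPen_succ, expPen_succ, Prog.relocate, step, step, PMF.expect_pure, PMF.expect_pure]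
        exact write r z s' h
      | op o r x y =>
        refine (slow 1 (by omega)).trans ?_
        rw [expPen_succ, expPen_succ, Prog.relocate, step, step, PMF.expect_pure, PMF.expect_pure,
          h.reg x hq.2.1, h.reg y hq.2.2]
        exact write r _ s' h
      | load r a =>
        refine (slow 3 (by omega)).trans ?_
        rw [Prog.relocate, expPen_seq]
        have := (Runs.op (w := w') (r := numLocals) (o := .add) (s := s') (a := b)
          (b := innerReg a) (by rw [address a hq.2]; exact addr_lt a hq.2))
          (.load (innerReg r) numLocals :: K.map (Prog.relocate b)) (3 * t + 1) G'
        rw [this, address a hq.2, expPen_succ, expPen_succ, step, step, PMF.expect_pure,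
          PMF.expect_pure]
        rw [State.setReg_self, State.setReg_mem, h.inside _ (h.lt a hq.2)]
        exact write r _ _ (h.scratch _)
      | store a r =>
        refine (slow 3 (by omega)).trans ?_
        rw [Prog.relocate, expPen_seq]
        have := (Runs.op (w := w') (r := numLocals) (o := .add) (s := s') (a := b)
          (b := innerReg a) (by rw [address a hq.1]; exact addr_lt a hq.1))
          (.store numLocals (innerReg r) :: K.map (Prog.relocate b)) (3 * t + 1) G'
        rw [this, address a hq.1, Runs.store, Runs.store, State.setReg_self, State.setReg_mem,
          State.setReg_ne _ _ (by simp [innerReg]; omega), h.reg r hq.2]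
        have h1 := (h.store (h.lt a hq.1) (v := s.reg r)).scratch (O + s.reg a)
        exact ih hKK h1
      | rand r a =>
        refine (slow 1 (by omega)).trans ?_
        rw [expPen_succ, expPen_succ, Prog.relocate, step, step, PMF.expect_map, PMF.expect_map,
          uniform_expect_congr (h.reg a hq.2)]
        exact PMF.expect_mono _ fun v => write r _ s' h
      | seq p q =>
        refine (slow 1 (by omega)).trans ?_
        rw [Prog.relocate, expPen_seq, expPen_seq]
        refine ih (K := p :: q :: K) ?_ h
        intro p' hp'
        rcases List.mem_cons.1 hp' with rfl | hp'
        · exact hq.1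
        rcases List.mem_cons.1 hp' with rfl | hp'
        · exact hq.2
        · exact hKK _ hp'
      | ite r p q =>
        refine (slow 1 (by omega)).trans ?_
        rw [expPen_succ, expPen_succ, Prog.relocate, step, step, PMF.expect_pure, PMF.expect_pure,
          h.reg r hq.1]
        split_ifs
        · exact ih (K := p :: K) (List.forall_mem_cons.2 ⟨hq.2.1, hKK⟩) h
        · exact ih (K := q :: K) (List.forall_mem_cons.2 ⟨hq.2.2, hKK⟩) h
      | loop r p =>
        refine (slow 1 (by omega)).trans ?_
        rw [expPen_succ, expPen_succ, Prog.relocate, step, step, PMF.expect_pure, PMF.expect_pure,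
          h.reg r hq.1]
        split_ifs
        · exact ih (K := p :: .loop r p :: K)
            (List.forall_mem_cons.2 ⟨hq.2, List.forall_mem_cons.2 ⟨hq, hKK⟩⟩) h
        · exact ih (K := K) hKK h

/-- Copy the registers `src r` of the calling program to the registers `r < R` of a
subroutine. -/
def passArgs (src : ℕ → Fin numLocals) : ℕ → Prog
  | 0 => .skip
  | R + 1 => .seq (passArgs src R)
      (.seq (.const (innerReg R) 0) (.op .add (innerReg R) (innerReg R) (src R)))

theorem passArgs_deterministic (src : ℕ → Fin numLocals) (R : ℕ) :
    (passArgs src R).Deterministic := by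
  induction R <;> simp_all [passArgs, Prog.Deterministic]

theorem passArgs_runs {w : ℕ} (src : ℕ → Fin numLocals) (R : ℕ) {s : State}
    (h : ∀ r < R, |s.abs.reg (src r)| < 2 ^ w) :
    ∃ s₁, Runs w (4 * R + 1) (passArgs src R) s s₁ ∧ s₁.abs = s.abs ∧
      ∀ r < R, s₁.reg (innerReg r) = s.abs.reg (src r) := by
  induction R with
  | zero => exact ⟨s, Runs.of_step fun K => by simp [step, passArgs], rfl, by simp⟩
  | succ R ih =>
    obtain ⟨s₁, h₁, h₂, h₃⟩ := ih fun r hr => h r (by omega)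
    have hne : ((src R : Fin numLocals) : ℕ) ≠ innerReg R := by
      have := (src R).isLt; simp only [innerReg]; omega
    have e : BinOp.add.eval ((s₁.setReg (innerReg R) 0).reg (innerReg R))
        ((s₁.setReg (innerReg R) 0).reg (src R)) = s.abs.reg (src R) := by
      rw [State.setReg_self, State.setReg_ne _ _ hne, BinOp.eval, zero_add, ← State.abs_reg, h₂]
    have T : 4 * (R + 1) + 1 = (4 * R + 1) + (1 + 1 + 1) + 1 := by ring
    rw [T]
    refine ⟨_, h₁.seq ((Runs.const (by simp)).seq
      (Runs.op (by rw [e]; exact h R (by omega)))), ?_, ?_⟩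
    · rw [State.abs_setReg_of_le _ _ (by simp [innerReg]; omega),
        State.abs_setReg_of_le _ _ (by simp [innerReg]; omega), h₂]
    · intro r hr
      by_cases hrR : r = R
      · subst hrR
        rw [State.setReg_self, e]
      · have : innerReg r ≠ innerReg R := by simp [innerReg, hrR]
        rw [State.setReg_ne _ _ this, State.setReg_ne _ _ this, h₃ r (by omega)]

/-- Run `p` as a subroutine with its memory at the content of register `b`, and with arguments
from the registers `src r`. -/
def callProg (R : ℕ) (src : ℕ → Fin numLocals) (b : Fin numLocals) (p : Prog) : Prog :=
  .seq (passArgs src R) (p.relocate b)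

theorem callProg_deterministic {R : ℕ} {src : ℕ → Fin numLocals} {b : Fin numLocals} {p : Prog}
    (h : p.Deterministic) : (callProg R src b p).Deterministic :=
  ⟨passArgs_deterministic _ _, Prog.relocate_deterministic h⟩

theorem Achieves.call (Q : Problem) (x : Q.Inst) {p : Prog} {R : ℕ} (hp : p.UsesBelow R)
    {w w' t : ℕ} {O B : ℤ} {σ : AState} {b : Fin numLocals} {src : ℕ → Fin numLocals}
    (hb : σ.reg b = O) (hw : (2 : ℤ) ^ w ≤ B) (hw' : |O| + B ≤ 2 ^ w')
    (hargs : ∀ r < R, σ.reg (src r) = (Q.args x).getD r 0)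
    (hargsB : ∀ r < R, |(Q.args x).getD r 0| < B)
    (hmem : ∀ a, |a| < B → σ.mem (O + a) = if 0 ≤ a then (Q.data x).getD a.toNat 0 else 0)
    (hlen : ((Q.data x).length : ℤ) + (Q.answer x).length ≤ B) :
    Achieves w' (4 * R + 3 * t + 2) (Q.failProb p w t x) (callProg R src b p) σ fun τ =>
      τ.reg = σ.reg ∧ (∀ i, (h : i < (Q.answer x).length) →
        τ.mem (O + ((Q.data x).length + i)) = (Q.answer x)[i]) ∧
        ∀ y, B ≤ |y - O| → τ.mem y = σ.mem y := fun s hs => by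
  have hBw : B ≤ 2 ^ w' := by have := abs_nonneg O; linarith
  obtain ⟨s₁, h₁, h₂, h₃⟩ := passArgs_runs (w := w') src R (s := s) fun r hr => by
    rw [hs, hargs r hr]; exact (hargsB r hr).trans_le hBw
  have T : 4 * R + 3 * t + 2 = (3 * t + (4 * R + 1)) + 1 := by ring
  rw [T, callProg, expPen_seq, h₁, failProb_eq_expPen]
  refine Simulates.expPen_le (K := [p]) (R := R) hb hw hw' ?_ (by simpa using hp) ?_
  · intro s₂ s₃ h
    refine failInd_le ?_
    rintro ⟨s₄, h₄, h₅⟩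
    simp only [Option.some.injEq, Prod.mk.injEq, true_and] at h₄
    subst h₄
    refine ⟨h.locals, fun i hi => ?_, h.outside⟩
    rw [← h₅ i hi]
    refine h.inside _ ?_
    rw [abs_of_nonneg (by positivity)]
    omega
  · have hm : s₁.mem = σ.mem := by rw [← hs, ← h₂]; rfl
    refine ⟨fun r hr => ?_, hargsB, by rw [h₂, hs], fun a ha => ?_, fun x _ => by rw [hm]⟩
    · rw [h₃ r hr, hs, hargs r hr]
    · rw [hm, hmem a ha]

/-! ### Every answer takes its length in time -/

theorem mem_of_mem_support_step {w : ℕ} {c c' : Config} (h : some c' ∈ (step w c).support) :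
    c'.2.mem = c.2.mem ∨ ∃ a v, c'.2.mem = Function.update c.2.mem a v := by
  have write {s : State} {r : ℕ} {v : ℤ} {K : List Prog}
      (h : some c' = (s.write w r v).map (Prod.mk K)) : c'.2.mem = s.mem := by
    unfold State.write at h
    split_ifs at h
    · simp only [Option.map_some, Option.some.injEq] at h; rw [h]
    · simp at h
  obtain ⟨K, s⟩ := c
  rcases K with _ | ⟨q, K⟩
  · simp only [step, PMF.mem_support_pure_iff, Option.some.injEq] at h
    rw [h]; exact Or.inl rfl
  · cases q <;> simp only [step, PMF.mem_support_pure_iff, PMF.mem_support_map_iff] at h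
    case const => exact Or.inl (write h)
    case op => exact Or.inl (write h)
    case load => exact Or.inl (write h)
    case store a r =>
      simp only [Option.some.injEq] at h
      rw [h]; exact Or.inr ⟨_, _, rfl⟩
    case rand =>
      obtain ⟨v, -, hv⟩ := h
      exact Or.inl (write hv.symm)
    all_goals simp only [Option.some.injEq] at h; rw [h]; exact Or.inl rfl

theorem PMF.one_le_expect {α : Type*} (q : PMF α) {g : α → ENNReal}
    (h : ∀ a ∈ q.support, 1 ≤ g a) : 1 ≤ q.expect g := by
  rw [← q.tsum_coe]
  refine ENNReal.tsum_le_tsum fun a => ?_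
  by_cases ha : a ∈ q.support
  · exact le_mul_of_one_le_right zero_le (h a ha)
  · rw [PMF.mem_support_iff, not_not] at ha; simp [ha]

-- A step changes at most one cell, so the number of wrong cells drops by at most one per step. With
-- more than `t` wrong cells, every possible run of `t` steps ends badly.
open scoped Classical in
theorem one_le_expPen_of_lt_card {w t n : ℕ} {Φ : State → ENNReal} {addr : Fin n → ℤ}
    (hinj : Function.Injective addr) {val : Fin n → ℤ}
    (hΦ : ∀ s, (∃ i, s.mem (addr i) ≠ val i) → 1 ≤ Φ s) {c : Config}
    (h : t < (Finset.univ.filter fun i => c.2.mem (addr i) ≠ val i).card) :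
    1 ≤ expPen w t c Φ := by
  induction t generalizing c with
  | zero =>
    obtain ⟨K, s⟩ := c
    rw [expPen_zero]
    cases K with
    | cons => exact le_rfl
    | nil =>
      obtain ⟨i, hi⟩ := Finset.card_pos.1 h
      exact le_min (hΦ s ⟨i, by simpa using hi⟩) le_rfl
  | succ t ih =>
    rw [expPen_succ]
    refine PMF.one_le_expect _ fun o ho => ?_
    cases o with
    | none => exact le_rfl
    | some c' =>
      refine ih ?_
      rcases mem_of_mem_support_step ho with hc | ⟨a, v, hc⟩
      · rw [hc]; omega
      · have : (Finset.univ.filter fun i => c.2.mem (addr i) ≠ val i) ⊆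
            (Finset.univ.filter fun i => c'.2.mem (addr i) ≠ val i) ∪
              (Finset.univ.filter fun i => addr i = a) := by
          intro i hi
          simp only [Finset.mem_union, Finset.mem_filter, Finset.mem_univ, true_and] at hi ⊢
          by_cases hia : addr i = a
          · exact Or.inr hia
          · left; rwa [hc, Function.update_of_ne hia]
        have h1 := (Finset.card_le_card this).trans (Finset.card_union_le _ _)
        have h2 : (Finset.univ.filter fun i => addr i = a).card ≤ 1 := by
          rw [Finset.card_le_one]
          intro i hi j hj
          simp only [Finset.mem_filter, Finset.mem_univ, true_and] at hi hj
          exact hinj (hi.trans hj.symm)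
        omega

/-- The output cells are zero at the start, so a nonzero answer has to be written cell by cell. This
yields a linear lower bound on the time of any correct algorithm, without hypotheses on `f`. -/
theorem length_answer_le_of_failProb_lt_one {Q : Problem} {p : Prog} {w t : ℕ} {x : Q.Inst}
    (h : Q.failProb p w t x < 1) (hx : ∀ z ∈ Q.answer x, z ≠ 0) : (Q.answer x).length ≤ t := by
  classical
  by_contra hlt
  rw [failProb_eq_expPen] at h
  refine absurd h (not_lt.2 ?_)
  refine one_le_expPen_of_lt_card (n := (Q.answer x).length)
    (addr := fun i => (Q.data x).length + (i : ℕ)) (val := fun i => (Q.answer x)[i])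
    (fun i j hij => by simpa [Fin.ext_iff] using hij) ?_ ?_
  · rintro s ⟨i, hi⟩
    rw [failInd, if_neg]
    rintro ⟨s', hs, h'⟩
    simp only [Option.some.injEq, Prod.mk.injEq, true_and] at hs
    subst hs
    exact hi (h' i i.isLt)
  · rw [Finset.filter_true_of_mem, Finset.card_univ, Fintype.card_fin]
    · omega
    · intro i _
      have h0 : (0 : ℤ) ≤ (Q.data x).length + (i : ℕ) := by positivity
      have h1 : ((Q.data x).length + ((i : ℕ) : ℤ)).toNat = (Q.data x).length + i := by omega
      simp only [Problem.start]
      rw [if_pos h0, h1, List.getD_eq_default _ _ (by omega)]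
      exact (hx _ (List.getElem_mem _)).symm

/-- The instance of range-restricted 3SUM with `A = B = {0, …, N - 1}`. -/
def ThreeSumInst.full (N : ℕ) (hN : 1 ≤ N) : ThreeSumInst where
  N := N
  N_pos := hN
  a := Fin.valEmbedding.trans Nat.castEmbedding
  b := Fin.valEmbedding.trans Nat.castEmbedding

theorem rangeThreeSum_size_le {p : Prog} {u w t : ℕ} (hu : 1 ≤ u) {N : ℕ} (hN : 1 ≤ N)
    (h : ∀ x : ThreeSumInst, x.N = N → rangeThreeSum.PolyBounded u x →
      rangeThreeSum.failProb p w t x < 1) : N ≤ t := by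
  have h1 := length_answer_le_of_failProb_lt_one (h (ThreeSumInst.full N hN) rfl ?_) ?_
  · simpa [rangeThreeSum, ThreeSumInst.full] using h1
  · intro z hz
    have hz' : |z| ≤ N := by
      simp only [rangeThreeSum, ThreeSumInst.full, List.mem_append, List.mem_ofFn] at hz
      rcases hz with ⟨i, rfl⟩ | ⟨i, rfl⟩ <;>
      · have := i.isLt
        change |((i : ℕ) : ℤ)| ≤ N
        rw [abs_of_nonneg (by positivity)]; omega
    refine hz'.trans (le_trans ?_ (le_self_pow₀ (by omega) (by omega)))
    simp [rangeThreeSum, ThreeSumInst.full]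
  · intro z hz
    simp only [rangeThreeSum, List.mem_ofFn] at hz
    obtain ⟨c, rfl⟩ := hz
    rw [Nat.cast_ne_zero, ← Nat.pos_iff_ne_zero, Finset.card_pos]
    -- The solution `0 + c` makes every count positive.
    refine ⟨(0, ((c : ℕ) : ℤ)), ?_⟩
    have hc : (c : ℕ) < N := c.isLt
    simp only [Finset.mem_filter, Finset.mem_product, Finset.mem_map, Finset.mem_univ, true_and,
      zero_add, and_true]
    exact ⟨⟨⟨0, hN⟩, rfl⟩, ⟨c, rfl⟩⟩

/-- The instance without any matching characters, for a text twice as long as the pattern. -/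
def MatchingInst.allDistinct (κ : ℕ) (hκ : 2 ≤ κ) (m : ℕ) (hm : 1 ≤ m) : MatchingInst κ where
  m := m
  n := 2 * m
  m_pos := hm
  m_le_n := by omega
  n_le := Nat.mul_le_mul_right m hκ
  P := fun _ => 0
  T := fun _ => 1

/-- A pattern of zeros in a text of ones has all its `m + 1` distances nonzero. -/
theorem hammingDistances_size_le {κ : ℕ} (hκ : 2 ≤ κ) {p : Prog} {u w t : ℕ} {m : ℕ}
    (hm : 1 ≤ m)
    (h : ∀ x : MatchingInst κ, x.m = m → (hammingDistances κ).PolyBounded u x →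
      (hammingDistances κ).failProb p w t x < 1) : m ≤ t := by
  have h1 := length_answer_le_of_failProb_lt_one
    (h (MatchingInst.allDistinct κ hκ m hm) rfl ?_) ?_
  · simp only [hammingDistances, MatchingInst.allDistinct, List.length_ofFn] at h1
    omega
  · intro z hz
    have hz' : |z| ≤ 1 := by
      simp only [hammingDistances, MatchingInst.allDistinct, List.mem_append, List.mem_ofFn] at hz
      rcases hz with ⟨i, rfl⟩ | ⟨i, rfl⟩ <;> simp
    exact hz'.trans (one_le_pow₀ (by simp))
  · intro z hz
    simp only [hammingDistances, List.mem_ofFn] at hz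
    obtain ⟨c, rfl⟩ := hz
    rw [Nat.cast_ne_zero, hammingDist_ne_zero]
    intro h
    have := congrFun h ⟨0, hm⟩
    simp [MatchingInst.allDistinct] at this

/-! ### Bit lengths -/

theorem Nat.two_pow_size_le {N : ℕ} (hN : 1 ≤ N) : 2 ^ N.size ≤ 2 * N := by
  have h : N.size - 1 < N.size := by
    have := Nat.size_pos.2 hN; omega
  have := Nat.lt_size.1 h
  calc 2 ^ N.size = 2 * 2 ^ (N.size - 1) := by rw [← pow_succ']; congr 1; omega
    _ ≤ 2 * N := by omega

theorem Nat.size_le_log {N : ℕ} (hN : 1 ≤ N) : (N.size : ℝ) ≤ 3 * Real.log ((N : ℝ) + 2) := by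
  have h1 : (2 : ℝ) ^ N.size ≤ ((N : ℝ) + 2) ^ 2 := by
    have : (2 : ℝ) ^ N.size ≤ 2 * N := by exact_mod_cast Nat.two_pow_size_le hN
    nlinarith [sq_nonneg (N : ℝ), (Nat.cast_nonneg N : (0 : ℝ) ≤ N)]
  have h2 := Real.log_le_log (by positivity) h1
  rw [Real.log_pow, Real.log_pow] at h2
  -- The constant three comes from `2 / log 2 < 3`.
  have h3 := Real.log_two_gt_d9
  have h4 : (0 : ℝ) ≤ N.size := Nat.cast_nonneg _
  push_cast at h2
  nlinarith

theorem le_floor_of_le_mul {f l : ℝ} {C c e s t τ : ℕ} (hτ : τ = ⌊C * f⌋₊) (hτ1 : 1 ≤ τ)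
    (hs : (s : ℝ) ≤ 3 * l) (h : t ≤ c * τ * s ^ e) :
    t ≤ ⌊((3 ^ e * c * C : ℕ) : ℝ) * (f * l ^ e)⌋₊ := by
  have hpos : 0 ≤ (C : ℝ) * f := by
    by_contra hneg
    -- A negative `C * f` would have floor zero, against `1 ≤ τ`; this disposes of negative values
    -- of `f`.
    rw [Nat.floor_of_nonpos (by linarith)] at hτ
    omega
  have hle : (τ : ℝ) ≤ C * f := hτ ▸ Nat.floor_le hpos
  refine Nat.le_floor ?_
  have hl : (s : ℝ) ^ e ≤ (3 * l) ^ e := by gcongr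
  calc (t : ℝ) ≤ c * τ * s ^ e := by exact_mod_cast h
    _ ≤ c * (C * f) * (3 * l) ^ e := by gcongr
    _ = _ := by push_cast; rw [mul_pow]; ring

/-! ### Powers of two that are polynomial in the size parameter -/

/-- Compute the bit length of register 0 in register 4, and `2 ^ (k * size)` in register 5. -/
def powerProg (k : ℕ) : Prog :=
  .seq (assignReg 4 (.lit 0))
  (.seq (forDo 2 0 (assignReg 4 (.reg 4 + .bin .lt (.bin .shl (.lit 1) (.reg 4))
    (.reg 0 + .lit 1))))
  (assignReg 5 (.bin .shl (.lit 1) (.lit k * .reg 4))))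

theorem powerProg_deterministic (k : ℕ) : (powerProg k).Deterministic := by
  simp [powerProg, Prog.Deterministic, assignReg_deterministic, forDo_deterministic]

/-- Register 4 grows by the comparison bit of `2 ^ r < N + 1`, which is one exactly while `r <
N.size`. Running all `N` rounds is wasteful, but linear time is available. -/
theorem Achieves.powerProg {w k N : ℕ} (hk : 1 ≤ k) (hN : 1 ≤ N) {σ : AState}
    (hσ : σ.reg 0 = N) (hw : k * N.size + 3 ≤ w) :
    Achieves w (100 * N) 0 (powerProg k) σ
      (· = ((σ.set 4 N.size).set 2 N).set 5 (2 ^ (k * N.size))) := by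
  have hs : 1 ≤ N.size := Nat.size_pos.2 hN
  have hs1 : N.size ≤ k * N.size := Nat.le_mul_of_pos_left _ hk
  have hNs : N < 2 ^ N.size := Nat.lt_size_self N
  have hss : N.size < 2 ^ N.size := Nat.lt_two_pow_self
  have hks : k * N.size < 2 ^ (k * N.size) := Nat.lt_two_pow_self
  have hmono : 2 ^ N.size ≤ 2 ^ (k * N.size) := Nat.pow_le_pow_right (by norm_num) hs1
  have h8 : 8 * 2 ^ (k * N.size) ≤ 2 ^ w := by
    calc 8 * 2 ^ (k * N.size) = 2 ^ (k * N.size + 3) := by rw [pow_add]; ring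
      _ ≤ 2 ^ w := Nat.pow_le_pow_right (by norm_num) hw
  have h8' : 8 * (2 : ℤ) ^ (k * N.size) ≤ 2 ^ w := by exact_mod_cast h8
  have big {x : ℕ} (hx : x ≤ 4 * 2 ^ (k * N.size)) : |(x : ℤ)| < 2 ^ w := by
    rw [abs_of_nonneg (by positivity)]
    have : x < 2 ^ w := by omega
    exact_mod_cast this
  have big' {x : ℕ} {z : ℤ} (hz : z = x) (hx : x ≤ 4 * 2 ^ (k * N.size)) : |z| < 2 ^ w :=
    hz ▸ big hx
  have shl_eq (x : ℕ) : BinOp.shl.eval 1 (x : ℤ) = ((2 ^ x : ℕ) : ℤ) := by simp [BinOp.eval]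
  refine Achieves.mono (t₁ := 5 + ((N * (27 + loopOverhead) + loopOverhead) + 15 + 1) + 1) ?_ ?_ le_rfl
    fun _ h => h
  swap
  · simp only [loopOverhead]; omega
  refine Achieves.seq_eq (Achieves.assign (by simp [Expr.Fits])) ?_
  refine Achieves.seq_eq (τ := (σ.set 4 N.size).set 2 N) ?_ ?_
  · have := Achieves.forLoop (w := w) (tb := 27) (ε := 0) (nn := N) (i := 2) (n := 0)
      (p := assignReg 4 (.reg 4 + .bin .lt (.bin .shl (.lit 1) (.reg 4)) (.reg 0 + .lit 1)))
      (σ := σ.set 4 0)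
      (by decide) (Inv := fun j τ => τ = (σ.set 4 (min j N.size : ℕ)).set 2 j) (by
        have := big (x := N + 1) (by omega)
        rw [abs_of_nonneg (by positivity)] at this; exact_mod_cast this)
      (fun j hj τ _ _ hτ => ?_) (by simp [AState.set_reg, hσ]) (by simp [AState.set])
    · rw [mul_zero] at this
      refine this.mono le_rfl le_rfl fun τ hτ => ?_
      rw [hτ, min_eq_right]
      -- Together with `2 ^ (N.size - 1) ≤ N` this gives `N.size ≤ N`, so `N` rounds reach the bit
      -- length.
      have h1 : N.size - 1 < 2 ^ (N.size - 1) := Nat.lt_two_pow_self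
      have h2 := Nat.lt_size.1 (show N.size - 1 < N.size by omega)
      omega
    · set r := min j N.size with hr
      have e4 : τ.reg 4 = r := by rw [hτ]; simp [AState.set_reg]
      have e0 : τ.reg 0 = N := by rw [hτ]; simp [AState.set_reg, hσ]
      have hrs : 2 ^ r ≤ 2 ^ N.size := Nat.pow_le_pow_right (by norm_num) (min_le_right _ _)
      have hr2 : r ≤ N.size := min_le_right _ _
      have elt : BinOp.lt.eval (BinOp.shl.eval 1 (τ.reg 4)) (BinOp.add.eval (τ.reg 0) 1) =
          ((if r < N.size then 1 else 0 : ℕ) : ℤ) := by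
        rw [e4, shl_eq, e0]
        have : (((2 ^ r : ℕ) : ℤ) < (N : ℤ) + 1) ↔ r < N.size := by
          rw [Nat.lt_size]; omega
        simp only [BinOp.eval, this]
        split_ifs <;> rfl
      have eadd : BinOp.add.eval (τ.reg 4) (BinOp.lt.eval (BinOp.shl.eval 1 (τ.reg 4))
          (BinOp.add.eval (τ.reg 0) 1)) = (min (j + 1) N.size : ℕ) := by
        rw [elt, e4, BinOp.eval]
        norm_cast
        split_ifs <;> omega
      have hF : Expr.Fits w τ (.reg 4 + .bin .lt (.bin .shl (.lit 1) (.reg 4))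
          (.reg 0 + .lit 1)) := by
        refine ⟨?_, ⟨⟨?_, ?_, ?_⟩, ⟨?_, ?_, ?_⟩, ?_⟩, ?_⟩
        · exact big' e4 (by omega)
        · exact big' (x := 1) rfl (by omega)
        · exact big' e4 (by omega)
        · exact big' (x := 2 ^ r) (by rw [Expr.eval, Expr.eval, e4, shl_eq]) (by omega)
        · exact big' e0 (by omega)
        · exact big' (x := 1) rfl (by omega)
        · exact big' (x := N + 1) (by rw [Expr.eval, Expr.eval, e0]; rfl) (by omega)
        · exact big' elt (by split_ifs <;> omega)
        · exact big' eadd (by omega)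
      refine (Achieves.assign hF).mono le_rfl le_rfl ?_
      rintro _ rfl
      have ev : Expr.eval τ (.reg 4 + .bin .lt (.bin .shl (.lit 1) (.reg 4))
          (.reg 0 + .lit 1)) = (min (j + 1) N.size : ℕ) := eadd
      rw [ev]
      refine ⟨?_, ?_, ?_⟩
      · rw [hτ]; simp [AState.set_reg]
      · rw [hτ]; simp [AState.set_reg, hσ]
      · rw [hτ]
        ext x
        · simp only [AState.set_reg]
          split_ifs <;> simp_all
        · rfl
  · have e4 : ((σ.set 4 N.size).set 2 N).reg 4 = N.size := by simp [AState.set_reg]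
    have emul : BinOp.mul.eval k (((σ.set 4 N.size).set 2 N).reg 4) = (k * N.size : ℕ) := by
      rw [e4, BinOp.eval]; norm_cast
    have eshl : BinOp.shl.eval 1 (BinOp.mul.eval k (((σ.set 4 N.size).set 2 N).reg 4)) =
        (2 ^ (k * N.size) : ℕ) := by
      rw [emul, shl_eq]
    have hkk : k ≤ k * N.size := Nat.le_mul_of_pos_right _ hs
    refine (Achieves.assign ?_).mono le_rfl le_rfl ?_
    · refine ⟨?_, ⟨?_, ?_, ?_⟩, ?_⟩
      · exact big' (x := 1) rfl (by omega)
      · exact big (x := k) (by omega)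
      · exact big' e4 (by omega)
      · exact big' emul (by omega)
      · exact big' eshl (by omega)
    · rintro _ rfl
      have ev : Expr.eval ((σ.set 4 N.size).set 2 N) (.bin .shl (.lit 1) (.lit k * .reg 4)) =
        (2 ^ (k * N.size) : ℕ) := eshl
      rw [ev]; push_cast; rfl

/-! ### From Hamming distances to 3SUM: the instances -/

theorem eq_and_eq_of_mul_add_eq {M q q' r r' : ℤ} (hr : 0 ≤ r) (hrM : r < M) (hr' : 0 ≤ r')
    (hrM' : r' < M) (h : q * M + r = q' * M + r') : q = q' ∧ r = r' := by
  have hq : q = q' := by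
    by_contra hne
    rcases lt_or_gt_of_ne hne with h1 | h1 <;> nlinarith
  subst hq
  exact ⟨rfl, by linarith⟩

/-- The number of pairs with sum `c`. -/
def pairCount {N : ℕ} (a b : Fin N → ℤ) (c : ℤ) : ℕ :=
  (Finset.univ.filter fun z : Fin N × Fin N => a z.1 + b z.2 = c).card

theorem card_filter_map_product {N : ℕ} (a b : Fin N ↪ ℤ) (c : ℤ) :
    (((Finset.univ.map a) ×ˢ (Finset.univ.map b)).filter fun z => z.1 + z.2 = c).card =
      pairCount a b c := by
  unfold pairCount
  rw [← Finset.card_map (a.prodMap b)]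
  congr 1
  ext ⟨z₁, z₂⟩
  simp only [Finset.mem_filter, Finset.mem_product, Finset.mem_map, Finset.mem_univ, true_and,
    Prod.exists, Function.Embedding.coe_prodMap, Prod.map_apply, Prod.mk.injEq]
  constructor
  · rintro ⟨⟨⟨i, rfl⟩, ⟨j, rfl⟩⟩, h⟩
    exact ⟨i, j, h, rfl, rfl⟩
  · rintro ⟨i, j, h, rfl, rfl⟩
    exact ⟨⟨⟨i, rfl⟩, ⟨j, rfl⟩⟩, h⟩

namespace MatchingInst

variable {κ : ℕ} (x : MatchingInst κ)

/-- The character at position `k` of the text, and `-1` beyond its end. -/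
def textChar (k : ℕ) : ℤ := if h : k < x.n then x.T ⟨k, h⟩ else -1

theorem neg_one_le_textChar (k : ℕ) : -1 ≤ x.textChar k := by
  unfold textChar; split_ifs <;> omega

/-- For each `g`, the 3SUM instances `2 * g` and `2 * g + 1` together count the matches for the
shifts in the `g`-th block of length `m`. -/
def block (t : ℕ) : ThreeSumInst where
  N := x.m
  N_pos := x.m_pos
  a := ⟨fun j => x.textChar ((t / 2 + t % 2) * x.m + j) * (2 * x.m) + ((t % 2 : ℕ) * x.m + j),
    fun i j h => by
      have hi := i.isLt
      have hj := j.isLt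
      -- The lower digit is below `2 * m`, so it can be recovered, and with it the index.
      rcases Nat.mod_two_eq_zero_or_one t with ht | ht <;> rw [ht] at h <;>
        simpa [Fin.ext_iff] using (eq_and_eq_of_mul_add_eq (by positivity) (by push_cast; omega)
          (by positivity) (by push_cast; omega) h).2⟩
  b := ⟨fun j => -((x.P j : ℤ) * (2 * x.m) + j), fun i j h => by
      have hi := i.isLt
      have hj := j.isLt
      simpa [Fin.ext_iff] using (eq_and_eq_of_mul_add_eq (by positivity) (by omega)
          (by positivity) (by omega) (neg_inj.1 h)).2⟩

/-- The number of solutions of a block instance. -/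
def blockCount (t c : ℕ) : ℕ := pairCount (x.block t).a (x.block t).b c

/-- The sum of the two packed numbers is `c` exactly when the characters agree and `t % 2 * m + k =
c + j`. The second condition determines `k` from `j` and says that `c + j` lies in the half of the
window that the instance is responsible for. -/
theorem blockCount_eq (t : ℕ) {c : ℕ} (hc : c < x.m) :
    x.blockCount t c = (Finset.univ.filter fun j : Fin x.m =>
      (c + j) / x.m = t % 2 ∧ x.textChar (t / 2 * x.m + (c + j)) = x.P j).card := by
  have hmod : t % 2 < 2 := Nat.mod_lt _ (by norm_num)
  have key (k j : Fin x.m) : (x.block t).a k + (x.block t).b j = c ↔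
      x.textChar ((t / 2 + t % 2) * x.m + k) = x.P j ∧ t % 2 * x.m + k = c + j := by
    have hk := k.isLt
    have hj := j.isLt
    have hb : t % 2 * x.m ≤ x.m := by
      calc t % 2 * x.m ≤ 1 * x.m := Nat.mul_le_mul_right _ (by omega)
        _ = x.m := one_mul _
    have hb' : (0 : ℤ) ≤ (t % 2 : ℕ) * x.m := by positivity
    have hb'' : ((t % 2 : ℕ) * x.m : ℤ) ≤ x.m := by exact_mod_cast hb
    show x.textChar ((t / 2 + t % 2) * x.m + k) * (2 * x.m) + ((t % 2 : ℕ) * x.m + (k : ℕ)) +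
      -((x.P j : ℤ) * (2 * x.m) + (j : ℕ)) = c ↔ _
    generalize x.textChar ((t / 2 + t % 2) * x.m + k) = u
    generalize (x.P j : ℤ) = v
    have : t % 2 * x.m + (k : ℕ) = c + (j : ℕ) ↔
        ((t % 2 : ℕ) * x.m + (k : ℕ) : ℤ) = c + (j : ℕ) := by norm_cast
    rw [this]
    generalize ((t % 2 : ℕ) * x.m : ℤ) = e at *
    constructor
    · intro h
      -- Distinct characters contribute at least `2 * m` in absolute value, more than the lower
      -- digits and `c` can compensate.
      have huv : u = v := by
        by_contra hne
        rcases lt_or_gt_of_ne hne with h1 | h1 <;> nlinarith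
      subst huv
      exact ⟨rfl, by linarith⟩
    · rintro ⟨rfl, h⟩
      linarith
  have hcount : x.blockCount t c = (Finset.univ.filter fun z : Fin x.m × Fin x.m =>
      x.textChar ((t / 2 + t % 2) * x.m + z.1) = x.P z.2 ∧ t % 2 * x.m + z.1 = c + z.2).card :=
    congrArg Finset.card (Finset.filter_congr fun z _ => key z.1 z.2)
  rw [hcount]
  -- The partner of `j` is the position `(c + j) % m`.
  refine Finset.card_bij (fun z _ => z.2) ?_ ?_ ?_
  · rintro ⟨k, j⟩ h
    simp only [Finset.mem_filter, Finset.mem_univ, true_and] at h ⊢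
    refine ⟨?_, ?_⟩
    · rw [← h.2, Nat.add_comm, Nat.add_mul_div_right _ _ x.m_pos, Nat.div_eq_of_lt k.isLt, zero_add]
    · rw [← h.1, ← h.2]; congr 1; ring
  · rintro ⟨k, j⟩ h ⟨k', j'⟩ h' hj
    simp only [Finset.mem_filter, Finset.mem_univ, true_and] at h h' hj
    subst hj
    have : (k : ℕ) = k' := by omega
    rw [Fin.ext this]
  · intro j h
    simp only [Finset.mem_filter, Finset.mem_univ, true_and] at h
    have hd := Nat.div_add_mod (c + j) x.m
    rw [h.1] at hd
    refine ⟨(⟨(c + j) % x.m, Nat.mod_lt _ x.m_pos⟩, j), ?_, rfl⟩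
    simp only [Finset.mem_filter, Finset.mem_univ, true_and]
    refine ⟨?_, by rw [mul_comm]; exact hd⟩
    rw [← h.2]
    congr 1
    nth_rw 2 [← hd]
    ring

/-- Since `c + j < 2 * m`, every matching position is counted in exactly one of the two halves, and
the remaining positions are the mismatches. -/
theorem blockCount_add_blockCount_add_hammingDist {i : ℕ} (hi : i < x.n - x.m + 1) :
    x.blockCount (2 * (i / x.m)) (i % x.m) + x.blockCount (2 * (i / x.m) + 1) (i % x.m) +
      hammingDist x.P (fun j : Fin x.m => x.T ⟨i + j, by
        have := j.isLt; have := x.m_le_n; omega⟩) = x.m := by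
  have hc : i % x.m < x.m := Nat.mod_lt _ x.m_pos
  have e1 : 2 * (i / x.m) % 2 = 0 := by omega
  have e2 : (2 * (i / x.m) + 1) % 2 = 1 := by omega
  have e3 : 2 * (i / x.m) / 2 = i / x.m := by omega
  have e4 : (2 * (i / x.m) + 1) / 2 = i / x.m := by omega
  rw [blockCount_eq _ _ hc, blockCount_eq _ _ hc, e1, e2, e3, e4]
  have hT (j : Fin x.m) : x.textChar (i / x.m * x.m + (i % x.m + j)) = x.P j ↔
      x.P j = x.T ⟨i + j, by have := j.isLt; have := x.m_le_n; omega⟩ := by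
    have e : i / x.m * x.m + (i % x.m + j) = i + j := by
      rw [← Nat.add_assoc, mul_comm, Nat.div_add_mod]
    rw [e, textChar, dif_pos (by have := j.isLt; have := x.m_le_n; omega)]
    rw [Nat.cast_inj]
    exact eq_comm
  have hd (j : Fin x.m) : (i % x.m + j) / x.m = 1 ↔ ¬ (i % x.m + j) / x.m = 0 := by
    have : (i % x.m + j) / x.m < 2 := by
      rw [Nat.div_lt_iff_lt_mul x.m_pos]; have := j.isLt; omega
    generalize (i % x.m + (j : ℕ)) / x.m = q at this ⊢
    omega
  simp only [hT, hd]
  rw [hammingDist, ← Finset.card_union_of_disjoint, ← Finset.filter_or,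
    ← Finset.card_union_of_disjoint, ← Finset.filter_or]
  · rw [Finset.filter_true_of_mem, Finset.card_univ, Fintype.card_fin]
    intro j _
    tauto
  · rw [Finset.disjoint_filter]; tauto
  · rw [Finset.disjoint_filter]; tauto

theorem polyBounded_block {u : ℕ} (hx : (hammingDistances κ).PolyBounded u x) (t : ℕ) :
    rangeThreeSum.PolyBounded (u + 4) (x.block t) := by
  have hm := x.m_pos
  have hsz : (hammingDistances κ).size x = x.m := rfl
  set M : ℤ := (x.m : ℤ) + 1 with hM
  have hM2 : 2 ≤ M := by omega
  have hMu : 1 ≤ M ^ u := one_le_pow₀ (by omega)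
  have hP (j : Fin x.m) : (x.P j : ℤ) ≤ M ^ u := by
    refine (le_abs_self _).trans (hx _ ?_)
    simp [hammingDistances]
  have hT (k : ℕ) : x.textChar k ≤ M ^ u := by
    unfold textChar
    split_ifs with h
    · refine (le_abs_self _).trans (hx _ ?_)
      simp only [hammingDistances, List.mem_append, List.mem_ofFn]
      exact Or.inr ⟨_, rfl⟩
    · linarith
  -- Characters are multiplied by `2 * m` and moved by at most `2 * m`; the resulting factor `4 * m`
  -- is at most the fourth power of `m + 1`.
  have big : M ^ u * (2 * (M - 1)) + 2 * (M - 1) ≤ M ^ (u + 4) := by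
    have h4 : 4 * (M - 1) ≤ M ^ 4 := by nlinarith [sq_nonneg (M ^ 2 - 2), sq_nonneg (M - 1), sq_nonneg (M - 2)]
    calc M ^ u * (2 * (M - 1)) + 2 * (M - 1) ≤ M ^ u * (4 * (M - 1)) := by nlinarith
      _ ≤ M ^ u * M ^ 4 := by gcongr
      _ = M ^ (u + 4) := (pow_add _ _ _).symm
  have e : ((rangeThreeSum.size (x.block t) : ℤ) + 1) = M := rfl
  have em : (x.m : ℤ) = M - 1 := by omega
  intro z hz
  rw [e]
  simp only [rangeThreeSum, List.mem_append, List.mem_ofFn] at hz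
  rcases hz with ⟨j, rfl⟩ | ⟨j, rfl⟩
  · have hj : (j : ℕ) < x.m := j.isLt
    have ht : ((t % 2 : ℕ) : ℤ) * x.m ≤ x.m := by
      have : ((t % 2 : ℕ) : ℤ) ≤ 1 := by omega
      nlinarith
    have ht0 : 0 ≤ ((t % 2 : ℕ) : ℤ) * x.m := by positivity
    have h1 := hT ((t / 2 + t % 2) * x.m + j)
    have h2 := x.neg_one_le_textChar ((t / 2 + t % 2) * x.m + j)
    show |x.textChar ((t / 2 + t % 2) * x.m + j) * (2 * x.m) + ((t % 2 : ℕ) * x.m + (j : ℕ))| ≤ _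
    rw [abs_le]
    constructor <;> nlinarith
  · have hj : (j : ℕ) < x.m := j.isLt
    have h1 := hP j
    show |-((x.P j : ℤ) * (2 * x.m) + (j : ℕ))| ≤ _
    rw [abs_neg, abs_of_nonneg (by positivity)]
    nlinarith

end MatchingInst

/-! ### Memory contents at the start -/

/-- The memory at the start. -/
def Problem.inputMem (Q : Problem) (x : Q.Inst) (y : ℤ) : ℤ :=
  if 0 ≤ y then (Q.data x).getD y.toNat 0 else 0

theorem Problem.inputMem_natCast (Q : Problem) (x : Q.Inst) (y : ℕ) :
    Q.inputMem x y = (Q.data x).getD y 0 := by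
  simp [Problem.inputMem]

theorem Problem.inputMem_of_le (Q : Problem) (x : Q.Inst) {y : ℤ}
    (h : ((Q.data x).length : ℤ) ≤ y) : Q.inputMem x y = 0 := by
  unfold Problem.inputMem
  split_ifs
  · exact List.getD_eq_default _ _ (by omega)
  · rfl

theorem Problem.abs_inputMem_le {Q : Problem} {x : Q.Inst} {u : ℕ} (hx : Q.PolyBounded u x)
    (y : ℤ) : |Q.inputMem x y| ≤ ((Q.size x : ℤ) + 1) ^ u := by
  have h0 : |(0 : ℤ)| ≤ ((Q.size x : ℤ) + 1) ^ u := by simp; positivity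
  unfold Problem.inputMem
  split_ifs
  · by_cases hy : y.toNat < (Q.data x).length
    · rw [List.getD_eq_getElem _ _ hy]; exact hx _ (List.getElem_mem _)
    · rwa [List.getD_eq_default _ _ (by omega)]
  · exact h0

theorem getD_ofFn_append_left {n n' : ℕ} (f : Fin n → ℤ) (g : Fin n' → ℤ) (j : Fin n) :
    (List.ofFn f ++ List.ofFn g).getD j 0 = f j := by
  rw [List.getD_append _ _ _ _ (by simp), List.getD_eq_getElem _ _ (by simp)]
  simp

theorem getD_ofFn_append_right {n n' : ℕ} (f : Fin n → ℤ) (g : Fin n' → ℤ) (j : Fin n') :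
    (List.ofFn f ++ List.ofFn g).getD (n + j) 0 = g j := by
  rw [List.getD_append_right _ _ _ _ (by simp), List.getD_eq_getElem _ _ (by simp)]
  simp

/-- This is the memory condition of `Achieves.call`: two copying loops into a region of zeros
reproduce a fresh memory with origin `O`. -/
theorem filled_filled_data {n n' : ℕ} (f : Fin n → ℤ) (g : Fin n' → ℤ) {μ : ℤ → ℤ} {O B : ℤ}
    (h0 : ∀ a, |a| < B → μ (O + a) = 0) {v₁ v₂ : ℕ → ℤ} (h₁ : ∀ j : Fin n, v₁ j = f j)
    (h₂ : ∀ j : Fin n', v₂ j = g j) (a : ℤ) (ha : |a| < B) :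
    filled (filled μ O n v₁) (O + n) n' v₂ (O + a) =
      if 0 ≤ a then (List.ofFn f ++ List.ofFn g).getD a.toNat 0 else 0 := by
  split_ifs with h
  · obtain ⟨j, rfl⟩ := Int.eq_ofNat_of_zero_le h
    rw [Int.toNat_natCast]
    by_cases hj : j < n
    · rw [filled_not_mem _ _ (Or.inl (by omega)), filled_mem _ _ hj, h₁ ⟨j, hj⟩,
        ← getD_ofFn_append_left f g ⟨j, hj⟩]
    · obtain ⟨k, rfl⟩ := Nat.exists_eq_add_of_le (Nat.not_lt.1 hj)
      rw [show O + ((n + k : ℕ) : ℤ) = O + n + k by push_cast; ring]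
      by_cases hk : k < n'
      · rw [filled_mem _ _ hk, h₂ ⟨k, hk⟩, ← getD_ofFn_append_right f g ⟨k, hk⟩]
      · rw [filled_not_mem _ _ (Or.inr (by omega)), filled_not_mem _ _ (Or.inr (by omega)),
          List.getD_eq_default _ _ (by simp; omega), add_assoc, ← Nat.cast_add]
        exact h0 _ ha
  · rw [filled_not_mem _ _ (Or.inl (by omega)), filled_not_mem _ _ (Or.inl (by omega)), h0 _ ha]

theorem failProb_le_of_achieves {Q : Problem} {p : Prog} {w t : ℕ} {x : Q.Inst} {ε : ENNReal}
    {G : AState → Prop}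
    (h : Achieves w t ε p ⟨fun r => (Q.args x).getD r 0, Q.inputMem x⟩ G)
    (hG : ∀ τ, G τ → ∀ i, (h : i < (Q.answer x).length) →
      τ.mem ((Q.data x).length + i) = (Q.answer x)[i]) : Q.failProb p w t x ≤ ε := by
  rw [failProb_eq_expPen]
  refine (expPen_mono (fun s => ?_) _ _ _).trans (h _ rfl)
  exact failInd_le fun hs => ⟨s, rfl, hG _ hs⟩

/-! ### From Hamming distances to 3SUM: the program -/

/-- Solve the block instance whose number is in register 6. -/
def blockProg (R : ℕ) (p : Prog) : Prog :=
  .seq (assignReg 8 ((.reg 6 + .lit 1) * .reg 5))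
  (.seq (forDo 2 0 (writeMem (.reg 8 + .reg 2)
    ((.bin .lt ((.reg 6 / .lit 2 + .reg 6 % .lit 2) * .reg 0 + .reg 2) (.reg 1) *
      (.load (.reg 0 + ((.reg 6 / .lit 2 + .reg 6 % .lit 2) * .reg 0 + .reg 2)) + .lit 1) -
        .lit 1) * (.lit 2 * .reg 0) + (.reg 6 % .lit 2 * .reg 0 + .reg 2))))
  (.seq (forDo 2 0 (writeMem (.reg 8 + .reg 0 + .reg 2)
    (.lit 0 - (.load (.reg 2) * (.lit 2 * .reg 0) + .reg 2))))
  (callProg R (fun r => if r = 0 then 0 else 9) 8 p)))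

/-- Compute Hamming distances with the 3SUM program `p`. -/
def hammingProg (κ k R : ℕ) (p : Prog) : Prog :=
  .seq (powerProg k)
  (.seq (assignReg 7 (.lit (2 * κ)))
  (.seq (forDo 6 7 (blockProg R p))
  (.seq (assignReg 10 (.reg 1 - .reg 0 + .lit 1))
  (forDo 2 10 (writeMem (.reg 0 + .reg 1 + .reg 2)
    (.reg 0 - .load ((.lit 2 * (.reg 2 / .reg 0) + .lit 1) * .reg 5 + .lit 2 * .reg 0 +
        .reg 2 % .reg 0) -
      .load ((.lit 2 * (.reg 2 / .reg 0) + .lit 2) * .reg 5 + .lit 2 * .reg 0 +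
        .reg 2 % .reg 0)))))))

theorem blockProg_deterministic (R : ℕ) {p : Prog} (h : p.Deterministic) :
    (blockProg R p).Deterministic :=
  ⟨assignReg_deterministic _ _, forDo_deterministic (writeMem_deterministic _ _),
    forDo_deterministic (writeMem_deterministic _ _), callProg_deterministic h⟩

theorem hammingProg_deterministic (κ k R : ℕ) {p : Prog} (h : p.Deterministic) :
    (hammingProg κ k R p).Deterministic :=
  ⟨powerProg_deterministic _, assignReg_deterministic _ _,
    forDo_deterministic (blockProg_deterministic R h), assignReg_deterministic _ _,
    forDo_deterministic (writeMem_deterministic _ _)⟩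

theorem BinOp.eval_natCast_lt (x y : ℕ) :
    BinOp.lt.eval (x : ℤ) (y : ℤ) = if x < y then 1 else 0 := by
  simp [BinOp.eval]

/-- The numbers of a computation are small compared to the distance `D` of the memory regions of
the subroutine calls, and these are small compared to the words. -/
structure Scales (N T : ℕ) (B D X : ℤ) (w : ℕ) : Prop where
  pos : 1 ≤ N
  T_mul_le : (T : ℤ) * N ≤ B
  B_le : 2 * B ≤ D
  D_le : ((T : ℤ) + 2) * D ≤ X
  wide : Wide X w

/-! ### The invariant of the calls for the block instances. -/

section block

variable {κ : ℕ} (x : MatchingInst κ)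

/-- The state after the first `t` subroutine calls. -/
structure BlockInv (D B : ℤ) (t : ℕ) (τ : AState) : Prop where
  r0 : τ.reg 0 = x.m
  r1 : τ.reg 1 = x.n
  r5 : τ.reg 5 = D
  r9 : τ.reg 9 = 0
  low : ∀ y < D - B, τ.mem y = (hammingDistances κ).inputMem x y
  high : ∀ y, (t + 1) * D - B ≤ y → τ.mem y = 0
  res : ∀ t' < t, ∀ c < x.m, τ.mem ((t' + 1) * D + 2 * x.m + c) = x.blockCount t' c

theorem BlockInv.of_reg_eq {D B : ℤ} {t : ℕ} {τ τ' : AState} (h : BlockInv x D B t τ)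
    (hm : τ'.mem = τ.mem) (h0 : τ'.reg 0 = τ.reg 0) (h1 : τ'.reg 1 = τ.reg 1)
    (h5 : τ'.reg 5 = τ.reg 5) (h9 : τ'.reg 9 = τ.reg 9) : BlockInv x D B t τ' :=
  ⟨h0.trans h.r0, h1.trans h.r1, h5.trans h.r5, h9.trans h.r9, hm ▸ h.low, hm ▸ h.high,
    hm ▸ h.res⟩

theorem inputMem_pattern (j : Fin x.m) : (hammingDistances κ).inputMem x (j : ℕ) = x.P j :=
  (Problem.inputMem_natCast (hammingDistances κ) x j).trans (getD_ofFn_append_left _ _ j)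

theorem inputMem_text (j : Fin x.n) :
    (hammingDistances κ).inputMem x (x.m + (j : ℕ) : ℕ) = x.T j :=
  (Problem.inputMem_natCast (hammingDistances κ) x (x.m + j)).trans
    (getD_ofFn_append_right _ _ j)

/-- The time of `blockProg`, up to a constant factor. -/
abbrev blockTime (R m τ : ℕ) : ℕ := 300 * m + 4 * R + 3 * τ + 300

-- The call works around the origin `O = (t + 1) * D`, where the memory is still zero, and changes
-- nothing at distance `B` or more from it. As `2 * B ≤ D`, the input, the earlier answers and the
-- regions of later calls are out of reach.
set_option maxHeartbeats 2000000 in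
theorem Achieves.blockProg {p : Prog} {R : ℕ} (hp : p.UsesBelow R) {B D X : ℤ} {w w' : ℕ}
    (hS : Scales x.m (6 * κ + 6) B D X w') (hw : (2 : ℤ) ^ w ≤ B)
    (hX : ∀ y, |(hammingDistances κ).inputMem x y| < X) {t τ₀ : ℕ} (ht : t < 2 * κ) {σ : AState}
    (hI : BlockInv x D B t σ) (h6 : σ.reg 6 = t) (h7 : σ.reg 7 = (2 * κ : ℕ)) {ε : ENNReal}
    (hε : rangeThreeSum.failProb p w τ₀ (x.block t) ≤ ε) :
    Achieves w' (blockTime R x.m τ₀) ε (blockProg R p) σ fun τ => τ.reg 6 = t ∧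
      τ.reg 7 = (2 * κ : ℕ) ∧ BlockInv x D B (t + 1) (τ.set 6 (t + 1 : ℕ)) := by
  obtain ⟨hm, hT, hBD, hDX, hwide⟩ := hS
  have hn := x.n_le
  have hmn := x.m_le_n
  have hκ : 1 ≤ κ := by omega
  push_cast at hT hDX
  have hκm : (κ : ℤ) ≤ κ * x.m := le_mul_of_one_le_right (by positivity) (by exact_mod_cast hm)
  have hn' : (x.n : ℤ) ≤ κ * x.m := by exact_mod_cast hn
  have hm' : (1 : ℤ) ≤ x.m := by exact_mod_cast hm
  have hmn' : (x.m : ℤ) ≤ x.n := by exact_mod_cast hmn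
  have hTB : 6 * (κ * x.m : ℤ) + 6 * x.m ≤ B := by linarith
  have hmκ : (x.m : ℤ) ≤ κ * x.m :=
    le_mul_of_one_le_left (by positivity) (by exact_mod_cast hκ)
  have hB0 : 0 < B := by linarith
  have hD0 : 0 < D := by linarith
  have hκD : 0 ≤ (κ : ℤ) * D := by positivity
  have hDX' : D ≤ X := by linarith
  have hwX := hwide.lt
  have hX0 : 0 < X := by linarith
  have htκ : (t : ℤ) + 1 ≤ 2 * κ := by exact_mod_cast ht
  have htD : (t : ℤ) * D + D ≤ 2 * (κ * D) := by
    have := mul_le_mul_of_nonneg_right htκ hD0.le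
    linarith
  have htD0 : 0 ≤ (t : ℤ) * D := by positivity
  set O : ℤ := (t + 1) * D with hO
  have hOD : D ≤ O := by rw [hO]; linarith
  have hOX : O + D ≤ X := by rw [hO]; linarith
  have hdiv : t / 2 + t % 2 ≤ κ := by omega
  have hdivm : (t / 2 + t % 2) * x.m ≤ κ * x.m := Nat.mul_le_mul_right _ hdiv
  have hdivm' : (((t / 2 + t % 2 : ℕ) : ℤ)) * x.m ≤ κ * x.m := by exact_mod_cast hdivm
  have hloopw : (x.m : ℤ) + 1 < 2 ^ w' := by linarith
  set μ := σ.mem with hμ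
  -- the two parts of the input
  set v₁ : ℕ → ℤ := fun j => x.textChar ((t / 2 + t % 2) * x.m + j) * (2 * x.m) +
    ((t % 2 : ℕ) * x.m + j) with hv₁
  set v₂ : ℕ → ℤ := fun j => 0 - (σ.mem j * (2 * x.m) + j) with hv₂
  have b {z : ℤ} (h1 : 0 ≤ z) (h2 : z ≤ D) : |z| ≤ X := by
    rw [abs_of_nonneg h1]; linarith
  have b0 : |(0 : ℤ)| ≤ X := b le_rfl hD0.le
  have b1 : |(1 : ℤ)| ≤ X := b (by norm_num) (by linarith)
  have b2 : |(2 : ℤ)| ≤ X := b (by norm_num) (by linarith)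
  have b6 : |(t : ℤ)| ≤ X := b (by positivity) (by linarith)
  have bm : |(x.m : ℤ)| ≤ X := b (by positivity) (by linarith)
  have bn : |(x.n : ℤ)| ≤ X := b (by positivity) (by linarith)
  have bD : |D| ≤ X := b hD0.le le_rfl
  have bO : |O| ≤ X := by rw [abs_of_nonneg (by linarith)]; linarith
  have bj {j : ℕ} (hj : j < x.m) : |(j : ℤ)| ≤ X := b (by positivity) (by linarith)
  refine Achieves.mono (t₁ := 17 + ((x.m * 180 + loopOverhead) +
    ((x.m * 100 + loopOverhead) + (4 * R + 3 * τ₀ + 2) + 1) + 1) + 1) ?_ ?_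
      hε fun _ h => h
  swap
  · simp only [loopOverhead, blockTime]; omega
  refine Achieves.seq_eq (τ := σ.set 8 O) ?_ ?_
  · refine Achieves.assign_of_bounded hwide 17 ?_ ?_
    · simp only [Expr.Bounded, Expr.add_eq, Expr.mul_eq, BinOp.Tame, h6, hI.r5, b1, b6, bD, and_self]
    · show (σ.reg 6 + 1) * σ.reg 5 = O
      rw [h6, hI.r5]
  refine Achieves.seq_eq (τ := ⟨Function.update (σ.set 8 O).reg 2 x.m, filled μ O x.m v₁⟩) ?_ ?_
  · refine Achieves.fill_of_bounded hwide 180 (by simp [AState.set_reg, hI.r0]) (by linarith) O v₁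
      fun j hj τ hτ => ?_
    have e0 : τ.reg 0 = x.m := by simp [hτ, AState.set, hI.r0]
    have e1 : τ.reg 1 = x.n := by simp [hτ, AState.set, hI.r1]
    have e2 : τ.reg 2 = j := by simp [hτ]
    have e6 : τ.reg 6 = t := by simp [hτ, AState.set, h6]
    have e8 : τ.reg 8 = O := by simp [hτ, AState.set]
    set k : ℕ := (t / 2 + t % 2) * x.m + j with hk
    have ek : (τ.reg 6 / 2 + τ.reg 6 % 2) * τ.reg 0 + τ.reg 2 = k := by
      rw [e6, e0, e2, hk]; push_cast; ring
    have hkO : ((x.m : ℤ) + k) < D - B := by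
      rw [hk]; push_cast at hdivm' ⊢; linarith
    have em : τ.mem (x.m + k) = (hammingDistances κ).inputMem x (x.m + k) := by
      rw [hτ]
      simp only
      rw [filled_not_mem _ _ (Or.inl (by linarith))]
      exact hI.low _ hkO
    refine ⟨?_, ?_, ?_, ?_⟩
    · simp only [Expr.Bounded, Expr.add_eq, BinOp.Tame, e2, e8, bO, bj hj, and_self]
    · have : |τ.mem (τ.reg 0 + ((τ.reg 6 / 2 + τ.reg 6 % 2) * τ.reg 0 + τ.reg 2))| ≤ X := by
        rw [ek, e0, em]; exact (hX _).le
      simp only [Expr.Bounded, Expr.add_eq, Expr.sub_eq, Expr.mul_eq, Expr.div_eq, Expr.mod_eq,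
        BinOp.Tame, e0, e1, e2, e6, bm, bn, b1, b2, b6, bj hj, and_self, true_and, and_true]
      exact this
    · show τ.reg 8 + τ.reg 2 = _
      rw [e8, e2]
    · show (BinOp.lt.eval ((τ.reg 6 / 2 + τ.reg 6 % 2) * τ.reg 0 + τ.reg 2) (τ.reg 1) *
        (τ.mem (τ.reg 0 + ((τ.reg 6 / 2 + τ.reg 6 % 2) * τ.reg 0 + τ.reg 2)) + 1) - 1) *
          (2 * τ.reg 0) + (τ.reg 6 % 2 * τ.reg 0 + τ.reg 2) = v₁ j
      rw [ek, e0, e1, e2, e6, em, BinOp.eval_natCast_lt]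
      -- The comparison bit replaces a branch: beyond the end of the text the product vanishes and
      -- the character `-1` remains, which matches nothing.
      have : (if k < x.n then 1 else 0) * ((hammingDistances κ).inputMem x (x.m + k) + 1) - 1 =
          x.textChar k := by
        unfold MatchingInst.textChar
        split_ifs with hkn
        · have := inputMem_text x ⟨k, hkn⟩
          push_cast at this
          rw [this]; ring
        · ring
      rw [this, hv₁]
      push_cast
      rfl
  refine Achieves.seq_eq (τ := ⟨Function.update (σ.set 8 O).reg 2 x.m,
    filled (filled μ O x.m v₁) (O + x.m) x.m v₂⟩) ?_ ?_
  · refine (Achieves.fill_of_bounded hwide 100 (by simp [AState.set, hI.r0])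
      (by linarith) (O + x.m) v₂ fun j hj τ hτ => ?_).mono le_rfl le_rfl ?_
    swap
    · rintro _ rfl; simp
    have e0 : τ.reg 0 = x.m := by simp [hτ, AState.set, hI.r0]
    have e2 : τ.reg 2 = j := by simp [hτ]
    have e8 : τ.reg 8 = O := by simp [hτ, AState.set]
    have hjD : (j : ℤ) < D - B := by linarith
    have em : τ.mem j = σ.mem j := by
      rw [hτ]
      simp only
      rw [filled_not_mem _ _ (Or.inl (by linarith)), filled_not_mem _ _ (Or.inl (by linarith))]
    have bmem : |τ.mem j| ≤ X := by
      rw [em, hI.low _ hjD]; exact (hX _).le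
    refine ⟨?_, ?_, ?_, ?_⟩
    · simp only [Expr.Bounded, Expr.add_eq, BinOp.Tame, e0, e2, e8, bO, bm, bj hj, and_self]
    · have : |τ.mem (τ.reg 2)| ≤ X := by rwa [e2]
      simp only [Expr.Bounded, Expr.add_eq, Expr.sub_eq, Expr.mul_eq, Expr.eval,
        BinOp.Tame, e0, e2, bm, b0, b2, bj hj, bmem, and_self]
    · show τ.reg 8 + τ.reg 0 + τ.reg 2 = _
      rw [e8, e0, e2]
    · show 0 - (τ.mem (τ.reg 2) * (2 * τ.reg 0) + τ.reg 2) = v₂ j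
      rw [e0, e2, em]
  have hmem := filled_filled_data (x.block t).a (x.block t).b (μ := μ) (O := O) (B := B)
    (fun a ha => hI.high _ (by have := abs_lt.1 ha; linarith)) (v₁ := v₁) (v₂ := v₂)
    (fun j => rfl) (fun j => by
      have hj : ((j : ℕ) : ℤ) < D - B := by
        have : ((j : ℕ) : ℤ) < x.m := by exact_mod_cast j.isLt
        linarith
      have := inputMem_pattern x j
      show 0 - (σ.mem (j : ℕ) * (2 * x.m) + (j : ℕ)) = -((x.P j : ℤ) * (2 * x.m) + (j : ℕ))
      rw [hI.low _ hj, this]; ring)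
  refine (Achieves.call rangeThreeSum (x.block t) hp (O := O) (B := B) (t := τ₀) (w := w) ?_ hw ?_ ?_ ?_ hmem
    ?_).mono le_rfl le_rfl ?_
  · simp [AState.set]
  · rw [abs_of_nonneg (by linarith)]; linarith
  · intro r hr
    rcases r with _ | r
    · simp [AState.set, hI.r0, rangeThreeSum, MatchingInst.block]
    · simp [AState.set, hI.r9, rangeThreeSum]
  · intro r hr
    rcases r with _ | r
    · simp [rangeThreeSum, MatchingInst.block]; linarith
    · simp [rangeThreeSum, hB0]
  · simp [rangeThreeSum, MatchingInst.block]; linarith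
  · rintro τ ⟨h1, h2, h3⟩
    have hr (r : Fin numLocals) (hr2 : r ≠ 2) (hr8 : r ≠ 8) : τ.reg r = σ.reg r := by
      rw [h1]; simp [AState.set, hr2, hr8]
    have out (y : ℤ) (hy : B ≤ |y - O|) (hy' : y < O ∨ O + 2 * x.m ≤ y) : τ.mem y = σ.mem y := by
      rw [h3 y hy]
      simp only
      rw [filled_not_mem _ _ (by omega), filled_not_mem _ _ (by omega)]
    refine ⟨?_, ?_, ?_⟩
    · rw [hr _ (by decide) (by decide), h6]
    · rw [hr _ (by decide) (by decide), h7]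
    refine BlockInv.of_reg_eq (τ := τ) x ⟨?_, ?_, ?_, ?_, ?_, ?_, ?_⟩ rfl ?_ ?_ ?_ ?_
    · rw [hr _ (by decide) (by decide), hI.r0]
    · rw [hr _ (by decide) (by decide), hI.r1]
    · rw [hr _ (by decide) (by decide), hI.r5]
    · rw [hr _ (by decide) (by decide), hI.r9]
    · intro y hy
      rw [out y (by rw [abs_of_nonpos (by linarith)]; linarith) (Or.inl (by linarith))]
      exact hI.low y hy
    · intro y hy
      have hy2 : O + D - B ≤ y := by rw [hO]; push_cast at hy; linarith
      rw [out y (by rw [abs_of_nonneg (by linarith)]; linarith) (Or.inr (by linarith))]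
      exact hI.high y (by linarith)
    · intro t' ht' c hc
      rcases Nat.lt_succ_iff_lt_or_eq.1 ht' with hlt | rfl
      · have hle : ((t' : ℤ) + 1) * D + D ≤ O := by
          have : (t' : ℤ) + 1 ≤ t := by exact_mod_cast hlt
          have := mul_le_mul_of_nonneg_right this hD0.le
          rw [hO]; linarith
        have hc' : (c : ℤ) < x.m := by exact_mod_cast hc
        have hlt2 : ((t' : ℤ) + 1) * D + 2 * x.m + c ≤ O - B := by linarith
        rw [out _ (by rw [abs_of_nonpos (by linarith)]; linarith) (Or.inl (by linarith))]
        exact hI.res t' hlt c hc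
      · have hlen : (rangeThreeSum.data (x.block t')).length = x.m + x.m := by
          simp [rangeThreeSum, MatchingInst.block]
        have hcl : c < (rangeThreeSum.answer (x.block t')).length := by
          simpa [rangeThreeSum, MatchingInst.block] using hc
        have h4 := h2 c hcl
        rw [hlen] at h4
        rw [show ((t' : ℤ) + 1) * D + 2 * x.m + c = O + (((x.m + x.m : ℕ) : ℤ) + c) by
          rw [hO]; push_cast; ring, h4]
        have : (rangeThreeSum.answer (x.block t'))[c] =
          ((((Finset.univ.map (x.block t').a) ×ˢ (Finset.univ.map (x.block t').b)).filter
            fun z => z.1 + z.2 = (c : ℤ)).card : ℤ) := by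
          simp [rangeThreeSum]
        rw [this, card_filter_map_product]
        rfl
    all_goals simp [AState.set_reg]

end block

/-- All scales are powers of two whose exponents are multiples of the bit length, so the conditions
reduce to comparing exponents; the factor 41 leaves room for `X ^ 40`. -/
theorem Scales.of_size {N T a T₀ : ℕ} (e : ℕ) (hN : 1 ≤ N) (hT : T ≤ 2 ^ (T₀ * N.size)) :
    Scales N T (2 ^ ((a + T₀ + 1) * N.size)) (2 ^ ((a + T₀ + 2) * N.size))
      (2 ^ ((a + 2 * T₀ + e + 5) * N.size)) (41 * (a + 2 * T₀ + e + 5) * N.size) := by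
  have hs : 1 ≤ N.size := Nat.size_pos.2 hN
  have hNs : N ≤ 2 ^ N.size := (Nat.lt_size_self N).le
  have two (b c : ℕ) (h : b ≤ c) : (2 : ℤ) ^ (b * N.size) ≤ 2 ^ (c * N.size) :=
    pow_le_pow_right₀ (by norm_num) (Nat.mul_le_mul_right _ h)
  have hT' : (T : ℤ) ≤ 2 ^ (T₀ * N.size) := by exact_mod_cast hT
  have hN' : (N : ℤ) ≤ 2 ^ N.size := by exact_mod_cast hNs
  have h2 : (2 : ℤ) ≤ 2 ^ N.size := le_self_pow₀ (by norm_num) (by omega)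
  refine ⟨hN, ?_, ?_, ?_, ?_, ?_⟩
  · calc (T : ℤ) * N ≤ 2 ^ (T₀ * N.size) * 2 ^ N.size := by gcongr
      _ = 2 ^ ((T₀ + 1) * N.size) := by rw [add_mul, one_mul, pow_add]
      _ ≤ _ := two _ _ (by omega)
  · calc (2 : ℤ) * 2 ^ ((a + T₀ + 1) * N.size) ≤ 2 ^ N.size * 2 ^ ((a + T₀ + 1) * N.size) := by
          gcongr
      _ = _ := by rw [← pow_add]; congr 1; ring
  · have : (T : ℤ) + 2 ≤ 2 ^ (T₀ * N.size) * 2 ^ (2 * N.size) := by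
      have h1 : (1 : ℤ) ≤ 2 ^ (T₀ * N.size) := one_le_pow₀ (by norm_num)
      have h4 : (4 : ℤ) ≤ 2 ^ (2 * N.size) := by
        rw [two_mul, pow_add]; nlinarith
      nlinarith
    calc ((T : ℤ) + 2) * 2 ^ ((a + T₀ + 2) * N.size) ≤
        2 ^ (T₀ * N.size) * 2 ^ (2 * N.size) * 2 ^ ((a + T₀ + 2) * N.size) := by gcongr
      _ = 2 ^ ((a + 2 * T₀ + 4) * N.size) := by rw [← pow_add, ← pow_add]; congr 1; ring
      _ ≤ _ := two _ _ (by omega)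
  · exact le_self_pow₀ (by norm_num) (by positivity)
  · rw [← pow_mul]
    refine pow_lt_pow_right₀ (by norm_num) ?_
    nlinarith

/-! ### From Hamming distances to 3SUM: the algorithm -/

section hamming

variable {κ : ℕ} (x : MatchingInst κ)

theorem Achieves.hammingProg {p : Prog} {k R : ℕ} (hp : p.UsesBelow R) {B X : ℤ} {w w' : ℕ}
    (hκ : 1 ≤ κ) (hk : 1 ≤ k) (hkw : k * x.m.size + 3 ≤ w')
    (hS : Scales x.m (6 * κ + 6) B (2 ^ (k * x.m.size)) X w') (hw : (2 : ℤ) ^ w ≤ B)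
    (hX : ∀ y, |(hammingDistances κ).inputMem x y| < X) {τ₀ : ℕ} {ε : ENNReal}
    (hε : ∀ t, rangeThreeSum.failProb p w τ₀ (x.block t) ≤ ε) (hτ₀ : x.m ≤ τ₀) :
    Achieves w' ((2 * κ * (4 * R + 627) + 200 * κ + 300) * τ₀) ((2 * κ : ℕ) * ε)
      (hammingProg κ k R p)
      ⟨fun r => ((hammingDistances κ).args x).getD r 0, (hammingDistances κ).inputMem x⟩
      fun τ => ∀ i < x.n - x.m + 1, τ.mem (x.m + x.n + i) =
        (x.m : ℤ) - x.blockCount (2 * (i / x.m)) (i % x.m) -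
          x.blockCount (2 * (i / x.m) + 1) (i % x.m) := by
  obtain ⟨hm, hT, hBD, hDX, hwide⟩ := id hS
  set D : ℤ := 2 ^ (k * x.m.size) with hD
  have hn := x.n_le
  have hmn := x.m_le_n
  push_cast at hT hDX
  have hmκ : (x.m : ℤ) ≤ κ * x.m :=
    le_mul_of_one_le_left (by positivity) (by exact_mod_cast hκ)
  have hκm : (κ : ℤ) ≤ κ * x.m := le_mul_of_one_le_right (by positivity) (by exact_mod_cast hm)
  have hn' : (x.n : ℤ) ≤ κ * x.m := by exact_mod_cast hn
  have hm' : (1 : ℤ) ≤ x.m := by exact_mod_cast hm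
  have hmn' : (x.m : ℤ) ≤ x.n := by exact_mod_cast hmn
  have hTB : 6 * (κ * x.m : ℤ) + 6 * x.m ≤ B := by linarith
  have hB0 : 0 < B := by linarith
  have hD0 : 0 < D := by linarith
  have hκD : 0 ≤ (κ : ℤ) * D := by positivity
  have hDX' : D ≤ X := by linarith
  have hwX := hwide.lt
  set σ₀ : AState :=
    ⟨fun r => ((hammingDistances κ).args x).getD r 0, (hammingDistances κ).inputMem x⟩ with hσ₀
  set σ₁ := ((σ₀.set 4 x.m.size).set 2 x.m).set 5 D with hσ₁
  have htime : 100 * x.m + (10 + ((2 * κ * (blockTime R x.m τ₀ + loopOverhead) + loopOverhead) +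
      (20 + ((x.n - x.m + 1) * 200 + loopOverhead) + 1) + 1) + 1) + 1 ≤
      (2 * κ * (4 * R + 627) + 200 * κ + 300) * τ₀ := by
    have h1 : x.n - x.m + 1 ≤ κ * τ₀ := by
      have := Nat.mul_le_mul_left κ hτ₀; omega
    have h2 : blockTime R x.m τ₀ + loopOverhead ≤ (4 * R + 627) * τ₀ := by
      have : R ≤ R * τ₀ := Nat.le_mul_of_pos_right _ (by omega)
      simp only [blockTime, loopOverhead]
      linarith
    have h3 := Nat.mul_le_mul_left (2 * κ) h2
    simp only [loopOverhead] at h3 ⊢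
    linarith
  refine Achieves.mono ?_ htime le_rfl fun _ h => h
  refine Achieves.seq_eq (τ := σ₁) (Achieves.powerProg hk hm rfl hkw) ?_
  refine Achieves.seq_eq (τ := σ₁.set 7 (2 * κ : ℕ)) ?_ ?_
  · refine Achieves.assign_of_bounded hwide 10 ?_ (by simp [Expr.eval]) (by simp [Expr.leaves])
      (by simp [Expr.time])
    show |((2 * κ : ℤ))| ≤ X
    rw [abs_of_nonneg (by positivity)]; linarith
  have hloop := Achieves.forLoop (w := w') (tb := blockTime R x.m τ₀) (nn := 2 * κ) (ε := ε)
    (i := 6) (n := 7) (p := _root_.blockProg R p) (by decide) (Inv := BlockInv x D B)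
    (by push_cast; linarith)
    (fun t ht σ h6 h7 hI => Achieves.blockProg x hp hS hw hX ht hI h6 h7 (hε t))
    (σ := σ₁.set 7 (2 * κ : ℕ)) (by simp [AState.set_reg]) ?_
  · rw [← add_zero (((2 * κ : ℕ) : ENNReal) * ε)]
    refine Achieves.seq hloop fun σ hI => ?_
    have b {z : ℤ} (h1 : 0 ≤ z) (h2 : z ≤ D) : |z| ≤ X := by
      rw [abs_of_nonneg h1]; linarith
    have b1 : |(1 : ℤ)| ≤ X := b (by norm_num) (by linarith)
    have b2 : |(2 : ℤ)| ≤ X := b (by norm_num) (by linarith)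
    have bm : |(x.m : ℤ)| ≤ X := b (by positivity) (by linarith)
    have bn : |(x.n : ℤ)| ≤ X := b (by positivity) (by linarith)
    have bD : |D| ≤ X := b hD0.le le_rfl
    refine Achieves.seq_eq (τ := σ.set 10 (x.n - x.m + 1 : ℕ)) ?_ ?_
    · refine Achieves.assign_of_bounded hwide 20 ?_ ?_
      · simp only [Expr.Bounded, Expr.add_eq, Expr.sub_eq, BinOp.Tame, hI.r0, hI.r1, b1, bm, bn,
          and_self]
      · show σ.reg 1 - σ.reg 0 + 1 = _
        rw [hI.r0, hI.r1]; omega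
    refine (Achieves.fill_of_bounded hwide 200 (nn := x.n - x.m + 1) (by simp [AState.set_reg])
      (by omega) (x.m + x.n) (fun i => (x.m : ℤ) - x.blockCount (2 * (i / x.m)) (i % x.m) -
          x.blockCount (2 * (i / x.m) + 1) (i % x.m)) fun j hj τ hτ => ?_).mono le_rfl le_rfl ?_
    swap
    · rintro _ rfl i hi
      simp only
      rw [filled_mem _ _ hi]
    have e0 : τ.reg 0 = x.m := by simp [hτ, AState.set, hI.r0]
    have e1 : τ.reg 1 = x.n := by simp [hτ, AState.set, hI.r1]
    have e2 : τ.reg 2 = j := by simp [hτ]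
    have e5 : τ.reg 5 = D := by simp [hτ, AState.set, hI.r5]
    have hc : j % x.m < x.m := Nat.mod_lt _ hm
    -- From `j ≤ n - m ≤ (κ - 1) * m`; hence `2 * κ` calls cover all shifts.
    have hg : j / x.m + 1 ≤ κ := by
      rw [Nat.succ_le_iff, Nat.div_lt_iff_lt_mul hm]; omega
    have ediv : τ.reg 2 / τ.reg 0 = (j / x.m : ℕ) := by rw [e0, e2]; norm_cast
    have emod : τ.reg 2 % τ.reg 0 = (j % x.m : ℕ) := by rw [e0, e2]; norm_cast
    have count_le (t c : ℕ) (hc : c < x.m) : (x.blockCount t c : ℤ) ≤ x.m := by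
      rw [x.blockCount_eq t hc]
      exact_mod_cast (Finset.card_filter_le _ _).trans_eq (by simp)
    have res (t : ℕ) (ht : t < 2 * κ) : τ.mem ((t + 1) * D + 2 * x.m + (j % x.m : ℕ)) =
        x.blockCount t (j % x.m) := by
      rw [hτ]
      simp only
      -- The output written so far lies below the answers of the calls and does not destroy them.
      rw [filled_not_mem _ _ (Or.inr ?_)]
      · exact hI.res t ht _ hc
      · have : 0 ≤ (t : ℤ) * D := by positivity
        have hj' : (j : ℤ) ≤ x.n - x.m := by omega
        have := Int.natCast_nonneg (j % x.m)
        linarith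
    have em1 : τ.mem ((2 * (τ.reg 2 / τ.reg 0) + 1) * τ.reg 5 + 2 * τ.reg 0 +
        τ.reg 2 % τ.reg 0) = x.blockCount (2 * (j / x.m)) (j % x.m) := by
      rw [ediv, emod, e5, e0, ← res _ (by omega)]
      push_cast; rfl
    have em2 : τ.mem ((2 * (τ.reg 2 / τ.reg 0) + 2) * τ.reg 5 + 2 * τ.reg 0 +
        τ.reg 2 % τ.reg 0) = x.blockCount (2 * (j / x.m) + 1) (j % x.m) := by
      rw [ediv, emod, e5, e0, ← res _ (by omega)]
      push_cast
      ring_nf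
    have bj : |(j : ℤ)| ≤ X := b (by positivity) (by omega)
    have bc (t : ℕ) : |(x.blockCount t (j % x.m) : ℤ)| ≤ X :=
      b (by positivity) (by have := count_le t _ hc; linarith)
    refine ⟨?_, ?_, ?_, ?_⟩
    · simp only [Expr.Bounded, Expr.add_eq, BinOp.Tame, e0, e1, e2, bj, bm, bn, and_self]
    · have h1 : |τ.mem ((2 * (τ.reg 2 / τ.reg 0) + 1) * τ.reg 5 + 2 * τ.reg 0 +
        τ.reg 2 % τ.reg 0)| ≤ X := by rw [em1]; exact bc _
      have h2 : |τ.mem ((2 * (τ.reg 2 / τ.reg 0) + 2) * τ.reg 5 + 2 * τ.reg 0 +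
        τ.reg 2 % τ.reg 0)| ≤ X := by rw [em2]; exact bc _
      simp only [Expr.Bounded, Expr.add_eq, Expr.sub_eq, Expr.mul_eq, Expr.div_eq, Expr.mod_eq,
        BinOp.Tame, e0, e2, e5, bm, b1, b2, bD, bj, and_self, true_and]
      exact ⟨h1, h2⟩
    · show τ.reg 0 + τ.reg 1 + τ.reg 2 = _
      rw [e0, e1, e2]
    · show τ.reg 0 - τ.mem ((2 * (τ.reg 2 / τ.reg 0) + 1) * τ.reg 5 + 2 * τ.reg 0 +
        τ.reg 2 % τ.reg 0) - τ.mem ((2 * (τ.reg 2 / τ.reg 0) + 2) * τ.reg 5 + 2 * τ.reg 0 +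
        τ.reg 2 % τ.reg 0) = _
      rw [em1, em2, e0]
  · have hlen : ((hammingDistances κ).data x).length = x.m + x.n := by
      simp [hammingDistances]
    refine ⟨?_, ?_, ?_, ?_, fun y _ => rfl, fun y hy => ?_, fun t ht => absurd ht (by omega)⟩
    · simp [AState.set_reg, hσ₁, hσ₀, hammingDistances]
    · simp [AState.set_reg, hσ₁, hσ₀, hammingDistances]
    · simp [AState.set_reg, hσ₁]
    · simp [AState.set_reg, hσ₁, hσ₀, hammingDistances]
      rfl
    · refine Problem.inputMem_of_le (hammingDistances κ) x ?_
      rw [hlen]; push_cast at hy ⊢; linarith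

end hamming

/-! ### Choice of the parameters in the reduction to 3SUM. -/

theorem two_pow_size_le_succ_pow (N k : ℕ) : (N + 1) ^ k ≤ 2 ^ (k * N.size) := by
  rw [mul_comm, pow_mul]
  exact Nat.pow_le_pow_left (Nat.lt_size_self N) k

/-- Keeping the failure bound `ε` abstract serves both versions: an inverse power of `N + 1` for
randomized algorithms, zero for deterministic ones. That it is below one is what makes the time
bound at least linear. -/
theorem exists_hammingProg {κ : ℕ} (hκ : 2 ≤ κ) (u : ℕ) (p : Prog) (k C : ℕ) (f : ℕ → ℝ)
    (ε : ℕ → ENNReal) (hε1 : ∀ N, 1 ≤ N → ε N < 1)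
    (h : ∀ x : ThreeSumInst, rangeThreeSum.PolyBounded (u + 4) x →
      rangeThreeSum.failProb p (k * x.N.size) ⌊C * f x.N⌋₊ x ≤ ε x.N) :
    ∃ (p' : Prog) (k' C' : ℕ), (p.Deterministic → p'.Deterministic) ∧
      ∀ x : MatchingInst κ, (hammingDistances κ).PolyBounded u x →
        (hammingDistances κ).failProb p' (k' * x.m.size)
          ⌊(C' : ℝ) * (f x.m * Real.log ((x.m : ℝ) + 2) ^ 0)⌋₊ x ≤ (2 * κ : ℕ) * ε x.m := by
  obtain ⟨R, hR⟩ := p.exists_usesBelow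
  set T₀ := 6 * κ + 6 with hT₀
  refine ⟨hammingProg κ (k + T₀ + 2) R p, 41 * (k + 2 * T₀ + u + 5),
    3 ^ 0 * (2 * κ * (4 * R + 627) + 200 * κ + 300) * C, hammingProg_deterministic _ _ _,
    fun x hx => ?_⟩
  have hm := x.m_pos
  have hs : 1 ≤ x.m.size := Nat.size_pos.2 hm
  set τ₀ := ⌊C * f x.m⌋₊ with hτ₀
  have hmτ : x.m ≤ τ₀ := rangeThreeSum_size_le (p := p) (u := u + 4) (w := k * x.m.size)
    (by omega) hm fun y hy hb => by
      have := h y hb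
      rw [hy] at this
      exact this.trans_lt (hε1 _ hm)
  have hS : Scales x.m (6 * κ + 6) _ _ _ _ := Scales.of_size (a := k) (T₀ := T₀) u hm
    (Nat.lt_two_pow_self.le.trans
      (Nat.pow_le_pow_right (by norm_num) (Nat.le_mul_of_pos_right _ hs)))
  have hA := Achieves.hammingProg x hR (k := k + T₀ + 2) (w := k * x.m.size) (τ₀ := τ₀) (by omega)
    (by omega) (by nlinarith) hS (pow_le_pow_right₀ (by norm_num)
      (Nat.mul_le_mul_right _ (by omega))) (fun y => ?_) (ε := ε x.m)
    (fun t => h (x.block t) (x.polyBounded_block hx t)) hmτ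
  · have hA' := hA.mono (le_floor_of_le_mul (e := 0) hτ₀ (by omega) (Nat.size_le_log hm)
      (by rw [pow_zero, mul_one])) le_rfl fun _ h => h
    refine failProb_le_of_achieves (Q := hammingDistances κ) hA' fun τ hτ i hi => ?_
    have hlen : ((hammingDistances κ).data x).length = x.m + x.n := by
      simp [hammingDistances]
    have hi' : i < x.n - x.m + 1 := by simpa [hammingDistances] using hi
    rw [hlen, Nat.cast_add, hτ i hi']
    have := x.blockCount_add_blockCount_add_hammingDist hi'
    simp only [hammingDistances, List.getElem_ofFn]
    omega
  · refine (Problem.abs_inputMem_le hx y).trans_lt ?_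
    have h1 : ((x.m : ℤ) + 1) ^ u ≤ 2 ^ (u * x.m.size) := by
      exact_mod_cast two_pow_size_le_succ_pow x.m u
    refine h1.trans_lt (pow_lt_pow_right₀ (by norm_num) ?_)
    exact Nat.mul_lt_mul_of_pos_right (by omega) hs

/-- As `a ≤ 2 ^ a ≤ (N + 1) ^ a`, a union bound over `a` events is paid for by raising the exponent
by `a`. -/
theorem const_mul_inv_pow_le {N : ℕ} (hN : 1 ≤ N) (a c : ℕ) :
    (a : ENNReal) * (((N : ENNReal) + 1) ^ (c + a))⁻¹ ≤ (((N : ENNReal) + 1) ^ c)⁻¹ := by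
  have h0 : (N : ENNReal) + 1 ≠ 0 := by simp
  have ht : (N : ENNReal) + 1 ≠ ⊤ := by simp
  have ha : (a : ENNReal) ≤ ((N : ENNReal) + 1) ^ a := by
    have : a ≤ (N + 1) ^ a := Nat.lt_two_pow_self.le.trans (Nat.pow_le_pow_left (by omega) a)
    exact_mod_cast this
  rw [pow_add, ENNReal.mul_inv (Or.inr (by finiteness)) (Or.inr (by positivity)), mul_left_comm]
  refine (mul_le_mul_right (mul_le_mul_left ha _) _).trans (le_of_eq ?_)
  rw [ENNReal.mul_inv_cancel (by positivity) (by finiteness), mul_one]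

theorem inv_pow_lt_one {N : ℕ} (hN : 1 ≤ N) {c : ℕ} (hc : 1 ≤ c) :
    (((N : ENNReal) + 1) ^ c)⁻¹ < 1 := by
  rw [ENNReal.inv_lt_one]
  refine one_lt_pow₀ ?_ (by omega)
  have : (1 : ENNReal) < (N + 1 : ℕ) := by exact_mod_cast (by omega : 1 < N + 1)
  simpa using this

theorem hammingDistances_of_rangeThreeSum_randomized {f : ℕ → ℝ} {κ : ℕ} (hκ : 2 ≤ κ)
    (h : rangeThreeSum.HasRandomizedAlgorithm f) :
    (hammingDistances κ).HasRandomizedAlgorithm fun m => f m * Real.log ((m : ℝ) + 2) ^ 0 := by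
  intro u c
  obtain ⟨p, k, C, hp⟩ := h (u + 4) (c + 2 * κ)
  obtain ⟨p', k', C', -, h'⟩ := exists_hammingProg hκ u p k C f
    (fun N => (((N : ENNReal) + 1) ^ (c + 2 * κ))⁻¹)
    (fun N hN => inv_pow_lt_one hN (by omega)) hp
  exact ⟨p', k', C', fun x hx => (h' x hx).trans (const_mul_inv_pow_le x.m_pos _ _)⟩

theorem hammingDistances_of_rangeThreeSum_deterministic {f : ℕ → ℝ} {κ : ℕ} (hκ : 2 ≤ κ)
    (h : rangeThreeSum.HasDeterministicAlgorithm f) :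
    (hammingDistances κ).HasDeterministicAlgorithm fun m => f m * Real.log ((m : ℝ) + 2) ^ 0 := by
  intro u
  obtain ⟨p, k, C, hd, hp⟩ := h (u + 4)
  obtain ⟨p', k', C', hd', h'⟩ := exists_hammingProg hκ u p k C f (fun _ => 0)
    (fun N _ => one_pos) (fun x hx => (hp x hx).le)
  refine ⟨p', k', C', hd' hd, fun x hx => ?_⟩
  have := h' x hx
  rwa [mul_zero, nonpos_iff_eq_zero] at this

/-! ### From 3SUM to Hamming distances: random shifts -/

open scoped Classical in
theorem card_functions_eq_on {N : ℕ} (S : Finset (Fin N)) (F₀ : Fin N → Fin N) :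
    (Finset.univ.filter fun F : Fin N → Fin N => ∀ j ∈ S, F j = F₀ j).card = N ^ (N - S.card) := by
  have : (Finset.univ.filter fun F : Fin N → Fin N => ∀ j ∈ S, F j = F₀ j) =
      Fintype.piFinset fun j => if j ∈ S then {F₀ j} else Finset.univ := by
    ext F
    simp only [Finset.mem_filter, Finset.mem_univ, true_and, Fintype.mem_piFinset]
    refine forall_congr' fun j => ?_
    split_ifs with h <;> simp [h]
  rw [this, Fintype.card_piFinset]
  have h2 (j : Fin N) : (if j ∈ S then {F₀ j} else Finset.univ : Finset (Fin N)).card =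
      if j ∈ S then 1 else N := by
    split_ifs <;> simp
  simp only [h2]
  rw [Finset.prod_ite]
  simp [Finset.filter_not, Finset.card_sdiff]

-- Elements that meet at one position have distinct values of `rep`: with equal values their offsets
-- would agree as well, against `hinj`. So `L` elements meeting at `y` prescribe `F` at `L`
-- arguments and leave at most `N ^ (N - L)` functions. The union bound runs over `y ∈ Y` and over
-- the at most `N ^ L / L!` sets of `L` elements.
open scoped Classical in
theorem card_crowded_mul_factorial_le {N L : ℕ} (E : Finset ℕ) (hE : E.card ≤ N)
    (rep : ℕ → Fin N) (off : ℕ → ℤ)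
    (hinj : ∀ i ∈ E, ∀ j ∈ E, rep i = rep j → off i = off j → i = j) (Y : Finset ℤ)
    (hY : ∀ F : Fin N → Fin N, ∀ i ∈ E, ((F (rep i) : ℕ) : ℤ) + off i ∈ Y) (hL : 1 ≤ L) :
    (Finset.univ.filter fun F : Fin N → Fin N =>
      ∃ y : ℤ, L ≤ (E.filter fun i => ((F (rep i) : ℕ) : ℤ) + off i = y).card).card * L.factorial ≤
      Y.card * N ^ N := by
  have hfix (I : Finset ℕ) (hI : I ∈ E.powersetCard L) (y : ℤ) :
      (Finset.univ.filter fun F : Fin N → Fin N =>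
        ∀ i ∈ I, ((F (rep i) : ℕ) : ℤ) + off i = y).card ≤ N ^ (N - L) := by
    rw [Finset.mem_powersetCard] at hI
    -- Every function of this kind agrees with a fixed one, `F₀`, on the image of `I`.
    rcases (Finset.univ.filter fun F : Fin N → Fin N =>
        ∀ i ∈ I, ((F (rep i) : ℕ) : ℤ) + off i = y).eq_empty_or_nonempty with h | ⟨F₀, hF₀⟩
    · rw [h]; simp
    · simp only [Finset.mem_filter, Finset.mem_univ, true_and] at hF₀
      have hcard : (I.image rep).card = L := by
        rw [Finset.card_image_of_injOn, hI.2]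
        intro i hi j hj hij
        have h1 := hF₀ i hi
        have h2 := hF₀ j hj
        rw [hij] at h1
        exact hinj i (hI.1 hi) j (hI.1 hj) hij (by linarith)
      rw [← hcard, ← card_functions_eq_on (I.image rep) F₀]
      refine Finset.card_le_card fun F hF => ?_
      simp only [Finset.mem_filter, Finset.mem_univ, true_and, Finset.forall_mem_image] at hF ⊢
      intro i hi
      have h1 := hF₀ i hi
      have h2 := hF i hi
      exact Fin.ext (by omega)
  have hsub : (Finset.univ.filter fun F : Fin N → Fin N =>
      ∃ y : ℤ, L ≤ (E.filter fun i => ((F (rep i) : ℕ) : ℤ) + off i = y).card) ⊆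
      (Y ×ˢ E.powersetCard L).biUnion fun z => Finset.univ.filter fun F : Fin N → Fin N =>
        ∀ i ∈ z.2, ((F (rep i) : ℕ) : ℤ) + off i = z.1 := by
    intro F hF
    simp only [Finset.mem_filter, Finset.mem_univ, true_and] at hF
    obtain ⟨y, hy⟩ := hF
    obtain ⟨I, hI, hIL⟩ := Finset.exists_subset_card_eq hy
    have hIE : I ⊆ E := hI.trans (Finset.filter_subset _ _)
    have hIy (i : ℕ) (hi : i ∈ I) : ((F (rep i) : ℕ) : ℤ) + off i = y :=
      (Finset.mem_filter.1 (hI hi)).2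
    obtain ⟨i, hi⟩ : I.Nonempty := Finset.card_pos.1 (by omega)
    rw [Finset.mem_biUnion]
    refine ⟨(y, I), ?_, by simpa using hIy⟩
    rw [Finset.mem_product, Finset.mem_powersetCard]
    exact ⟨hIy i hi ▸ hY F i (hIE hi), hIE, hIL⟩
  have h1 := (Finset.card_le_card hsub).trans (Finset.card_biUnion_le_card_mul _ _ (N ^ (N - L))
    fun z hz => hfix z.2 (Finset.mem_product.1 hz).2 z.1)
  rw [Finset.card_product, Finset.card_powersetCard] at h1
  by_cases hLE : L ≤ E.card
  · have h2 : E.card.choose L * L.factorial ≤ N ^ L := by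
      rw [mul_comm, ← Nat.descFactorial_eq_factorial_mul_choose]
      exact (Nat.descFactorial_le_pow _ _).trans (Nat.pow_le_pow_left hE L)
    calc _ ≤ Y.card * E.card.choose L * N ^ (N - L) * L.factorial := Nat.mul_le_mul_right _ h1
      _ = Y.card * (E.card.choose L * L.factorial) * N ^ (N - L) := by ring
      _ ≤ Y.card * N ^ L * N ^ (N - L) := by gcongr
      _ = Y.card * N ^ N := by rw [mul_assoc, ← pow_add]; congr 2; omega
  · rw [Nat.choose_eq_zero_of_lt (by omega)] at h1
    have : (Finset.univ.filter fun F : Fin N → Fin N =>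
      ∃ y : ℤ, L ≤ (E.filter fun i => ((F (rep i) : ℕ) : ℤ) + off i = y).card).card = 0 := by
      simpa using h1
    rw [this]; simp

/-! ### Layers of arrays in which every entry is written at most once -/

/-- The number of the first `n` elements at position `y`. -/
def load (pos : ℕ → ℤ) (n : ℕ) (y : ℤ) : ℕ := ((Finset.range n).filter fun i => pos i = y).card

theorem load_succ (pos : ℕ → ℤ) (n : ℕ) (y : ℤ) :
    load pos (n + 1) y = load pos n y + if pos n = y then 1 else 0 := by
  unfold load
  rw [Finset.range_add_one, Finset.filter_insert]
  split_ifs <;> simp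

theorem load_mono (pos : ℕ → ℤ) {n n' : ℕ} (h : n ≤ n') (y : ℤ) : load pos n y ≤ load pos n' y :=
  Finset.card_le_card (Finset.filter_subset_filter _ (Finset.range_mono h))

theorem load_lt (pos : ℕ → ℤ) {i n : ℕ} (h : i < n) {y : ℤ} (hy : pos i = y) :
    load pos i y < load pos n y := by
  have := load_mono pos (Nat.succ_le_of_lt h) y
  rw [Nat.succ_eq_add_one, load_succ, if_pos hy] at this
  omega

/-- The character of the `r`-th element at position `y`, if there is one among the first `n`
elements, and `0` otherwise. -/
def layer (pos chr : ℕ → ℤ) (n : ℕ) (y : ℤ) (r : ℕ) : ℤ :=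
  ∑ i ∈ Finset.range n, if pos i = y ∧ load pos i y = r then chr i else 0

theorem layer_succ (pos chr : ℕ → ℤ) (n : ℕ) (y : ℤ) (r : ℕ) :
    layer pos chr (n + 1) y r =
      layer pos chr n y r + if pos n = y ∧ load pos n y = r then chr n else 0 := by
  rw [layer, Finset.sum_range_succ, ← layer]

/-- The layer of an element is the number of its predecessors at the same position, which stays
below the load. -/
theorem layer_of_load_le (pos chr : ℕ → ℤ) {n : ℕ} {y : ℤ} {r : ℕ} (h : load pos n y ≤ r) :
    layer pos chr n y r = 0 := by
  refine Finset.sum_eq_zero fun i hi => ?_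
  rw [if_neg]
  rintro ⟨h1, h2⟩
  have := load_lt pos (Finset.mem_range.1 hi) h1
  omega

theorem layer_succ_eq_ite (pos chr : ℕ → ℤ) (n : ℕ) (y : ℤ) (r : ℕ) :
    layer pos chr (n + 1) y r =
      if pos n = y ∧ load pos n y = r then chr n else layer pos chr n y r := by
  rw [layer_succ]
  split_ifs with h
  · rw [layer_of_load_le _ _ h.2.le, zero_add]
  · rw [add_zero]

/-- A new element at `y` enters the layer `load pos n y`, which was blank before, and leaves the
others alone. Blanks contribute nothing because of `hg`, and the bound on the load ensures that the
layer is one of the `L` summands. -/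
theorem sum_layer (pos chr : ℕ → ℤ) {n L : ℕ} {y : ℤ} (h : load pos n y ≤ L) (g : ℤ → ℕ)
    (hg : g 0 = 0) :
    ∑ r ∈ Finset.range L, g (layer pos chr n y r) =
      ∑ i ∈ Finset.range n, if pos i = y then g (chr i) else 0 := by
  induction n with
  | zero => simp [layer, hg]
  | succ n ih =>
    have hn : load pos n y ≤ L := (load_mono pos (Nat.le_succ n) y).trans h
    rw [Finset.sum_range_succ, ← ih hn]
    by_cases hy : pos n = y
    · have hlt : load pos n y < L := (load_lt pos (Nat.lt_succ_self n) hy).trans_le h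
      have hmem := Finset.mem_range.2 hlt
      rw [if_pos hy, ← Finset.add_sum_erase _ _ hmem, ← Finset.add_sum_erase _ _ hmem,
        layer_succ_eq_ite, if_pos ⟨hy, rfl⟩, layer_of_load_le pos chr le_rfl, hg, zero_add,
        add_comm]
      congr 1
      refine Finset.sum_congr rfl fun r hr => ?_
      rw [layer_succ_eq_ite, if_neg]
      rintro ⟨-, h2⟩
      exact (Finset.mem_erase.1 hr).1 h2.symm
    · rw [if_neg hy, add_zero]
      refine Finset.sum_congr rfl fun r _ => ?_
      rw [layer_succ_eq_ite, if_neg (fun h => hy h.1)]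

/-- Whether two characters are equal and not blank. -/
def charMatch (u v : ℤ) : ℕ := if u = v ∧ v ≠ 0 then 1 else 0

/-- Two applications of `sum_layer`: every pair of elements at `y` and `y'` meets in exactly one
pair of layers, and blanks match nothing. -/
theorem sum_charMatch_layer (pos chr pos' chr' : ℕ → ℤ) {n n' L : ℕ} {y y' : ℤ}
    (h : load pos n y ≤ L) (h' : load pos' n' y' ≤ L) :
    ∑ r ∈ Finset.range L, ∑ r' ∈ Finset.range L,
      charMatch (layer pos chr n y r) (layer pos' chr' n' y' r') =
    ∑ i ∈ Finset.range n, ∑ i' ∈ Finset.range n',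
      if pos i = y ∧ pos' i' = y' then charMatch (chr i) (chr' i') else 0 := by
  have h1 (u : ℤ) : ∑ r' ∈ Finset.range L, charMatch u (layer pos' chr' n' y' r') =
      ∑ i' ∈ Finset.range n', if pos' i' = y' then charMatch u (chr' i') else 0 :=
    sum_layer pos' chr' h' (charMatch u) (by simp [charMatch])
  simp only [h1]
  rw [sum_layer pos chr h (fun u => ∑ i' ∈ Finset.range n', if pos' i' = y' then
    charMatch u (chr' i') else 0) ?_]
  · refine Finset.sum_congr rfl fun i _ => ?_
    split_ifs with hy
    · simp [hy]
    · simp [hy]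
  · refine Finset.sum_eq_zero fun i' _ => ?_
    have : charMatch 0 (chr' i') = 0 := if_neg fun h => h.2 h.1.symm
    simp [this]

theorem sum_range_mul_mod_div {a : ℕ} (ha : 0 < a) (b : ℕ) (h : ℕ → ℕ → ℕ) :
    ∑ t ∈ Finset.range (a * b), h (t % a) (t / a) =
      ∑ i ∈ Finset.range a, ∑ j ∈ Finset.range b, h i j := by
  induction b with
  | zero => simp
  | succ b ih =>
    rw [Nat.mul_succ, Finset.sum_range_add, ih]
    simp only [Finset.sum_range_succ, Finset.sum_add_distrib]
    congr 1
    refine Finset.sum_congr rfl fun i hi => ?_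
    rw [Finset.mem_range] at hi
    rw [Nat.mul_add_mod, Nat.mod_eq_of_lt hi, Nat.mul_add_div ha, Nat.div_eq_of_lt hi, add_zero]

/-! ### Tables of keys -/

/-- The table that assigns `i + 1` to the last `i < n` with a given key, and `0` to other keys. -/
def keyTab (key : ℕ → ℤ) : ℕ → ℤ → ℤ
  | 0 => fun _ => 0
  | n + 1 => Function.update (keyTab key n) (key n) (n + 1)

theorem keyTab_eq_zero_or (key : ℕ → ℤ) (n : ℕ) (q : ℤ) :
    keyTab key n q = 0 ∨ ∃ i < n, keyTab key n q = i + 1 ∧ key i = q := by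
  induction n with
  | zero => exact Or.inl rfl
  | succ n ih =>
    rw [keyTab]
    by_cases hq : q = key n
    · subst hq
      exact Or.inr ⟨n, Nat.lt_succ_self n, by simp, rfl⟩
    · rw [Function.update_of_ne hq]
      rcases ih with h | ⟨i, hi, h⟩
      · exact Or.inl h
      · exact Or.inr ⟨i, by omega, h⟩

theorem keyTab_ne_zero (key : ℕ → ℤ) {n i : ℕ} (hi : i < n) : keyTab key n (key i) ≠ 0 := by
  induction n with
  | zero => omega
  | succ n ih =>
    rw [keyTab]
    by_cases hq : key i = key n
    · rw [hq, Function.update_self]; omega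
    · rw [Function.update_of_ne hq]
      exact ih (by rcases Nat.lt_succ_iff_lt_or_eq.1 hi with h | rfl; exacts [h, absurd rfl hq])

/-! ### From 3SUM to Hamming distances: counting -/

namespace ThreeSumInst

variable (x : ThreeSumInst)

/-- The elements of the first set. -/
def aN (i : ℕ) : ℤ := if h : i < x.N then x.a ⟨i, h⟩ else 0

/-- The elements of the second set. -/
def bN (i : ℕ) : ℤ := if h : i < x.N then x.b ⟨i, h⟩ else 0

theorem aN_inj {i j : ℕ} (hi : i < x.N) (hj : j < x.N) (h : x.aN i = x.aN j) : i = j := by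
  rw [aN, aN, dif_pos hi, dif_pos hj] at h
  exact Fin.ext_iff.1 (x.a.injective h)

theorem bN_inj {i j : ℕ} (hi : i < x.N) (hj : j < x.N) (h : x.bN i = x.bN j) : i = j := by
  rw [bN, bN, dif_pos hi, dif_pos hj] at h
  exact Fin.ext_iff.1 (x.b.injective h)

/-- The names of the blocks of length `N` that contain elements of the first set. -/
def tab (q : ℤ) : ℤ := keyTab (fun i => x.aN i / x.N) x.N q

theorem tab_mem (q : ℤ) : 0 ≤ x.tab q ∧ x.tab q ≤ x.N := by
  rcases keyTab_eq_zero_or (fun i => x.aN i / x.N) x.N q with h | ⟨i, hi, h, -⟩ <;>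
    rw [tab, h] <;> omega

/-- A nonzero name is one plus the index of an element of the block, and that element determines the
block. -/
theorem eq_of_tab_eq {q q' : ℤ} (h : x.tab q = x.tab q') (h0 : x.tab q' ≠ 0) : q = q' := by
  rcases keyTab_eq_zero_or (fun i => x.aN i / x.N) x.N q with h1 | ⟨i, hi, h1, h2⟩
  · exact absurd (h.symm.trans h1) h0
  rcases keyTab_eq_zero_or (fun i => x.aN i / x.N) x.N q' with h3 | ⟨j, hj, h3, h4⟩
  · exact absurd h3 h0
  rw [tab, tab, h1, h3] at h
  have : i = j := by omega
  subst this
  exact h2.symm.trans h4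

/-- The random shift of a block. -/
def shift (F : Fin x.N → Fin x.N) (v : ℤ) : ℤ := if 1 ≤ v then extendFin F (v - 1).toNat else 0

theorem extendFin_mem {N : ℕ} (hN : 1 ≤ N) (F : Fin N → Fin N) (j : ℕ) :
    0 ≤ extendFin F j ∧ extendFin F j < N := by
  unfold extendFin
  split_ifs with h
  · have := (F ⟨j, h⟩).isLt; omega
  · omega

theorem shift_mem (F : Fin x.N → Fin x.N) (v : ℤ) : 0 ≤ x.shift F v ∧ x.shift F v < x.N := by
  have hN := x.N_pos
  unfold shift
  split_ifs
  · exact extendFin_mem hN F _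
  · omega

/-- The character of an element of the first set. -/
def chrA (i : ℕ) : ℤ := x.tab (x.aN i / x.N)

/-- The position of an element of the first set. -/
def posA (F : Fin x.N → Fin x.N) (i : ℕ) : ℤ := x.aN i % x.N + x.shift F (x.chrA i)

/-- The character of an element of the second set: the name of the block of those numbers whose
block indices add up to `-d`. -/
def chrB (d : ℕ) (i : ℕ) : ℤ := x.tab (-(x.bN i / x.N) - d)

/-- The position of an element of the second set, with elements that have no partners far away. -/
def posB (F : Fin x.N → Fin x.N) (d : ℕ) (i : ℕ) : ℤ :=
  if x.chrB d i = 0 then x.N + i else x.shift F (x.chrB d i) - x.bN i % x.N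

/-- No position is used by more than `L` elements. -/
def LowLoad (L : ℕ) (F : Fin x.N → Fin x.N) : Prop :=
  (∀ y, load (x.posA F) x.N y ≤ L) ∧ ∀ d < 2, ∀ y, load (x.posB F d) x.N y ≤ L

theorem chrA_pos {i : ℕ} (hi : i < x.N) : 1 ≤ x.chrA i := by
  have h1 := (x.tab_mem (x.aN i / x.N)).1
  have h2 : x.tab (x.aN i / x.N) ≠ 0 := keyTab_ne_zero (fun i => x.aN i / x.N) hi
  unfold chrA
  omega

/-- The index in the table of shifts. -/
def rep (v : ℤ) : Fin x.N :=
  if h : (v - 1).toNat < x.N then ⟨(v - 1).toNat, h⟩ else ⟨0, x.N_pos⟩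

theorem shift_eq (F : Fin x.N → Fin x.N) {v : ℤ} (h1 : 1 ≤ v) (h2 : v ≤ x.N) :
    x.shift F v = (F (x.rep v) : ℕ) := by
  have h : (v - 1).toNat < x.N := by omega
  rw [shift, if_pos h1, extendFin, dif_pos h, rep, dif_pos h]

theorem rep_inj {v v' : ℤ} (h1 : 1 ≤ v) (h2 : v ≤ x.N) (h1' : 1 ≤ v') (h2' : v' ≤ x.N)
    (h : x.rep v = x.rep v') : v = v' := by
  rw [rep, rep, dif_pos (by omega), dif_pos (by omega), Fin.mk.injEq] at h
  omega

theorem emod_mem (z : ℤ) : 0 ≤ z % x.N ∧ z % x.N < x.N := by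
  have hN : (0 : ℤ) < x.N := by exact_mod_cast x.N_pos
  exact ⟨Int.emod_nonneg _ hN.ne', Int.emod_lt_of_pos _ hN⟩

theorem eq_of_div_mod {z z' : ℤ} (h1 : z / x.N = z' / x.N) (h2 : z % x.N = z' % x.N) : z = z' := by
  rw [← Int.mul_ediv_add_emod z x.N, ← Int.mul_ediv_add_emod z' x.N, h1, h2]

-- `card_crowded_mul_factorial_le` is applied three times, to the first set and to the second set
-- for both carries, each time with `3 * N` possible positions. Distinct elements of one block have
-- distinct remainders, which is the injectivity required there.
open scoped Classical in
theorem card_not_lowLoad_mul_factorial_le {L : ℕ} (hL : 1 ≤ L) :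
    (Finset.univ.filter fun F => ¬ x.LowLoad L F).card * L.factorial ≤ 9 * x.N * x.N ^ x.N := by
  have hN := x.N_pos
  -- A shift plus a remainder lies in `[0, 2N)`, a shift minus a remainder in `(-N, N)`.
  set Y : Finset ℤ := Finset.Ico (-x.N) (2 * x.N) with hY
  have hYc : Y.card = 3 * x.N := by rw [hY, Int.card_Ico]; omega
  have hA := card_crowded_mul_factorial_le (N := x.N) (L := L) (Finset.range x.N) (by simp)
    (fun i => x.rep (x.chrA i)) (fun i => x.aN i % x.N) (fun i hi j hj h1 h2 => by
      rw [Finset.mem_range] at hi hj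
      have hci := x.chrA_pos hi
      have hcj := x.chrA_pos hj
      have h3 := x.rep_inj hci (x.tab_mem _).2 hcj (x.tab_mem _).2 h1
      have h4 := x.eq_of_tab_eq h3 (by unfold chrA at hcj; omega)
      exact x.aN_inj hi hj (x.eq_of_div_mod h4 h2)) Y (fun F i hi => by
      have h1 := x.emod_mem (x.aN i)
      have h2 := (F (x.rep (x.chrA i))).isLt
      rw [hY, Finset.mem_Ico]; omega) hL
  have hB (d : ℕ) := card_crowded_mul_factorial_le (N := x.N) (L := L)
    ((Finset.range x.N).filter fun i => x.chrB d i ≠ 0)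
    ((Finset.card_filter_le _ _).trans (by simp))
    (fun i => x.rep (x.chrB d i)) (fun i => -(x.bN i % x.N)) (fun i hi j hj h1 h2 => by
      rw [Finset.mem_filter, Finset.mem_range] at hi hj
      have hci := x.tab_mem (-(x.bN i / x.N) - d)
      have hcj := x.tab_mem (-(x.bN j / x.N) - d)
      have hi2 := hi.2
      have hj2 := hj.2
      unfold chrB at h1 hi2 hj2
      have h3 := x.rep_inj (by omega) hci.2 (by omega) hcj.2 h1
      have h4 := x.eq_of_tab_eq h3 hj2
      exact x.bN_inj hi.1 hj.1 (x.eq_of_div_mod (by omega) (by omega))) Y (fun F i hi => by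
      have h1 := x.emod_mem (x.bN i)
      have h2 := (F (x.rep (x.chrB d i))).isLt
      rw [hY, Finset.mem_Ico]; omega) hL
  rw [hYc] at hA
  simp only [hYc] at hB
  set SA := Finset.univ.filter fun F : Fin x.N → Fin x.N => ∃ y : ℤ, L ≤
    ((Finset.range x.N).filter fun i =>
      ((F (x.rep (x.chrA i)) : ℕ) : ℤ) + x.aN i % x.N = y).card with hSA
  set SB := fun d : ℕ => Finset.univ.filter fun F : Fin x.N → Fin x.N => ∃ y : ℤ, L ≤
    (((Finset.range x.N).filter fun i => x.chrB d i ≠ 0).filter fun i =>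
      ((F (x.rep (x.chrB d i)) : ℕ) : ℤ) + -(x.bN i % x.N) = y).card with hSB
  have hsub : (Finset.univ.filter fun F => ¬ x.LowLoad L F) ⊆ SA ∪ (SB 0 ∪ SB 1) := by
    intro F hF
    rw [Finset.mem_filter] at hF
    by_contra hnot
    simp only [Finset.mem_union, not_or] at hnot
    refine hF.2 ⟨fun y => ?_, fun d hd y => ?_⟩
    · by_contra hlt
      refine hnot.1 ?_
      rw [hSA, Finset.mem_filter]
      refine ⟨Finset.mem_univ _, y, (not_le.1 hlt).le.trans (Finset.card_le_card fun i hi => ?_)⟩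
      rw [Finset.mem_filter] at hi ⊢
      refine ⟨hi.1, ?_⟩
      rw [← hi.2, posA, x.shift_eq F (x.chrA_pos (Finset.mem_range.1 hi.1)) (x.tab_mem _).2,
        add_comm]
    · by_contra hlt
      have key : F ∈ SB d := by
        rw [hSB, Finset.mem_filter]
        refine ⟨Finset.mem_univ _, y, ?_⟩
        have hreal (i : ℕ) (h : x.chrB d i ≠ 0) : x.posB F d i =
            ((F (x.rep (x.chrB d i)) : ℕ) : ℤ) + -(x.bN i % x.N) := by
          have hci : 0 ≤ x.chrB d i ∧ x.chrB d i ≤ x.N := x.tab_mem _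
          rw [posB, if_neg h, x.shift_eq F (by omega) hci.2]
          ring
        -- An element without partners sits alone: its position `N + i₀` is private among such
        -- elements, and all others stay below `N`.
        by_cases hd0 : ∃ i₀ < x.N, x.chrB d i₀ = 0 ∧ x.posB F d i₀ = y
        · exfalso
          obtain ⟨i₀, hi₀, h0, hy⟩ := hd0
          rw [posB, if_pos h0] at hy
          have : load (x.posB F d) x.N y ≤ 1 := by
            refine Finset.card_le_one.2 fun i hi j hj => ?_
            have aux (i : ℕ) (hi : x.posB F d i = y) : i = i₀ := by
              by_cases hc : x.chrB d i = 0
              · rw [posB, if_pos hc] at hi; omega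
              · rw [hreal i hc] at hi
                have h1 := x.emod_mem (x.bN i)
                have h2 := (F (x.rep (x.chrB d i))).isLt
                omega
            rw [aux i (Finset.mem_filter.1 hi).2, aux j (Finset.mem_filter.1 hj).2]
          omega
        · refine (not_le.1 hlt).le.trans (Finset.card_le_card fun i hi => ?_)
          rw [Finset.mem_filter] at hi
          have hc : x.chrB d i ≠ 0 := fun hc =>
            hd0 ⟨i, Finset.mem_range.1 hi.1, hc, hi.2⟩
          rw [Finset.mem_filter, Finset.mem_filter]
          exact ⟨⟨hi.1, hc⟩, by rw [← hi.2, hreal i hc]⟩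
      interval_cases d
      · exact hnot.2.1 key
      · exact hnot.2.2 key
  have h1 := (Finset.card_le_card hsub).trans ((Finset.card_union_le _ _).trans
    (Nat.add_le_add_left (Finset.card_union_le _ _) _))
  have h2 := Nat.mul_le_mul_right L.factorial h1
  have hB0 := hB 0
  have hB1 := hB 1
  calc _ ≤ _ := h2
    _ = SA.card * L.factorial + ((SB 0).card * L.factorial + (SB 1).card * L.factorial) := by ring
    _ ≤ 3 * x.N * x.N ^ x.N + (3 * x.N * x.N ^ x.N + 3 * x.N * x.N ^ x.N) :=
        Nat.add_le_add hA (Nat.add_le_add hB0 hB1)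
    _ = _ := by ring

/-- The character at position `k` of the text of the `t`-th call. -/
def textVal (L : ℕ) (F : Fin x.N → Fin x.N) (t k : ℕ) : ℤ :=
  layer (x.posA F) x.chrA x.N (k - x.N * (t % 2 : ℕ) + x.N * (t / 2 % 2 : ℕ)) (t / 2 / 2 % L)

/-- The character at position `j` of the pattern of the `t`-th call, or `0` for a blank. -/
def patVal (L : ℕ) (F : Fin x.N → Fin x.N) (t j : ℕ) : ℤ :=
  layer (x.posB F (t / 2 % 2)) (x.chrB (t / 2 % 2)) x.N (j - x.N * (t % 2 : ℕ)) (t / 2 / 2 / L)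

/-- The number of matches for shift `c` in the `t`-th call. -/
def callMatches (L : ℕ) (F : Fin x.N → Fin x.N) (c t : ℕ) : ℕ :=
  ∑ j ∈ Finset.range x.N, charMatch (x.textVal L F t (c + j)) (x.patVal L F t j)

/-- Equal nonblank characters name the same block, hence carry the same random shift, which cancels
in the comparison of positions. The result no longer depends on `F`. -/
theorem charMatch_chrA_chrB (F : Fin x.N → Fin x.N) (c d : ℕ) {i i' : ℕ} (hi : i < x.N) :
    (if x.posA F i = c + x.N * d + x.posB F d i' then charMatch (x.chrA i) (x.chrB d i') else 0) =
      if x.aN i / x.N + x.bN i' / x.N = -d ∧ x.aN i % x.N + x.bN i' % x.N = c + x.N * d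
        then 1 else 0 := by
  have hpos := x.chrA_pos hi
  have hiff : x.chrA i = x.chrB d i' ↔ x.aN i / x.N + x.bN i' / x.N = -d := by
    constructor
    · intro h
      have := x.eq_of_tab_eq h (fun h0 => by rw [chrB, h0] at h; omega)
      omega
    · intro h
      rw [chrA, chrB]; congr 1; omega
  by_cases h : x.chrA i = x.chrB d i'
  · have h0 : x.chrB d i' ≠ 0 := by omega
    have h2 : x.posA F i = c + x.N * d + x.posB F d i' ↔
        x.aN i % x.N + x.bN i' % x.N = c + x.N * d := by
      rw [posA, posB, if_neg h0, h]
      constructor <;> intro h <;> linarith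
    simp only [h2, ← hiff, h, charMatch, h0, ne_eq, not_false_eq_true, and_self, if_true, true_and]
  · have h0 : charMatch (x.chrA i) (x.chrB d i') = 0 := if_neg fun h' => h h'.1
    rw [h0, ite_self, if_neg (fun h' => h (hiff.2 h'.1))]

/-- The two remainders add up to less than `2 * N`. So a sum in `[0, N)` forces the quotients to add
up to `0` or `-1`, and exactly one carry `d` detects the solution. -/
theorem sum_charMatch_chrA_chrB (F : Fin x.N → Fin x.N) {c i i' : ℕ} (hc : c < x.N)
    (hi : i < x.N) :
    ∑ d ∈ Finset.range 2, (if x.posA F i = c + x.N * d + x.posB F d i' then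
      charMatch (x.chrA i) (x.chrB d i') else 0) = if x.aN i + x.bN i' = c then 1 else 0 := by
  simp only [x.charMatch_chrA_chrB F c _ hi]
  have ha := Int.mul_ediv_add_emod (x.aN i) x.N
  have hb := Int.mul_ediv_add_emod (x.bN i') x.N
  have hma := x.emod_mem (x.aN i)
  have hmb := x.emod_mem (x.bN i')
  have hab : x.aN i + x.bN i' = x.N * (x.aN i / x.N + x.bN i' / x.N) +
      (x.aN i % x.N + x.bN i' % x.N) := by linarith
  rw [hab]
  generalize x.aN i / x.N + x.bN i' / x.N = Q
  have hR : 0 ≤ x.aN i % x.N + x.bN i' % x.N ∧ x.aN i % x.N + x.bN i' % x.N < 2 * x.N := by omega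
  generalize x.aN i % x.N + x.bN i' % x.N = r at hR
  have hc' : (c : ℤ) < x.N := by exact_mod_cast hc
  have hN : (0 : ℤ) < x.N := by exact_mod_cast x.N_pos
  simp only [Finset.sum_range_succ, Finset.sum_range_zero, zero_add, Nat.cast_zero, Nat.cast_one,
    neg_zero, mul_zero, add_zero, mul_one]
  by_cases h : x.N * Q + r = c
  · have hQ : Q = 0 ∨ Q = -1 := by
      have h1 : Q < 1 := by by_contra h1; nlinarith
      have h2 : -2 < Q := by by_contra h2; nlinarith
      omega
    rw [if_pos h]
    rcases hQ with rfl | rfl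
    · rw [if_pos ⟨rfl, by linarith⟩, if_neg (by rintro ⟨h, -⟩; omega)]
    · rw [if_neg (by rintro ⟨h, -⟩; omega), if_pos ⟨rfl, by linarith⟩]
  · rw [if_neg h, if_neg, if_neg]
    · rintro ⟨rfl, rfl⟩; exact h (by ring)
    · rintro ⟨rfl, rfl⟩; exact h (by ring)

/-- Nonblank pattern positions lie in `[-N, N)`, which the windows `[0, N)` for `e = 0` and `[-N,
0)` for `e = 1` partition. So exactly one pair `(e, j)` contributes. -/
theorem sum_windows (F : Fin x.N → Fin x.N) (c d i i' : ℕ) :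
    ∑ e ∈ Finset.range 2, ∑ j ∈ Finset.range x.N,
      (if x.posA F i = (c + j : ℕ) - x.N * e + x.N * d ∧ x.posB F d i' = j - x.N * e then
        charMatch (x.chrA i) (x.chrB d i') else 0) =
      if x.posA F i = c + x.N * d + x.posB F d i' then charMatch (x.chrA i) (x.chrB d i')
        else 0 := by
  by_cases h0 : x.chrB d i' = 0
  · simp [charMatch, h0]
  have hpos : -(x.N : ℤ) ≤ x.posB F d i' ∧ x.posB F d i' < x.N := by
    have h1 := x.shift_mem F (x.chrB d i')
    have h2 := x.emod_mem (x.bN i')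
    rw [posB, if_neg h0]; omega
  generalize x.posB F d i' = y at *
  generalize charMatch (x.chrA i) (x.chrB d i') = M
  have single (e k : ℕ) (hk : y = k - x.N * e) (hkN : k < x.N) :
      ∑ j ∈ Finset.range x.N,
        (if x.posA F i = (c + j : ℕ) - x.N * e + x.N * d ∧ y = j - x.N * e then M else 0) =
      if x.posA F i = c + x.N * d + y then M else 0 := by
    rw [Finset.sum_eq_single k]
    · have : x.posA F i = (c + k : ℕ) - x.N * e + x.N * d ∧ y = k - x.N * e ↔
          x.posA F i = c + x.N * d + y := by
        rw [hk]; push_cast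
        constructor
        · rintro ⟨h, -⟩; linarith
        · intro h; exact ⟨by linarith, rfl⟩
      simp only [this]
    · intro j _ hj
      rw [if_neg]
      rintro ⟨-, h⟩
      exact hj (by omega)
    · intro h; exact absurd (Finset.mem_range.2 hkN) h
  rw [Finset.sum_range_succ, Finset.sum_range_one]
  by_cases hy : 0 ≤ y
  · rw [single 0 y.toNat (by simp [hy]) (by omega), Finset.sum_eq_zero, add_zero]
    intro j hj
    rw [if_neg]
    rintro ⟨-, h⟩
    rw [Finset.mem_range] at hj
    push_cast at h
    omega
  · rw [single 1 (y + x.N).toNat (by push_cast; omega) (by omega), Finset.sum_eq_zero, zero_add]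
    intro j hj
    rw [if_neg]
    rintro ⟨-, h⟩
    push_cast at h
    omega

/-- In mixed radix the number `t` of a call encodes the window `e`, the carry `d` and the layers
`r`, `r'`. Summation over the layers recovers all pairs of elements, summation over windows and
carries then counts each solution once. -/
theorem sum_callMatches {L : ℕ} (hL : 1 ≤ L) {F : Fin x.N → Fin x.N} (hF : x.LowLoad L F) {c : ℕ}
    (hc : c < x.N) :
    ∑ t ∈ Finset.range (2 * (2 * (L * L))), x.callMatches L F c t = pairCount x.a x.b c := by
  set M : ℕ → ℕ → ℕ → ℕ → ℕ := fun e d r r' => ∑ j ∈ Finset.range x.N,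
    charMatch (layer (x.posA F) x.chrA x.N ((c + j : ℕ) - x.N * e + x.N * d) r)
      (layer (x.posB F d) (x.chrB d) x.N (j - x.N * e) r') with hM
  have h1 : ∑ t ∈ Finset.range (2 * (2 * (L * L))), x.callMatches L F c t =
      ∑ e ∈ Finset.range 2, ∑ d ∈ Finset.range 2, ∑ r ∈ Finset.range L, ∑ r' ∈ Finset.range L,
        M e d r r' := by
    refine (sum_range_mul_mod_div (a := 2) (by norm_num) (2 * (L * L)) fun e t =>
      M e (t % 2) (t / 2 % L) (t / 2 / L)).trans (Finset.sum_congr rfl fun e _ => ?_)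
    refine (sum_range_mul_mod_div (a := 2) (by norm_num) (L * L) fun d t =>
      M e d (t % L) (t / L)).trans (Finset.sum_congr rfl fun d _ => ?_)
    exact sum_range_mul_mod_div hL L fun r r' => M e d r r'
  have h2 (e d : ℕ) (hd : d < 2) : ∑ r ∈ Finset.range L, ∑ r' ∈ Finset.range L, M e d r r' =
      ∑ j ∈ Finset.range x.N, ∑ i ∈ Finset.range x.N, ∑ i' ∈ Finset.range x.N,
        (if x.posA F i = (c + j : ℕ) - x.N * e + x.N * d ∧ x.posB F d i' = j - x.N * e then
          charMatch (x.chrA i) (x.chrB d i') else 0) := by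
    simp only [hM]
    rw [Finset.sum_congr rfl fun r _ => Finset.sum_comm, Finset.sum_comm]
    exact Finset.sum_congr rfl fun j _ =>
      sum_charMatch_layer _ _ _ _ (hF.1 _) (hF.2 d hd _)
  have h3 : ∑ i ∈ Finset.range x.N, ∑ i' ∈ Finset.range x.N,
      (if x.aN i + x.bN i' = c then 1 else 0) = pairCount x.a x.b c := by
    rw [pairCount, Finset.card_filter, ← Finset.univ_product_univ, Finset.sum_product,
      Finset.sum_range]
    refine Finset.sum_congr rfl fun i _ => ?_
    rw [Finset.sum_range]
    refine Finset.sum_congr rfl fun j _ => ?_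
    simp only [aN, bN, i.isLt, j.isLt, dif_pos, Fin.eta]
  rw [h1, ← h3]
  rw [Finset.sum_congr rfl fun e _ => Finset.sum_congr rfl fun d hd =>
    h2 e d (Finset.mem_range.1 hd)]
  calc _ = ∑ e ∈ Finset.range 2, ∑ d ∈ Finset.range 2, ∑ i ∈ Finset.range x.N,
        ∑ i' ∈ Finset.range x.N, ∑ j ∈ Finset.range x.N, _ :=
      Finset.sum_congr rfl fun e _ => Finset.sum_congr rfl fun d _ =>
        Finset.sum_comm.trans (Finset.sum_congr rfl fun i _ => Finset.sum_comm)
    _ = ∑ i ∈ Finset.range x.N, ∑ i' ∈ Finset.range x.N, ∑ d ∈ Finset.range 2,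
        ∑ e ∈ Finset.range 2, ∑ j ∈ Finset.range x.N, _ := by
      rw [Finset.sum_comm]
      rw [Finset.sum_congr rfl fun d _ => Finset.sum_comm, Finset.sum_comm]
      refine Finset.sum_congr rfl fun i _ => ?_
      rw [Finset.sum_congr rfl fun d _ => Finset.sum_comm, Finset.sum_comm]
    _ = _ := by
      refine Finset.sum_congr rfl fun i hi => Finset.sum_congr rfl fun i' _ => ?_
      rw [← x.sum_charMatch_chrA_chrB F hc (Finset.mem_range.1 hi)]
      exact Finset.sum_congr rfl fun d _ => x.sum_windows F c d i i'

end ThreeSumInst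

/-! ### Values of expressions -/

/-- The expression has value `v`, and its leaves are at most `X` in absolute value. -/
def Expr.Val (X : ℤ) (τ : AState) (e : Expr) (v : ℤ) : Prop := e.Bounded X τ ∧ e.eval τ = v

namespace Expr.Val

variable {X : ℤ} {τ : AState} {a b : Expr} {u v : ℤ}

theorem reg {r : Fin numLocals} (h : τ.reg r = v) (hv : |v| ≤ X) : Expr.Val X τ (.reg r) v :=
  ⟨by simpa [Expr.Bounded, h] using hv, h⟩

theorem lit (hv : |v| ≤ X) : Expr.Val X τ (.lit v) v := ⟨hv, rfl⟩

theorem add (ha : a.Val X τ u) (hb : b.Val X τ v) : (a + b).Val X τ (u + v) :=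
  ⟨⟨trivial, ha.1, hb.1⟩, congrArg₂ (· + ·) ha.2 hb.2⟩

theorem sub (ha : a.Val X τ u) (hb : b.Val X τ v) : (a - b).Val X τ (u - v) :=
  ⟨⟨trivial, ha.1, hb.1⟩, congrArg₂ (· - ·) ha.2 hb.2⟩

theorem mul (ha : a.Val X τ u) (hb : b.Val X τ v) : (a * b).Val X τ (u * v) :=
  ⟨⟨trivial, ha.1, hb.1⟩, congrArg₂ (· * ·) ha.2 hb.2⟩

theorem div (ha : a.Val X τ u) (hb : b.Val X τ v) : (a / b).Val X τ (u / v) :=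
  ⟨⟨trivial, ha.1, hb.1⟩, congrArg₂ (· / ·) ha.2 hb.2⟩

theorem mod (ha : a.Val X τ u) (hb : b.Val X τ v) : (a % b).Val X τ (u % v) :=
  ⟨⟨trivial, ha.1, hb.1⟩, congrArg₂ (· % ·) ha.2 hb.2⟩

theorem eq (ha : a.Val X τ u) (hb : b.Val X τ v) :
    (Expr.bin .eq a b).Val X τ (if u = v then 1 else 0) :=
  ⟨⟨trivial, ha.1, hb.1⟩, congrArg₂ (BinOp.eq.eval · ·) ha.2 hb.2⟩

theorem load (ha : a.Val X τ u) (hu : τ.mem u = v) (hv : |v| ≤ X) : (Expr.load a).Val X τ v :=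
  ⟨⟨ha.1, by rwa [ha.2, hu]⟩, by rw [Expr.eval, ha.2, hu]⟩

theorem of_eq (ha : a.Val X τ u) (h : u = v) : a.Val X τ v := h ▸ ha

end Expr.Val

theorem Achieves.assign_of_val {X : ℤ} {w : ℕ} (hX : Wide X w) (c : ℕ) {r : Fin numLocals}
    {e : Expr} {σ : AState} {v : ℤ} (he : e.Val X σ v)
    (hle : e.leaves ≤ 40 := by decide) (hc : e.time + 4 ≤ c := by decide) :
    Achieves w c 0 (assignReg r e) σ (· = σ.set r v) :=
  Achieves.assign_of_bounded hX c he.1 he.2 hle hc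

theorem Achieves.assignMem_of_val {X : ℤ} {w : ℕ} (hX : Wide X w) (c : ℕ) {a e : Expr}
    {σ : AState} {u v : ℤ} (ha : a.Val X σ u) (he : e.Val X σ v)
    (hla : a.leaves ≤ 40 := by decide)
    (hle : e.leaves ≤ 40 := by decide) (hc : a.time + e.time + 3 ≤ c := by decide) :
    Achieves w c 0 (writeMem a e) σ (· = σ.put u v) := by
  refine (Achieves.assignMem (ha.1.fits_of_wide hX hla) (he.1.fits_of_wide hX hle)).mono hc le_rfl ?_
  rintro _ rfl
  rw [ha.2, he.2]

theorem Achieves.fill_of_val {X : ℤ} {w nn : ℕ} (hX : Wide X w) (c : ℕ)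
    {i n : Fin numLocals} {a e : Expr} {σ : AState} (hn : σ.reg n = nn) (hnX : (nn : ℤ) ≤ X)
    (base : ℤ) (v : ℕ → ℤ)
    (h : ∀ j < nn, ∀ τ, τ = (⟨Function.update σ.reg i j, filled σ.mem base j v⟩ : AState) →
      a.Val X τ (base + j) ∧ e.Val X τ (v j))
    (hin : i ≠ n := by decide) (hla : a.leaves ≤ 40 := by decide)
    (hle : e.leaves ≤ 40 := by decide) (hc : a.time + e.time + 3 + loopOverhead ≤ c := by decide) :
    Achieves w (nn * c + loopOverhead) 0 (forDo i n (writeMem a e)) σ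
      (· = ⟨Function.update σ.reg i nn, filled σ.mem base nn v⟩) :=
  Achieves.fill_of_bounded hX c hn hnX base v (fun j hj τ hτ =>
    let ⟨h1, h2⟩ := h j hj τ hτ
    ⟨h1.1, h2.1, h1.2, h2.2⟩) hin hla hle hc

/-! ### Memory regions -/

/-- The memory around the multiples `g * D` is given by `V g`. -/
def Regions (D B : ℤ) (μ : ℤ → ℤ) (V : ℕ → ℤ → ℤ) : Prop :=
  ∀ (g : ℕ) (a : ℤ), |a| < B → μ (g * D + a) = V g a

theorem le_abs_of_ne {D B : ℤ} (hBD : 2 * B ≤ D) {g g' : ℕ} (h : g ≠ g') {a a' : ℤ}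
    (ha : |a| < B) (ha' : |a'| < B) : g * D + a ≠ g' * D + a' := by
  intro he
  rw [abs_lt] at ha ha'
  have hB : 0 < B := by linarith
  rcases lt_or_gt_of_ne h with hlt | hlt
  · have : (g : ℤ) + 1 ≤ g' := by exact_mod_cast hlt
    nlinarith
  · have : (g' : ℤ) + 1 ≤ g := by exact_mod_cast hlt
    nlinarith

theorem le_abs_sub_of_ne {D B : ℤ} (hBD : 2 * B ≤ D) {g g' : ℕ} (h : g ≠ g') {a : ℤ}
    (ha : |a| < B) : B ≤ |g * D + a - g' * D| := by
  by_contra hlt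
  exact le_abs_of_ne hBD h ha (not_le.1 hlt) (by ring)

namespace Regions

variable {D B : ℤ} {μ : ℤ → ℤ} {V : ℕ → ℤ → ℤ}

theorem update (hBD : 2 * B ≤ D) (h : Regions D B μ V) (g : ℕ) {a : ℤ} (ha : |a| < B) (v : ℤ) :
    Regions D B (Function.update μ (g * D + a) v)
      (Function.update V g (Function.update (V g) a v)) := by
  intro g' a' ha'
  by_cases hg : g' = g
  · subst hg
    rw [Function.update_self]
    by_cases haa : a' = a
    · subst haa; simp
    · rw [Function.update_of_ne haa, Function.update_of_ne (by simpa using haa), h _ _ ha']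
  · rw [Function.update_of_ne hg, Function.update_of_ne (le_abs_of_ne hBD hg ha' ha), h _ _ ha']

theorem filled (hBD : 2 * B ≤ D) (h : Regions D B μ V) (g : ℕ) {a : ℤ} (ha : 0 ≤ a) {n : ℕ}
    (hn : a + n ≤ B) (v : ℕ → ℤ) :
    Regions D B (_root_.filled μ (g * D + a) n v)
      (Function.update V g (_root_.filled (V g) a n v)) := by
  induction n with
  | zero => simpa [filled_zero] using h
  | succ n ih =>
    push_cast at hn
    have := (ih (by linarith)).update hBD g (a := a + n)
      (by rw [abs_of_nonneg (by positivity)]; linarith) (v n)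
    rw [Function.update_idem, Function.update_self] at this
    rwa [filled_succ, filled_succ, add_assoc]

end Regions

/-! ### Arrays of layers -/

/-- The layers of an array, with the entries at a position next to each other. -/
def layerArray (pos chr : ℕ → ℤ) (L n : ℕ) (a : ℤ) : ℤ := layer pos chr n (a / L) (a % L).toNat

theorem layerArray_mul_add (pos chr : ℕ → ℤ) {L r : ℕ} (n : ℕ) (y : ℤ) (hr : r < L) :
    layerArray pos chr L n (y * L + r) = layer pos chr n y r := by
  have hL : (L : ℤ) ≠ 0 := by omega
  have h1 : (y * L + r) / L = y := by
    rw [add_comm, Int.add_mul_ediv_right _ _ hL, Int.ediv_eq_zero_of_lt (by positivity)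
      (by exact_mod_cast hr), zero_add]
  have h2 : (y * L + r) % L = r := by
    rw [add_comm, Int.add_mul_emod_self_right, Int.emod_eq_of_lt (by positivity)
      (by exact_mod_cast hr)]
  rw [layerArray, h1, h2, Int.toNat_natCast]

/-- The new element takes the first free slot of its position; the bound on the load keeps this slot
from spilling into the next position. -/
theorem layerArray_succ (pos chr : ℕ → ℤ) {L n : ℕ} (h : load pos n (pos n) < L) :
    layerArray pos chr L (n + 1) = Function.update (layerArray pos chr L n)
      (pos n * L + load pos n (pos n)) (chr n) := by
  funext a
  by_cases ha : a = pos n * L + load pos n (pos n)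
  · subst ha
    rw [Function.update_self, layerArray_mul_add _ _ _ _ h, layer_succ_eq_ite, if_pos ⟨rfl, rfl⟩]
  · rw [Function.update_of_ne ha, layerArray, layer_succ_eq_ite, if_neg]
    · rfl
    · rintro ⟨h1, h2⟩
      have hL : (0 : ℤ) < L := by omega
      have := Int.emod_nonneg a hL.ne'
      have h3 := Int.mul_ediv_add_emod a L
      refine ha ?_
      rw [← h1] at h2 h3
      rw [h2]
      rw [Int.toNat_of_nonneg this]
      linarith

theorem load_array_succ (pos : ℕ → ℤ) (n : ℕ) :
    (fun y => (load pos (n + 1) y : ℤ)) =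
      Function.update (fun y => (load pos n y : ℤ)) (pos n) (load pos n (pos n) + 1) := by
  funext y
  rw [load_succ]
  by_cases hy : y = pos n
  · subst hy; simp
  · rw [Function.update_of_ne hy, if_neg (Ne.symm hy), add_zero]

theorem layer_eq_zero_or (pos chr : ℕ → ℤ) (n : ℕ) (y : ℤ) (r : ℕ) :
    layer pos chr n y r = 0 ∨ ∃ i < n, layer pos chr n y r = chr i := by
  induction n with
  | zero => exact Or.inl rfl
  | succ n ih =>
    rw [layer_succ_eq_ite]
    split_ifs
    · exact Or.inr ⟨n, Nat.lt_succ_self n, rfl⟩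
    · rcases ih with h | ⟨i, hi, h⟩
      · exact Or.inl h
      · exact Or.inr ⟨i, by omega, h⟩

/-! ### From 3SUM to Hamming distances: the instances -/

namespace ThreeSumInst

variable (x : ThreeSumInst)

theorem textVal_mem (L : ℕ) (F : Fin x.N → Fin x.N) (t k : ℕ) :
    0 ≤ x.textVal L F t k ∧ x.textVal L F t k ≤ x.N := by
  rcases layer_eq_zero_or (x.posA F) x.chrA x.N (k - x.N * (t % 2 : ℕ) + x.N * (t / 2 % 2 : ℕ))
    (t / 2 / 2 % L) with h | ⟨i, -, h⟩
  · rw [textVal, h]; omega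
  · rw [textVal, h]; exact x.tab_mem _

theorem patVal_mem (L : ℕ) (F : Fin x.N → Fin x.N) (t j : ℕ) :
    0 ≤ x.patVal L F t j ∧ x.patVal L F t j ≤ x.N := by
  rcases layer_eq_zero_or (x.posB F (t / 2 % 2)) (x.chrB (t / 2 % 2)) x.N
    (j - x.N * (t % 2 : ℕ)) (t / 2 / 2 / L) with h | ⟨i, -, h⟩
  · rw [patVal, h]; omega
  · rw [patVal, h]; exact x.tab_mem _

/-- The instance of the `t`-th call, where blanks in the pattern do not match anything. -/
def call {κ : ℕ} (hκ : 2 ≤ κ) (L : ℕ) (F : Fin x.N → Fin x.N) (t : ℕ) : MatchingInst κ where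
  m := x.N
  n := 2 * x.N
  m_pos := x.N_pos
  m_le_n := by omega
  n_le := Nat.mul_le_mul_right _ hκ
  P j := if x.patVal L F t j = 0 then x.N + 1 else (x.patVal L F t j).toNat
  T k := (x.textVal L F t k).toNat

variable {κ : ℕ} (hκ : 2 ≤ κ) (L : ℕ) (F : Fin x.N → Fin x.N) (t : ℕ)

theorem cast_call_P (j : Fin x.N) : (((x.call hκ L F t).P j : ℕ) : ℤ) =
    x.patVal L F t j + (if x.patVal L F t j = 0 then 1 else 0) * (x.N + 1) := by
  have := x.patVal_mem L F t j
  simp only [call]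
  split_ifs with h
  · rw [h]; push_cast; ring
  · rw [Int.toNat_of_nonneg this.1]; ring

theorem cast_call_T (k : Fin (2 * x.N)) :
    (((x.call hκ L F t).T k : ℕ) : ℤ) = x.textVal L F t k :=
  Int.toNat_of_nonneg (x.textVal_mem L F t k).1

/-- Since names replace the quotients, the characters are at most `N + 1`, however large the
exponent of the 3SUM instance is. -/
theorem polyBounded_call : (hammingDistances κ).PolyBounded 1 (x.call hκ L F t) := by
  have hN := x.N_pos
  intro z hz
  rw [pow_one]
  show |z| ≤ (x.N : ℤ) + 1
  simp only [hammingDistances, List.mem_append, List.mem_ofFn] at hz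
  rcases hz with ⟨j, rfl⟩ | ⟨j, rfl⟩
  · have h := x.cast_call_P hκ L F t j
    have := x.patVal_mem L F t j
    split_ifs at h <;> rw [h, abs_of_nonneg (by omega)] <;> omega
  · have h := x.cast_call_T hκ L F t j
    have := x.textVal_mem L F t j
    rw [h, abs_of_nonneg (by omega)]; omega

/-- A blank is `0` in the text and `N + 1` in the pattern, and neither value occurs on the other
side. So equality of characters is the same as `charMatch`. -/
theorem answer_call {c : ℕ} (hc : c < ((hammingDistances κ).answer (x.call hκ L F t)).length)
    (hcN : c < x.N) :
    ((hammingDistances κ).answer (x.call hκ L F t))[c] = x.N - (x.callMatches L F c t : ℤ) := by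
  simp only [hammingDistances, List.getElem_ofFn]
  rw [eq_sub_iff_add_eq]
  norm_cast
  rw [callMatches, Finset.sum_range, hammingDist, Finset.card_filter]
  refine (Finset.sum_add_distrib (s := (Finset.univ : Finset (Fin x.N)))).symm.trans ?_
  calc _ = ∑ _j : Fin x.N, 1 := by
        refine Finset.sum_congr rfl fun j _ => ?_
        have h1 := x.cast_call_P hκ L F t j
        have h2 := x.cast_call_T hκ L F t ⟨c + j, by have := j.isLt; omega⟩
        have h3 := x.patVal_mem L F t j
        have h4 := x.textVal_mem L F t (c + j)
        simp only at h2
        have h5 {p q : ℕ} (hp : (p : ℤ) = x.patVal L F t j +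
            (if x.patVal L F t j = 0 then 1 else 0) * (x.N + 1))
            (hq : (q : ℤ) = x.textVal L F t (c + j)) : p ≠ q ↔
            ¬ (x.textVal L F t (c + j) = x.patVal L F t j ∧ x.patVal L F t j ≠ 0) := by
          split_ifs at hp <;> omega
        refine (congrArg (· + _) (if_congr (h5 h1 h2) rfl rfl)).trans ?_
        rw [charMatch]
        split_ifs <;> rfl
    _ = x.N := by simp

end ThreeSumInst

/-! ### From 3SUM to Hamming distances: the tables -/

/-- Assign names to the blocks that contain elements of the first set, in region 2. -/
def tableProg : Prog :=
  forDo 2 0 (writeMem (.lit 2 * .reg 5 + .load (.reg 2) / .reg 0) (.reg 2 + .lit 1))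

/-- Build the layers of an array in region `g + 1`, with the loads of the positions in region `g`;
the expression for the position can use the character in register 13. -/
def layersProg (g : ℕ) (chr pos : Expr) : Prog :=
  forDo 2 0
    (.seq (assignReg 13 chr)
    (.seq (assignReg 3 pos)
    (.seq (writeMem (.lit (g + 1 : ℕ) * .reg 5 +
      (.reg 3 * .reg 10 + .load (.lit g * .reg 5 + .reg 3))) (.reg 13))
    (writeMem (.lit g * .reg 5 + .reg 3) (.load (.lit g * .reg 5 + .reg 3) + .lit 1)))))

namespace ThreeSumInst

variable (x : ThreeSumInst)

/-- The memory at the start. -/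
abbrev input (y : ℤ) : ℤ := rangeThreeSum.inputMem x y

theorem input_left {i : ℕ} (hi : i < x.N) : x.input i = x.aN i := by
  rw [aN, dif_pos hi]
  exact (Problem.inputMem_natCast rangeThreeSum x i).trans (getD_ofFn_append_left _ _ ⟨i, hi⟩)

theorem input_right {i : ℕ} (hi : i < x.N) : x.input (x.N + i) = x.bN i := by
  rw [bN, dif_pos hi]
  have := (Problem.inputMem_natCast rangeThreeSum x (x.N + i)).trans
    (getD_ofFn_append_right _ _ ⟨i, hi⟩)
  exact_mod_cast this

/-- All numbers of the computation are small compared to the words. -/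
structure Fits (L : ℕ) (B D X : ℤ) (w : ℕ) : Prop where
  scales : Scales x.N (4 * (L * L) + 4 * L + 10) B D X w
  L_pos : 1 ≤ L
  input_le : ∀ y, |x.input y| + 2 ≤ B

/-! ### Size bounds for the numbers of the computation. -/

namespace Fits

variable {x} {L : ℕ} {B D X : ℤ} {w : ℕ}

theorem sum_le (h : x.Fits L B D X w) : 4 * ((L : ℤ) * L * x.N) + 4 * (L * x.N) + 10 * x.N ≤ B := by
  have := h.scales.T_mul_le
  push_cast at this
  linarith

theorem N_pos (_ : x.Fits L B D X w) : (1 : ℤ) ≤ x.N := by exact_mod_cast x.N_pos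

theorem B_pos (h : x.Fits L B D X w) : 10 ≤ B := by
  have h1 := h.sum_le
  have h2 := h.N_pos
  have : (0 : ℤ) ≤ (L : ℤ) * L * x.N := by positivity
  have : (0 : ℤ) ≤ (L : ℤ) * x.N := by positivity
  linarith

theorem N_le (h : x.Fits L B D X w) : 10 * (x.N : ℤ) ≤ B := by
  have h1 := h.sum_le
  have : (0 : ℤ) ≤ (L : ℤ) * L * x.N := by positivity
  have : (0 : ℤ) ≤ (L : ℤ) * x.N := by positivity
  linarith

theorem mul_D_le (h : x.Fits L B D X w) {g : ℕ} (hg : g ≤ 4 * (L * L) + 12) : g * D ≤ X := by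
  have hD : 0 ≤ D := by linarith [h.scales.B_le, h.B_pos]
  have h1 : (g : ℤ) ≤ ((4 * (L * L) + 4 * L + 10 : ℕ) : ℤ) + 2 := by omega
  exact (mul_le_mul_of_nonneg_right h1 hD).trans h.scales.D_le

theorem abs_le (h : x.Fits L B D X w) {z : ℤ} (hz : |z| ≤ D) : |z| ≤ X := by
  have h1 := h.mul_D_le (g := 1) (by omega)
  have h2 := h.B_pos
  have h3 := h.scales.B_le
  push_cast at h1
  linarith

theorem abs_le_of_lt (h : x.Fits L B D X w) {z : ℤ} (hz : |z| < B) : |z| ≤ X :=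
  h.abs_le (by linarith [h.scales.B_le, h.B_pos])

theorem natCast_le (h : x.Fits L B D X w) {n : ℕ} (hn : (n : ℤ) < B) : |(n : ℤ)| ≤ X :=
  h.abs_le_of_lt (by rwa [abs_of_nonneg (by positivity)])

theorem loop_lt (h : x.Fits L B D X w) {n : ℕ} (hn : (n : ℤ) < B) : (n : ℤ) + 1 < 2 ^ w := by
  have h1 := h.scales.wide.lt
  have h2 := h.natCast_le hn
  rw [abs_of_nonneg (by positivity)] at h2
  have := h.B_pos
  have h3 := h.mul_D_le (g := 1) (by omega)
  have h4 := h.scales.B_le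
  push_cast at h3
  linarith

theorem abs_ediv_lt (h : x.Fits L B D X w) (y : ℤ) : |x.input y / x.N| + 1 < B := by
  have := h.input_le y
  have := Int.abs_ediv_le_abs (x.input y) x.N
  linarith

end Fits

/-- The contents of registers and memory during the computation. -/
structure Layout (L : ℕ) (D B : ℤ) (V : ℕ → ℤ → ℤ) (τ : AState) : Prop where
  r0 : τ.reg 0 = x.N
  r5 : τ.reg 5 = D
  r7 : τ.reg 7 = (2 * (2 * (L * L)) : ℕ)
  r9 : τ.reg 9 = 0
  r10 : τ.reg 10 = L
  r11 : τ.reg 11 = (x.N : ℤ) - 1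
  r12 : τ.reg 12 = (2 * x.N : ℕ)
  mem : Regions D B τ.mem V

/-- The registers for intermediate results. -/
def scratch (r : Fin numLocals) : Bool := r = 2 || r = 3 || r = 6 || r = 8 || r = 13

namespace Layout

variable {x} {L : ℕ} {B D X : ℤ} {w : ℕ} {V V' : ℕ → ℤ → ℤ} {τ τ' : AState}

theorem congr (h : x.Layout L D B V τ) (hr : ∀ r, scratch r = false → τ'.reg r = τ.reg r)
    (hm : Regions D B τ'.mem V') : x.Layout L D B V' τ' :=
  ⟨(hr _ (by decide)).trans h.r0, (hr _ (by decide)).trans h.r5, (hr _ (by decide)).trans h.r7,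
    (hr _ (by decide)).trans h.r9, (hr _ (by decide)).trans h.r10, (hr _ (by decide)).trans h.r11,
    (hr _ (by decide)).trans h.r12, hm⟩

theorem set (h : x.Layout L D B V τ) (r : Fin numLocals) (v : ℤ)
    (hr : scratch r = true := by decide) : x.Layout L D B V (τ.set r v) :=
  h.congr (fun r' hr' => by
    rw [AState.set_reg, if_neg]
    rintro rfl
    simp [hr'] at hr) h.mem

theorem put (hBD : 2 * B ≤ D) (h : x.Layout L D B V τ) (g : ℕ) {a : ℤ} (ha : |a| < B) (v : ℤ) :
    x.Layout L D B (Function.update V g (Function.update (V g) a v)) (τ.put (g * D + a) v) :=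
  h.congr (fun _ _ => rfl) (h.mem.update hBD g ha v)

theorem load_val (h : x.Layout L D B V τ) {e : Expr} {g : ℕ} {a v : ℤ}
    (he : e.Val X τ (g * D + a)) (ha : |a| < B) (hv : V g a = v) (hvX : |v| ≤ X) :
    (Expr.load e).Val X τ v :=
  he.load ((h.mem g a ha).trans hv) hvX

theorem load_val_zero (h : x.Layout L D B V τ) {e : Expr} {a v : ℤ}
    (he : e.Val X τ a) (ha : |a| < B) (hv : V 0 a = v) (hvX : |v| ≤ X) :
    (Expr.load e).Val X τ v :=
  h.load_val (g := 0) (he.of_eq (by simp)) ha hv hvX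

end Layout

variable {x} {L : ℕ} {B D X : ℤ} {w : ℕ} {V : ℕ → ℤ → ℤ} {σ : AState}

/-- The quotients, possibly negative, are below `B` in absolute value and serve directly as
addresses in region 2. Neither sorting nor hashing is needed, because absent keys read zero from the
clean memory. -/
theorem achieves_tableProg (hF : x.Fits L B D X w) (hI : x.Layout L D B V σ) (h0 : V 0 = x.input)
    (h2 : V 2 = 0) :
    Achieves w (x.N * 100 + loopOverhead) 0 tableProg σ
      (x.Layout L D B (Function.update V 2 x.tab)) := by
  have hN := hF.N_pos
  have hNB := hF.N_le
  have := Achieves.forLoop (w := w) (tb := 76) (ε := 0) (nn := x.N) (i := 2) (n := 0)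
    (p := writeMem (.lit 2 * .reg 5 + .load (.reg 2) / .reg 0) (.reg 2 + .lit 1))
    (by decide) (Inv := fun j => x.Layout L D B
      (Function.update V 2 (keyTab (fun i => x.aN i / x.N) j)))
    (hF.loop_lt (by linarith)) (fun j hj τ h2 hn hτ => ?_) hI.r0
    ((hI.set 2 0).congr (fun _ _ => rfl) (by
      have : (keyTab (fun i => x.aN i / x.N) 0) = V 2 := h2.symm
      rw [this, Function.update_eq_self]; exact hI.mem))
  · rwa [mul_zero] at this
  have hj' : (j : ℤ) < x.N := by exact_mod_cast hj
  have bj : |(j : ℤ)| < B := by rw [abs_of_nonneg (by positivity)]; linarith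
  have hin : x.input j = x.aN j := x.input_left hj
  have hkey := hF.abs_ediv_lt j
  have hval := hF.input_le j
  rw [hin] at hkey hval
  have v5 : (Expr.reg 5).Val X τ D := .reg hτ.r5 (hF.abs_le (abs_of_nonneg
    (by linarith [hF.B_pos, hF.scales.B_le])).le)
  have v0 : (Expr.reg 0).Val X τ x.N := .reg hτ.r0 (hF.natCast_le (by linarith))
  have v2 : (Expr.reg 2).Val X τ j := .reg h2 (hF.abs_le_of_lt bj)
  have lit {z : ℕ} (hz : z ≤ 9) : (Expr.lit z).Val X τ z :=
    .lit (hF.natCast_le (by have := hF.B_pos; omega))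
  have va : (Expr.load (.reg 2)).Val X τ (x.aN j) :=
    hτ.load_val_zero v2 bj (by rw [Function.update_of_ne (by decide), h0, hin])
      (hF.abs_le_of_lt (by linarith))
  refine (Achieves.assignMem_of_val hF.scales.wide 76
    (((lit (z := 2) (by norm_num)).mul v5).add (va.div v0))
    (v2.add (lit (z := 1) (by norm_num)))).mono le_rfl le_rfl ?_
  rintro _ rfl
  refine ⟨h2, hn, ?_⟩
  have := (hτ.put hF.scales.B_le 2 (a := x.aN j / x.N) (by linarith) (j + 1)).set 2 (j + 1 : ℕ)
  rwa [Function.update_idem, Function.update_self] at this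

-- The current load of a position is the rank of the element, hence its slot; the slot is filled
-- before the load is increased. The hypotheses on `ce` and `pe` range over all memories that agree
-- with `V` outside the two regions, since these change during the loop.
set_option maxHeartbeats 2000000 in
theorem achieves_layersProg (hF : x.Fits L B D X w) (hI : x.Layout L D B V σ) {g : ℕ}
    (hg : g ≤ 8) (h0 : V g = 0) (h1 : V (g + 1) = 0) {chr pos : ℕ → ℤ}
    (hload : ∀ y, load pos x.N y ≤ L) (hpos : ∀ i < x.N, |pos i| ≤ 2 * x.N)
    (hchr : ∀ i < x.N, |chr i| ≤ x.N) {ce pe : Expr}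
    (hce : ∀ i < x.N, ∀ τ V', x.Layout L D B V' τ →
      (∀ g', g' ≠ g → g' ≠ g + 1 → V' g' = V g') → τ.reg 2 = i → ce.Val X τ (chr i))
    (hpe : ∀ i < x.N, ∀ τ V', x.Layout L D B V' τ →
      (∀ g', g' ≠ g → g' ≠ g + 1 → V' g' = V g') → τ.reg 2 = i → τ.reg 13 = chr i →
      pe.Val X τ (pos i))
    (hcl : ce.leaves ≤ 40 := by decide) (hpl : pe.leaves ≤ 40 := by decide)
    (hct : ce.time ≤ 100 := by decide) (hpt : pe.time ≤ 100 := by decide) :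
    Achieves w (x.N * 400 + loopOverhead) 0 (layersProg g ce pe) σ
      (x.Layout L D B (Function.update (Function.update V g fun y => (load pos x.N y : ℤ)) (g + 1)
        (layerArray pos chr L x.N))) := by
  have hN := hF.N_pos
  have hNB := hF.N_le
  have hB := hF.B_pos
  have hBD := hF.scales.B_le
  set Vj : ℕ → ℕ → ℤ → ℤ := fun j => Function.update (Function.update V g fun y =>
    (load pos j y : ℤ)) (g + 1) (layerArray pos chr L j) with hVj
  have hgg : g ≠ g + 1 := by omega
  have hVg (j : ℕ) : Vj j g = fun y => (load pos j y : ℤ) := by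
    rw [hVj]; simp only; rw [Function.update_of_ne hgg, Function.update_self]
  have hVg1 (j : ℕ) : Vj j (g + 1) = layerArray pos chr L j := by
    rw [hVj]; simp only; rw [Function.update_self]
  have hVo (j g' : ℕ) (h : g' ≠ g) (h' : g' ≠ g + 1) : Vj j g' = V g' := by
    rw [hVj]; simp only; rw [Function.update_of_ne h', Function.update_of_ne h]
  have hV0 : Vj 0 = V := by
    funext g'
    by_cases e : g' = g
    · subst e; rw [hVg, h0]; funext y; simp [load]
    by_cases e1 : g' = g + 1
    · subst e1; rw [hVg1, h1]; funext y; simp [layerArray, layer]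
    exact hVo 0 g' e e1
  have := Achieves.forLoop (w := w) (tb := 376) (ε := 0) (nn := x.N) (i := 2) (n := 0)
    (p := .seq (assignReg 13 ce)
    (.seq (assignReg 3 pe)
    (.seq (writeMem (.lit (g + 1 : ℕ) * .reg 5 +
      (.reg 3 * .reg 10 + .load (.lit g * .reg 5 + .reg 3))) (.reg 13))
    (writeMem (.lit g * .reg 5 + .reg 3) (.load (.lit g * .reg 5 + .reg 3) + .lit 1)))))
    (by decide) (Inv := fun j => x.Layout L D B (Vj j))
    (hF.loop_lt (by linarith)) (fun j hj τ h2 hn hτ => ?_) hI.r0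
    (by rw [hV0]; exact hI.set 2 0)
  · rwa [mul_zero] at this
  have hLN : (L : ℤ) ≤ L * x.N := le_mul_of_one_le_right (by positivity) hN
  have hL1 : (1 : ℤ) ≤ L := by exact_mod_cast hF.L_pos
  have hLLN : (0 : ℤ) ≤ (L : ℤ) * L * x.N := by positivity
  have hLB : (L : ℤ) ≤ B := by linarith [hF.sum_le]
  have hlt : load pos j (pos j) < L := (load_lt pos hj rfl).trans_le (hload _)
  have hltZ : (load pos j (pos j) : ℤ) < L := by exact_mod_cast hlt
  have bpos : |pos j| < B := by have := hpos j hj; linarith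
  have bld : |(load pos j (pos j) : ℤ)| ≤ X := hF.natCast_le (by linarith)
  have blay : |pos j * L + (load pos j (pos j) : ℤ)| < B := by
    have h3 : |pos j * (L : ℤ)| ≤ 2 * (L * x.N) := by
      rw [abs_mul, abs_of_nonneg (by positivity : (0 : ℤ) ≤ L)]
      have := mul_le_mul_of_nonneg_right (hpos j hj) (by positivity : (0 : ℤ) ≤ L)
      linarith
    have h4 : |(load pos j (pos j) : ℤ)| ≤ L := by rw [abs_of_nonneg (by positivity)]; exact hltZ.le
    have := abs_add_le (pos j * L) (load pos j (pos j) : ℤ)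
    linarith [hF.sum_le]
  have b2 : |(j : ℤ)| ≤ X := hF.natCast_le (by have : (j : ℤ) < x.N := by exact_mod_cast hj
                                               linarith)
  have bD : |D| ≤ X := hF.abs_le (abs_of_nonneg (by linarith)).le
  have bL : |(L : ℤ)| ≤ X := hF.natCast_le (by linarith [hF.sum_le])
  have bg {z : ℕ} (hz : z ≤ 9) : |(z : ℤ)| ≤ X := hF.natCast_le (by omega)
  set σ₁ := τ.set 13 (chr j)
  set σ₂ := σ₁.set 3 (pos j)
  have hσ₁ : x.Layout L D B (Vj j) σ₁ := hτ.set 13 _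
  have hσ₂ : x.Layout L D B (Vj j) σ₂ := hσ₁.set 3 _
  have hσ₃ := hσ₂.put hBD (g + 1) blay (chr j)
  set σ₃ := σ₂.put ((g + 1 : ℕ) * D + (pos j * L + (load pos j (pos j) : ℤ))) (chr j)
  have hσ₄ := hσ₃.put hBD g bpos (load pos j (pos j) + 1)
  have hfin : Function.update (Function.update (Vj j) (g + 1) (Function.update (Vj j (g + 1))
      (pos j * L + (load pos j (pos j) : ℤ)) (chr j))) g (Function.update (Function.update (Vj j)
      (g + 1) (Function.update (Vj j (g + 1)) (pos j * L + (load pos j (pos j) : ℤ)) (chr j)) g)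
      (pos j) (load pos j (pos j) + 1)) = Vj (j + 1) := by
    rw [hVg1, ← layerArray_succ pos chr hlt, Function.update_of_ne hgg, hVg, ← load_array_succ]
    funext g'
    by_cases e : g' = g
    · subst e; rw [Function.update_self, hVg]
    rw [Function.update_of_ne e]
    by_cases e1 : g' = g + 1
    · subst e1; rw [Function.update_self, hVg1]
    rw [Function.update_of_ne e1, hVo _ _ e e1, hVo _ _ e e1]
  rw [hfin] at hσ₄
  have q13 : σ₃.reg 13 = chr j := by
    show (Function.update (Function.update τ.reg 13 (chr j)) 3 (pos j)) 13 = chr j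
    simp
  have q3 : σ₃.reg 3 = pos j := by
    show (Function.update (Function.update τ.reg 13 (chr j)) 3 (pos j)) 3 = pos j
    simp
  have q2 : σ₃.reg 2 = j := by
    show (Function.update (Function.update τ.reg 13 (chr j)) 3 (pos j)) 2 = j
    simpa using h2
  refine Achieves.mono (t₁ := 104 + (104 + (100 + 60 + 1) + 1) + 1) ?_ (by norm_num) le_rfl
    fun _ h => h
  refine Achieves.seq_eq (t₂ := 104 + (100 + 60 + 1) + 1) (τ := σ₁) (Achieves.assign_of_val hF.scales.wide 104
    (hce j hj τ _ hτ (hVo j) h2) hcl (by omega)) ?_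
  refine Achieves.seq_eq (t₂ := 100 + 60 + 1) (τ := σ₂) (Achieves.assign_of_val hF.scales.wide 104
    (hpe j hj σ₁ _ hσ₁ (hVo j) (by simpa [σ₁, AState.set_reg] using h2)
      (by simp [σ₁, AState.set_reg])) hpl (by omega)) ?_
  have vals {ρ : AState} {W : ℕ → ℤ → ℤ} (hρ : x.Layout L D B W ρ) (hr : ρ.reg = σ₃.reg)
      (hW : W g = fun y => (load pos j y : ℤ)) :
      (Expr.reg 5).Val X ρ D ∧ (Expr.reg 10).Val X ρ L ∧ (Expr.reg 3).Val X ρ (pos j) ∧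
      (Expr.reg 13).Val X ρ (chr j) ∧
      (Expr.load (.lit g * .reg 5 + .reg 3)).Val X ρ (load pos j (pos j) : ℤ) := by
    have v3 : (Expr.reg 3).Val X ρ (pos j) :=
      .reg (by rw [hr, q3]) (hF.abs_le_of_lt bpos)
    have v5 : (Expr.reg 5).Val X ρ D := .reg hρ.r5 bD
    refine ⟨v5, .reg hρ.r10 bL, v3, .reg (by rw [hr, q13]) (hF.abs_le_of_lt ?_), ?_⟩
    · have := hchr j hj; linarith
    · exact hρ.load_val (((Expr.Val.lit (bg (z := g) (by omega))).mul v5).add v3) bpos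
        (by rw [hW]) bld
  refine Achieves.seq_eq (t₁ := 100) (t₂ := 60) (τ := σ₃) ?_ ?_
  · obtain ⟨v5, v10, v3, v13, vl⟩ := vals hσ₂ rfl (hVg j)
    exact Achieves.assignMem_of_val hF.scales.wide 100
      (((Expr.Val.lit (bg (z := g + 1) (by omega))).mul v5).add ((v3.mul v10).add vl)) v13
      (by simp [Expr.leaves]) (by simp [Expr.leaves]) (by simp [Expr.time])
  · obtain ⟨v5, v10, v3, v13, vl⟩ := vals hσ₃ rfl (by rw [Function.update_of_ne hgg, hVg])
    refine (Achieves.assignMem_of_val hF.scales.wide 60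
      (((Expr.Val.lit (bg (z := g) (by omega))).mul v5).add v3)
      (vl.add (.lit (bg (z := 1) (by omega))))
      (by simp [Expr.leaves]) (by simp [Expr.leaves]) (by simp [Expr.time])).mono le_rfl le_rfl ?_
    rintro _ rfl
    exact ⟨q2, hσ₄.r0, hσ₄.set 2 _⟩

end ThreeSumInst

/-! ### From 3SUM to Hamming distances: the layers -/

/-- The character of an element of the first set. -/
def chrAExpr : Expr := .load (.lit 2 * .reg 5 + .load (.reg 2) / .reg 0)

/-- The position of an element of the first set with the character in register 13. -/
def posAExpr : Expr := .load (.reg 2) % .reg 0 + .load (.lit 1 * .reg 5 + (.reg 13 - .lit 1))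

/-- The character of an element of the second set. -/
def chrBExpr (d : ℕ) : Expr :=
  .load (.lit 2 * .reg 5 + (.lit 0 - .load (.reg 0 + .reg 2) / .reg 0 - .lit d))

/-- The position of an element of the second set with the character in register 13. -/
def posBExpr : Expr :=
  .load (.lit 1 * .reg 5 + (.reg 13 - .lit 1)) - .load (.reg 0 + .reg 2) % .reg 0 +
    .bin .eq (.reg 13) (.lit 0) * (.reg 0 + .reg 2 + .load (.reg 0 + .reg 2) % .reg 0)

/-- Prepare the layers of all arrays. -/
def tablesProg : Prog :=
  .seq tableProg
  (.seq (layersProg 3 chrAExpr posAExpr)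
  (.seq (layersProg 5 (chrBExpr 0) posBExpr)
  (layersProg 7 (chrBExpr 1) posBExpr)))

namespace ThreeSumInst

variable {x : ThreeSumInst} {L : ℕ} {B D X : ℤ} {w : ℕ} {V : ℕ → ℤ → ℤ} {σ τ : AState}
  {F : Fin x.N → Fin x.N}

/-- The memory region with the random shifts. -/
def shifts (F : Fin x.N → Fin x.N) : ℤ → ℤ := filled 0 0 x.N (extendFin F)

/-- For the blank `v = 0` the address is `-1`, just below the table, where the memory is zero. -/
theorem shifts_sub_one {v : ℤ} (h1 : v ≤ x.N) :
    shifts F (v - 1) = x.shift F v := by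
  unfold shifts filled shift
  split_ifs <;> first | rfl | omega | simp

theorem abs_posA_le (i : ℕ) : |x.posA F i| ≤ 2 * x.N := by
  have h1 := x.shift_mem F (x.chrA i)
  have h2 := x.emod_mem (x.aN i)
  rw [posA, abs_of_nonneg (by omega)]; omega

theorem abs_posB_le (d : ℕ) {i : ℕ} (hi : i < x.N) : |x.posB F d i| ≤ 2 * x.N := by
  have h1 := x.shift_mem F (x.chrB d i)
  have h2 := x.emod_mem (x.bN i)
  rw [posB, abs_le]; split_ifs <;> omega

theorem abs_tab_le (q : ℤ) : |x.tab q| ≤ x.N := by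
  have := x.tab_mem q
  rw [abs_of_nonneg this.1]; exact this.2

/-! ### Values of the expressions for characters and positions. -/

section values

theorem Layout.val_zero (hF : x.Fits L B D X w) (hI : x.Layout L D B V τ) :
    (Expr.reg 0).Val X τ x.N :=
  .reg hI.r0 (hF.natCast_le (by linarith [hF.N_le, hF.N_pos]))

theorem Fits.abs_D_le (hF : x.Fits L B D X w) : |D| ≤ X :=
  hF.abs_le (abs_of_nonneg (by linarith [hF.B_pos, hF.scales.B_le])).le

theorem Layout.val_five (hF : x.Fits L B D X w) (hI : x.Layout L D B V τ) :
    (Expr.reg 5).Val X τ D := .reg hI.r5 hF.abs_D_le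

theorem Fits.val_lit (hF : x.Fits L B D X w) (z : ℕ) (hz : z ≤ 9 := by norm_num) :
    (Expr.lit z).Val X τ z :=
  .lit (hF.natCast_le (by have := hF.B_pos; omega))

theorem Fits.abs_lt_of_lt (hF : x.Fits L B D X w) {i : ℕ} (hi : i < x.N) : |(i : ℤ)| < B := by
  have := hF.N_le
  have := hF.N_pos
  rw [abs_of_nonneg (by positivity)]; omega

theorem Layout.val_left (hF : x.Fits L B D X w) (hI : x.Layout L D B V τ) (h0 : V 0 = x.input)
    {i : ℕ} (hi : i < x.N) (h2 : τ.reg 2 = i) : (Expr.load (.reg 2)).Val X τ (x.aN i) := by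
  have hv := hF.input_le i
  rw [x.input_left hi] at hv
  exact hI.load_val_zero (.reg h2 (hF.abs_le_of_lt (hF.abs_lt_of_lt hi))) (hF.abs_lt_of_lt hi)
    (by rw [h0, x.input_left hi]) (hF.abs_le_of_lt (by linarith))

theorem Layout.val_right (hF : x.Fits L B D X w) (hI : x.Layout L D B V τ) (h0 : V 0 = x.input)
    {i : ℕ} (hi : i < x.N) (h2 : τ.reg 2 = i) :
    (Expr.load (.reg 0 + .reg 2)).Val X τ (x.bN i) := by
  have hv := hF.input_le (x.N + i)
  have hN := hF.N_le
  have hN := hF.N_pos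
  rw [x.input_right hi] at hv
  exact hI.load_val_zero ((hI.val_zero hF).add (.reg h2 (hF.abs_le_of_lt (hF.abs_lt_of_lt hi))))
    (by rw [abs_of_nonneg (by positivity)]; omega)
    (by rw [h0, x.input_right hi]) (hF.abs_le_of_lt (by linarith))

theorem Layout.val_chrA (hF : x.Fits L B D X w) (hI : x.Layout L D B V τ) (h0 : V 0 = x.input)
    (ht : V 2 = x.tab) {i : ℕ} (hi : i < x.N) (h2 : τ.reg 2 = i) :
    chrAExpr.Val X τ (x.chrA i) := by
  have hk := hF.abs_ediv_lt i
  rw [x.input_left hi] at hk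
  exact hI.load_val (g := 2) (((hF.val_lit 2).mul (hI.val_five hF)).add
    ((hI.val_left hF h0 hi h2).div (hI.val_zero hF))) (by linarith) (by rw [ht]; rfl)
    (hF.abs_le_of_lt (by
      have : |x.chrA i| ≤ x.N := x.abs_tab_le _
      linarith [hF.N_le, hF.N_pos]))

theorem Layout.val_chrB (hF : x.Fits L B D X w) (hI : x.Layout L D B V τ) (h0 : V 0 = x.input)
    (ht : V 2 = x.tab) {i d : ℕ} (hd : d < 2) (hi : i < x.N) (h2 : τ.reg 2 = i) :
    (chrBExpr d).Val X τ (x.chrB d i) := by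
  have hk := hF.abs_ediv_lt (x.N + i)
  rw [x.input_right hi] at hk
  have hd' : |(d : ℤ)| ≤ 1 := by rw [abs_of_nonneg (by positivity)]; omega
  have hsum := abs_sub (-(x.bN i / x.N)) d
  rw [abs_neg] at hsum
  exact hI.load_val (g := 2) (a := -(x.bN i / x.N) - d)
    ((((hF.val_lit 2).mul (hI.val_five hF)).add
    (((hF.val_lit 0).sub ((hI.val_right hF h0 hi h2).div (hI.val_zero hF))).sub
      (hF.val_lit d (by omega)))).of_eq (by push_cast; ring)) (by linarith) (by rw [ht]; rfl)
    (hF.abs_le_of_lt (by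
      have : |x.chrB d i| ≤ x.N := x.abs_tab_le _
      linarith [hF.N_le, hF.N_pos]))

theorem Layout.val_shift (hF : x.Fits L B D X w) (hI : x.Layout L D B V τ) (hs : V 1 = shifts F)
    {v : ℤ} (hv : 0 ≤ v ∧ v ≤ x.N) (h13 : τ.reg 13 = v) :
    (Expr.load (.lit 1 * .reg 5 + (.reg 13 - .lit 1))).Val X τ (x.shift F v) := by
  have hN := hF.N_le
  have hN' := hF.N_pos
  have := x.shift_mem F v
  exact hI.load_val (g := 1) (a := v - 1) (((hF.val_lit 1).mul (hI.val_five hF)).add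
    ((Expr.Val.reg h13 (hF.abs_le_of_lt (by rw [abs_of_nonneg hv.1]; omega))).sub (hF.val_lit 1)))
    (by rw [abs_lt]; omega) (by rw [hs, shifts_sub_one hv.2])
    (hF.abs_le_of_lt (by rw [abs_of_nonneg this.1]; omega))

theorem Layout.val_posA (hF : x.Fits L B D X w) (hI : x.Layout L D B V τ) (h0 : V 0 = x.input)
    (hs : V 1 = shifts F) {i : ℕ} (hi : i < x.N) (h2 : τ.reg 2 = i)
    (h13 : τ.reg 13 = x.chrA i) : posAExpr.Val X τ (x.posA F i) :=
  ((hI.val_left hF h0 hi h2).mod (hI.val_zero hF)).add (hI.val_shift hF hs (x.tab_mem _) h13)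

/-- A comparison bit replaces the branch: for a blank the shift reads zero, the remainder cancels
and `N + i` remains. -/
theorem Layout.val_posB (hF : x.Fits L B D X w) (hI : x.Layout L D B V τ) (h0 : V 0 = x.input)
    (hs : V 1 = shifts F) {i d : ℕ} (hi : i < x.N) (h2 : τ.reg 2 = i)
    (h13 : τ.reg 13 = x.chrB d i) : posBExpr.Val X τ (x.posB F d i) := by
  have hmem : 0 ≤ x.chrB d i ∧ x.chrB d i ≤ x.N := x.tab_mem _
  have v13 : (Expr.reg 13).Val X τ (x.chrB d i) := .reg h13 (hF.abs_le_of_lt (by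
    rw [abs_of_nonneg hmem.1]; linarith [hF.N_le, hF.N_pos]))
  have vm := (hI.val_right hF h0 hi h2).mod (hI.val_zero hF)
  refine (((hI.val_shift hF hs hmem h13).sub vm).add ((v13.eq (hF.val_lit 0)).mul
    (((hI.val_zero hF).add (.reg h2 (hF.abs_le_of_lt (hF.abs_lt_of_lt hi)))).add vm))).of_eq ?_
  rw [posB]
  by_cases h : x.chrB d i = 0
  · rw [h]; simp [shift]
  · simp [h]

end values

/-- The memory contains all layers; the output for the first calls is given by `s`, and the
regions of the remaining calls are empty. -/
structure Layered (x : ThreeSumInst) (L : ℕ) (F : Fin x.N → Fin x.N) (t : ℕ) (W : ℕ → ℤ → ℤ) :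
    Prop where
  zero : W 0 = filled x.input (2 * x.N : ℕ) x.N fun c =>
    ∑ t' ∈ Finset.range t, (x.callMatches L F c t' : ℤ)
  left : W 4 = layerArray (x.posA F) x.chrA L x.N
  right : ∀ d < 2, W (6 + 2 * d) = layerArray (x.posB F d) (x.chrB d) L x.N
  high : ∀ g, 9 + t ≤ g → W g = 0

/-- The output cells already hold the empty sum that is needed before the first call. -/
theorem filled_input_zero : filled x.input (2 * x.N : ℕ) x.N (fun _ => 0) = x.input := by
  funext y
  unfold filled
  split_ifs with h
  · refine (Problem.inputMem_of_le rangeThreeSum x ?_).symm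
    have : (rangeThreeSum.data x).length = x.N + x.N := by simp [rangeThreeSum]
    rw [this]; omega
  · rfl

theorem achieves_tablesProg (hF : x.Fits L B D X w) (hL : x.LowLoad L F)
    (hI : x.Layout L D B V σ) (h0 : V 0 = x.input) (h1 : V 1 = shifts F)
    (h2 : ∀ g, 2 ≤ g → V g = 0) :
    Achieves w (x.N * 1300 + 4 * loopOverhead + 3) 0 tablesProg σ
      fun τ => ∃ W, x.Layered L F 0 W ∧ x.Layout L D B W τ := by
  refine Achieves.mono (t₁ := (x.N * 100 + loopOverhead) + ((x.N * 400 + loopOverhead) +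
    ((x.N * 400 + loopOverhead) + (x.N * 400 + loopOverhead) + 1) + 1) + 1) ?_ (by omega)
    le_rfl fun _ h => h
  have hchr (q : ℤ) : |x.tab q| ≤ x.N := x.abs_tab_le q
  refine Achieves.seq_det (achieves_tableProg hF hI h0 (h2 2 le_rfl)) fun τ₁ hτ₁ => ?_
  set V₁ := Function.update V 2 x.tab with hV₁
  have e0 : V₁ 0 = x.input := by simpa [hV₁] using h0
  have e1 : V₁ 1 = shifts F := by simpa [hV₁] using h1
  have e2 : V₁ 2 = x.tab := by simp [hV₁]
  have e (g : ℕ) (hg : 3 ≤ g) : V₁ g = 0 := by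
    rw [hV₁, Function.update_of_ne (by omega), h2 g (by omega)]
  clear_value V₁
  refine Achieves.seq_det (achieves_layersProg hF hτ₁ (g := 3) (chr := x.chrA) (by norm_num) (e _ (by norm_num))
    (e _ (by norm_num)) hL.1 (fun i _ => abs_posA_le i) (fun i _ => hchr _)
    (fun i hi τ V' hτ hV' hr => hτ.val_chrA hF (by rw [hV' 0, e0] <;> norm_num)
      (by rw [hV' 2, e2] <;> norm_num) hi hr)
    (fun i hi τ V' hτ hV' hr hr' => hτ.val_posA hF (by rw [hV' 0, e0] <;> norm_num)
      (by rw [hV' 1, e1] <;> norm_num) hi hr hr')) fun τ₂ hτ₂ => ?_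
  set V₂ := Function.update (Function.update V₁ 3 fun y => (load (x.posA F) x.N y : ℤ)) (3 + 1)
    (layerArray (x.posA F) x.chrA L x.N) with hV₂
  have f4 : V₂ 4 = layerArray (x.posA F) x.chrA L x.N := by simp [hV₂]
  have f (g : ℕ) (hg : g ≠ 3) (hg' : g ≠ 4) : V₂ g = V₁ g := by simp [hV₂, hg, hg']
  clear_value V₂
  -- The arrays for the two carries are built alike, with the loads in region `5 + 2 * d` and the
  -- layers in region `6 + 2 * d`.
  have layersB (d : ℕ) (hd : d < 2) (τ : AState) (W : ℕ → ℤ → ℤ) (hτ : x.Layout L D B W τ)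
      (hW : ∀ g < 3, W g = V₁ g) (hW' : W (5 + 2 * d) = 0) (hW'' : W (6 + 2 * d) = 0) :
      Achieves w (x.N * 400 + loopOverhead) 0 (layersProg (5 + 2 * d) (chrBExpr d) posBExpr) τ
        fun τ => ∃ W', x.Layout L D B W' τ ∧
          W' (6 + 2 * d) = layerArray (x.posB F d) (x.chrB d) L x.N ∧
          ∀ g, g ≠ 5 + 2 * d → g ≠ 6 + 2 * d → W' g = W g := by
    refine (achieves_layersProg hF hτ (g := 5 + 2 * d) (chr := x.chrB d) (by omega) hW'
      (by rw [← hW'']; congr 1; omega) (hL.2 d hd) (fun i hi => abs_posB_le d hi)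
      (fun i _ => hchr _)
      (fun i hi τ V' hτ hV' hr => hτ.val_chrB hF
        (by rw [hV' 0 (by omega) (by omega), hW 0 (by omega), e0])
        (by rw [hV' 2 (by omega) (by omega), hW 2 (by omega), e2]) hd hi hr)
      (fun i hi τ V' hτ hV' hr hr' => hτ.val_posB hF
        (by rw [hV' 0 (by omega) (by omega), hW 0 (by omega), e0])
        (by rw [hV' 1 (by omega) (by omega), hW 1 (by omega), e1]) hi hr hr')
      (by simp [chrBExpr, Expr.leaves, Expr.sub_eq, Expr.div_eq]) (by decide) (by simp [chrBExpr, Expr.time, Expr.sub_eq, Expr.div_eq])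
      (by decide)).mono le_rfl le_rfl fun τ' hτ' => ⟨_, hτ', ?_, fun g hg hg' => ?_⟩
    · rw [show 5 + 2 * d + 1 = 6 + 2 * d by omega, Function.update_self]
    · rw [Function.update_of_ne (by omega), Function.update_of_ne hg]
  refine Achieves.seq_det (layersB 0 (by norm_num) τ₂ V₂ hτ₂
    (fun g hg => f g (by omega) (by omega)) ?_ ?_) ?_
  · rw [f _ (by norm_num) (by norm_num), e _ (by norm_num)]
  · rw [f _ (by norm_num) (by norm_num), e _ (by norm_num)]
  rintro τ₃ ⟨V₃, hτ₃, g6, g⟩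
  refine (layersB 1 (by norm_num) τ₃ V₃ hτ₃ (fun g' hg => ?_) ?_ ?_).mono le_rfl le_rfl ?_
  · rw [g _ (by omega) (by omega), f _ (by omega) (by omega)]
  · rw [g _ (by omega) (by omega), f _ (by omega) (by omega), e _ (by norm_num)]
  · rw [g _ (by omega) (by omega), f _ (by omega) (by omega), e _ (by norm_num)]
  rintro τ₄ ⟨V₄, hτ₄, h8, h⟩
  refine ⟨V₄, ⟨?_, ?_, ?_, ?_⟩, hτ₄⟩
  · rw [h _ (by omega) (by omega), g _ (by omega) (by omega), f _ (by omega) (by omega), e0]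
    simp only [Finset.sum_range_zero]
    exact filled_input_zero.symm
  · rw [h _ (by omega) (by omega), g _ (by omega) (by omega), f4]
  · intro d hd
    interval_cases d
    · rw [h _ (by omega) (by omega), g6]
    · exact h8
  · intro g' hg'
    rw [h _ (by omega) (by omega), g _ (by omega) (by omega), f _ (by omega) (by omega),
      e _ (by omega)]

end ThreeSumInst

/-! ### From 3SUM to Hamming distances: the calls -/

/-- The entry of the pattern in the call whose number is in register 6. -/
def patExpr : Expr :=
  .load ((.lit 6 + .lit 2 * (.reg 6 / .lit 2 % .lit 2)) * .reg 5 +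
    ((.reg 2 - .reg 0 * (.reg 6 % .lit 2)) * .reg 10 + .reg 6 / .lit 2 / .lit 2 / .reg 10))

/-- The entry of the text in the call whose number is in register 6. -/
def textExpr : Expr :=
  .load (.lit 4 * .reg 5 +
    ((.reg 2 - .reg 0 * (.reg 6 % .lit 2) + .reg 0 * (.reg 6 / .lit 2 % .lit 2)) * .reg 10 +
      .reg 6 / .lit 2 / .lit 2 % .reg 10))

/-- Add the numbers of matches in the call whose number is in register 6 to the output. -/
def matchesProg (R : ℕ) (p : Prog) : Prog :=
  .seq (assignReg 8 ((.lit 9 + .reg 6) * .reg 5))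
  (.seq (forDo 2 0 (writeMem (.reg 8 + .reg 2)
    (patExpr + .bin .eq patExpr (.lit 0) * (.reg 0 + .lit 1))))
  (.seq (forDo 2 12 (writeMem (.reg 8 + .reg 0 + .reg 2) textExpr))
  (.seq (callProg R (fun r => if r = 0 then 0 else if r = 1 then 12 else 9) 8 p)
  (forDo 2 0 (writeMem (.reg 12 + .reg 2) (.load (.reg 12 + .reg 2) +
    (.reg 0 - .load (.reg 8 + (.lit 3 * .reg 0 + .reg 2)))))))))

theorem filled_filled (μ : ℤ → ℤ) (base : ℤ) (n : ℕ) (v v' : ℕ → ℤ) :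
    filled (filled μ base n v) base n v' = filled μ base n v' := by
  funext y
  unfold filled
  split_ifs <;> rfl

namespace ThreeSumInst

variable {x : ThreeSumInst} {L : ℕ} {B D X : ℤ} {w : ℕ} {V : ℕ → ℤ → ℤ} {σ τ : AState}
  {F : Fin x.N → Fin x.N}

theorem Layout.val_six (hF : x.Fits L B D X w) {t : ℕ}
    (ht : t < 2 * (2 * (L * L))) (h6 : τ.reg 6 = t) : (Expr.reg 6).Val X τ t := by
  refine .reg h6 (hF.natCast_le ?_)
  have h1 : (t : ℤ) < 4 * (L * L) := by exact_mod_cast (by omega : t < 4 * (L * L))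
  have h2 : ((L : ℤ) * L) ≤ L * L * x.N := le_mul_of_one_le_right (by positivity) hF.N_pos
  have : (0 : ℤ) ≤ L * x.N := by positivity
  linarith [hF.sum_le, hF.N_pos]

theorem Fits.abs_index_lt (hF : x.Fits L B D X w) {y : ℤ} (hy : |y| ≤ 3 * x.N) {r : ℕ}
    (hr : r < L) : |y * L + r| < B := by
  have h1 : |y * (L : ℤ)| ≤ 3 * (L * x.N) := by
    rw [abs_mul, abs_of_nonneg (by positivity : (0 : ℤ) ≤ L)]
    have := mul_le_mul_of_nonneg_right hy (by positivity : (0 : ℤ) ≤ L)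
    linarith
  have h2 : |(r : ℤ)| ≤ L := by rw [abs_of_nonneg (by positivity)]; omega
  have h3 : (L : ℤ) ≤ L * x.N := le_mul_of_one_le_right (by positivity) hF.N_pos
  have : (0 : ℤ) ≤ (L : ℤ) * L * x.N := by positivity
  linarith [hF.sum_le, hF.N_pos, abs_add_le (y * (L : ℤ)) r]

theorem Fits.abs_val_le (hF : x.Fits L B D X w) {v : ℤ} (hv : 0 ≤ v ∧ v ≤ x.N) : |v| ≤ X :=
  hF.abs_le_of_lt (by rw [abs_of_nonneg hv.1]; linarith [hF.N_le, hF.N_pos])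

theorem Layout.val_ten (hF : x.Fits L B D X w) (hI : x.Layout L D B V τ) :
    (Expr.reg 10).Val X τ L := by
  refine .reg hI.r10 (hF.natCast_le ?_)
  have h3 : (L : ℤ) ≤ L * x.N := le_mul_of_one_le_right (by positivity) hF.N_pos
  have : (0 : ℤ) ≤ (L : ℤ) * L * x.N := by positivity
  linarith [hF.sum_le, hF.N_pos]

/-- The digits of `t` select the region, the window and the layer; the last digit is below `L`
because `t < 4 * L ^ 2`. -/
theorem Layout.val_pat (hF : x.Fits L B D X w) (hI : x.Layout L D B V τ) {t j : ℕ}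
    (hV : V (6 + 2 * (t / 2 % 2)) =
      layerArray (x.posB F (t / 2 % 2)) (x.chrB (t / 2 % 2)) L x.N)
    (ht : t < 2 * (2 * (L * L))) (h6 : τ.reg 6 = t) (hj : j < x.N) (h2 : τ.reg 2 = j) :
    patExpr.Val X τ (x.patVal L F t j) := by
  have v6 := Layout.val_six hF ht h6
  have hr : t / 2 / 2 / L < L := by
    rw [Nat.div_lt_iff_lt_mul hF.L_pos]; omega
  have v2 : (Expr.reg 2).Val X τ j := .reg h2 (hF.abs_le_of_lt (hF.abs_lt_of_lt hj))
  have ha : |((j : ℤ) - x.N * (t % 2 : ℕ)) * L + (t / 2 / 2 / L : ℕ)| < B := by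
    refine hF.abs_index_lt ?_ hr
    have hj' : (j : ℤ) < x.N := by exact_mod_cast hj
    rcases Nat.mod_two_eq_zero_or_one t with h | h <;> rw [h, abs_le] <;> push_cast <;>
      constructor <;> linarith [hF.N_pos]
  refine hI.load_val (g := 6 + 2 * (t / 2 % 2)) (.of_eq (Expr.Val.add (Expr.Val.mul
    (Expr.Val.add (hF.val_lit 6) ((hF.val_lit 2).mul ((v6.div (hF.val_lit 2)).mod (hF.val_lit 2))))
    (hI.val_five hF)) (Expr.Val.add (Expr.Val.mul (v2.sub ((hI.val_zero hF).mul
      (v6.mod (hF.val_lit 2)))) (hI.val_ten hF)) (((v6.div (hF.val_lit 2)).div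
        (hF.val_lit 2)).div (hI.val_ten hF)))) ?_) ha ?_ (hF.abs_val_le (x.patVal_mem L F t j))
  · push_cast; ring
  · rw [hV, layerArray_mul_add _ _ _ _ hr, patVal]

theorem Layout.val_text (hF : x.Fits L B D X w) (hI : x.Layout L D B V τ) {t k : ℕ}
    (hV : V 4 = layerArray (x.posA F) x.chrA L x.N)
    (ht : t < 2 * (2 * (L * L))) (h6 : τ.reg 6 = t) (hk : k < 2 * x.N) (h2 : τ.reg 2 = k) :
    textExpr.Val X τ (x.textVal L F t k) := by
  have v6 := Layout.val_six hF ht h6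
  have hr : t / 2 / 2 % L < L := Nat.mod_lt _ hF.L_pos
  have hk' : (k : ℤ) < 2 * x.N := by exact_mod_cast hk
  have v2 : (Expr.reg 2).Val X τ k := .reg h2 (hF.natCast_le (by linarith [hF.N_le, hF.N_pos]))
  have ha : |((k : ℤ) - x.N * (t % 2 : ℕ) + x.N * (t / 2 % 2 : ℕ)) * L + (t / 2 / 2 % L : ℕ)| <
      B := by
    refine hF.abs_index_lt ?_ hr
    rcases Nat.mod_two_eq_zero_or_one t with h | h <;>
      rcases Nat.mod_two_eq_zero_or_one (t / 2) with h' | h' <;> rw [h, h', abs_le] <;>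
      push_cast <;> constructor <;> linarith [hF.N_pos]
  refine hI.load_val (g := 4) (.of_eq (Expr.Val.add (Expr.Val.mul
    (hF.val_lit 4) (hI.val_five hF)) (Expr.Val.add (Expr.Val.mul (Expr.Val.add
      (v2.sub ((hI.val_zero hF).mul (v6.mod (hF.val_lit 2)))) ((hI.val_zero hF).mul
        ((v6.div (hF.val_lit 2)).mod (hF.val_lit 2)))) (hI.val_ten hF))
      (((v6.div (hF.val_lit 2)).div (hF.val_lit 2)).mod (hI.val_ten hF)))) ?_) ha ?_
    (hF.abs_val_le (x.textVal_mem L F t k))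
  · push_cast; ring
  · rw [hV, layerArray_mul_add _ _ _ _ hr, textVal]

/-- The time of `matchesProg`. -/
abbrev matchesTime (R N τ : ℕ) : ℕ := 1200 * N + 4 * R + 3 * τ + 130

theorem callMatches_le (x : ThreeSumInst) (L : ℕ) (F : Fin x.N → Fin x.N) (c t : ℕ) :
    x.callMatches L F c t ≤ x.N := by
  refine (Finset.sum_le_card_nsmul _ _ 1 fun j _ => ?_).trans (by simp)
  unfold charMatch; split_ifs <;> simp

-- Call `t` owns region `9 + t`, which is still empty. Its answers start at offset `3 * N`, after a
-- pattern of length `N` and a text of length `2 * N`; being distances, they are subtracted from `N`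
-- before they are added to the output.
set_option maxHeartbeats 2000000 in
theorem achieves_matchesProg {κ : ℕ} (hκ : 2 ≤ κ) {p : Prog} {R : ℕ} (hp : p.UsesBelow R)
    (hF : x.Fits L B D X w) {w₀ τ₀ : ℕ} (hw : (2 : ℤ) ^ w₀ ≤ B) {t : ℕ}
    (ht : t < 2 * (2 * (L * L))) {W : ℕ → ℤ → ℤ} (hW : x.Layered L F t W)
    (hI : x.Layout L D B W σ) (h6 : σ.reg 6 = t) {ε : ENNReal}
    (hε : (hammingDistances κ).failProb p w₀ τ₀ (x.call hκ L F t) ≤ ε) :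
    Achieves w (matchesTime R x.N τ₀) ε (matchesProg R p) σ fun τ => τ.reg 6 = t ∧
      ∃ W, x.Layered L F (t + 1) W ∧ x.Layout L D B W τ := by
  have hN := hF.N_pos
  have hNB := hF.N_le
  have hBD := hF.scales.B_le
  have hB := hF.B_pos
  have hwide := hF.scales.wide
  set G : ℕ := 9 + t with hG
  set O : ℤ := G * D with hO
  have hO0 : 0 ≤ O := mul_nonneg (by positivity) (by linarith)
  have hOX : O + D ≤ X := by
    have := hF.mul_D_le (g := G + 1) (by omega)
    push_cast at this
    rw [hO]; linarith
  have hX := hwide.lt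
  have v12 {ρ : AState} {U : ℕ → ℤ → ℤ} (hρ : x.Layout L D B U ρ) :
      (Expr.reg 12).Val X ρ (2 * x.N : ℕ) :=
    .reg hρ.r12 (hF.natCast_le (by push_cast; linarith))
  have v8 {ρ : AState} (hρ : ρ.reg 8 = O) : (Expr.reg 8).Val X ρ O :=
    .reg hρ (by rw [abs_of_nonneg hO0]; linarith)
  have v2 {ρ : AState} {j : ℕ} (hj : j < 2 * x.N) (hρ : ρ.reg 2 = j) : (Expr.reg 2).Val X ρ j :=
    .reg hρ (hF.natCast_le (by
      have : (j : ℤ) < 2 * x.N := by exact_mod_cast hj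
      linarith))
  set pv : ℕ → ℤ := fun j => x.patVal L F t j +
    (if x.patVal L F t j = 0 then 1 else 0) * (x.N + 1) with hpv
  set tv : ℕ → ℤ := x.textVal L F t with htv
  refine Achieves.mono (t₁ := 30 + ((x.N * 400 + loopOverhead) + (((2 * x.N) * 250 + loopOverhead) +
    ((4 * R + 3 * τ₀ + 2) + (x.N * 150 + loopOverhead) + 1) + 1) + 1) + 1) ?_
    (by simp only [matchesTime, loopOverhead]; omega) le_rfl fun _ h => h
  -- the offset
  refine Achieves.seq_eq (τ := σ.set 8 O) (Achieves.assign_of_val hwide 30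
    ((((Expr.Val.lit (hF.natCast_le (n := 9) (by push_cast; linarith))).add
      (Layout.val_six hF ht h6)).mul (hI.val_five hF)).of_eq
      (by rw [hO, hG]; push_cast; ring))) ?_
  set σ₁ := σ.set 8 O with hσ₁
  have hI₁ : x.Layout L D B W σ₁ := hI.set 8 O
  have h6₁ : σ₁.reg 6 = t := by simpa [hσ₁, AState.set_reg] using h6
  have h8₁ : σ₁.reg 8 = O := by simp [hσ₁, AState.set_reg]
  clear_value σ₁
  -- the pattern
  set σ₂ : AState := ⟨Function.update σ₁.reg 2 x.N, filled σ₁.mem O x.N pv⟩ with hσ₂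
  have R₂ (n : ℕ) (hn : n ≤ x.N) : Regions D B (filled σ₁.mem O n pv)
      (Function.update W G (filled (W G) 0 n pv)) := by
    have := hI₁.mem.filled hBD G le_rfl (n := n) (by rw [zero_add]; omega) pv
    rwa [add_zero] at this
  refine Achieves.seq_eq (τ := σ₂) ?_ ?_
  · refine Achieves.fill_of_val hwide 400 hI₁.r0 (by linarith) O pv fun j hj ρ hρ => ?_
    have hρI : x.Layout L D B (Function.update W G (filled (W G) 0 j pv)) ρ :=
      hI₁.congr (fun r hr => by
        rw [hρ]
        exact Function.update_of_ne (by rintro rfl; exact absurd hr (by decide)) _ _)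
        (by rw [hρ]; exact R₂ j hj.le)
    have e2 : ρ.reg 2 = j := by simp [hρ]
    have e6 : ρ.reg 6 = t := by simpa [hρ] using h6₁
    have e8 : ρ.reg 8 = O := by simpa [hρ] using h8₁
    have vp : patExpr.Val X ρ (x.patVal L F t j) := hρI.val_pat hF (by
      rw [Function.update_of_ne (by omega), hW.right _ (by omega)]) ht e6 hj e2
    exact ⟨(v8 e8).add (v2 (by omega) e2), vp.add ((vp.eq (hF.val_lit 0)).mul
      ((hρI.val_zero hF).add (hF.val_lit 1)))⟩
  have hI₂ : x.Layout L D B (Function.update W G (filled (W G) 0 x.N pv)) σ₂ :=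
    hI₁.congr (fun r hr => Function.update_of_ne (by rintro rfl; exact absurd hr (by decide)) _ _)
      (R₂ _ le_rfl)
  have h6₂ : σ₂.reg 6 = t := by simpa [hσ₂] using h6₁
  have h8₂ : σ₂.reg 8 = O := by simpa [hσ₂] using h8₁
  -- the text
  set W₂ := Function.update W G (filled (W G) 0 x.N pv) with hW₂
  set σ₃ : AState := ⟨Function.update σ₂.reg 2 (2 * x.N : ℕ),
    filled σ₂.mem (O + x.N) (2 * x.N) tv⟩ with hσ₃
  have R₃ (n : ℕ) (hn : n ≤ 2 * x.N) : Regions D B (filled σ₂.mem (O + x.N) n tv)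
      (Function.update W₂ G (filled (W₂ G) x.N n tv)) :=
    hI₂.mem.filled hBD G (by positivity) (by omega) tv
  refine Achieves.seq_eq (τ := σ₃) ?_ ?_
  · refine Achieves.fill_of_val hwide 250 hI₂.r12 (by push_cast; linarith) (O + x.N) tv
      fun j hj ρ hρ => ?_
    have hρI : x.Layout L D B (Function.update W₂ G (filled (W₂ G) x.N j tv)) ρ :=
      hI₂.congr (fun r hr => by
        rw [hρ]
        exact Function.update_of_ne (by rintro rfl; exact absurd hr (by decide)) _ _)
        (by rw [hρ]; exact R₃ j hj.le)
    have e2 : ρ.reg 2 = j := by simp [hρ]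
    have e6 : ρ.reg 6 = t := by simpa [hρ] using h6₂
    have e8 : ρ.reg 8 = O := by simpa [hρ] using h8₂
    exact ⟨((v8 e8).add (hρI.val_zero hF)).add (v2 hj e2), hρI.val_text hF (by
      rw [Function.update_of_ne (by omega), hW₂, Function.update_of_ne (by omega), hW.left])
      ht e6 hj e2⟩
  have hI₃ : x.Layout L D B (Function.update W₂ G (filled (W₂ G) x.N (2 * x.N) tv)) σ₃ :=
    hI₂.congr (fun r hr => Function.update_of_ne (by rintro rfl; exact absurd hr (by decide)) _ _)
      (R₃ _ le_rfl)
  have h6₃ : σ₃.reg 6 = t := by simpa [hσ₃] using h6₂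
  have h8₃ : σ₃.reg 8 = O := by simpa [hσ₃] using h8₂
  have hdata := filled_filled_data (fun j : Fin x.N => (((x.call hκ L F t).P j : ℕ) : ℤ))
    (fun k : Fin (2 * x.N) => (((x.call hκ L F t).T k : ℕ) : ℤ)) (μ := 0) (O := 0) (B := B)
    (fun _ _ => rfl) (v₁ := pv) (v₂ := tv) (fun j => (x.cast_call_P hκ L F t j).symm)
    (fun k => (x.cast_call_T hκ L F t k).symm)
  have hW₃ : Function.update W₂ G (filled (W₂ G) x.N (2 * x.N) tv) G =
      filled (filled 0 0 x.N pv) (0 + x.N) (2 * x.N) tv := by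
    rw [Function.update_self, hW₂, Function.update_self, hW.high _ le_rfl, zero_add]
  set W₃ := Function.update W₂ G (filled (W₂ G) x.N (2 * x.N) tv) with hW₃'
  have hW₃o (g : ℕ) (hg : g ≠ G) : W₃ g = W g := by
    rw [hW₃', Function.update_of_ne hg, hW₂, Function.update_of_ne hg]
  clear_value σ₃ W₃
  -- the call
  have hlen : ((hammingDistances κ).answer (x.call hκ L F t)).length = x.N + 1 := by
    simp only [hammingDistances, List.length_ofFn, call]; omega
  have hdlen : ((hammingDistances κ).data (x.call hκ L F t)).length = 3 * x.N := by
    simp only [hammingDistances, List.length_append, List.length_ofFn, call]; omega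
  have hargs : (hammingDistances κ).args (x.call hκ L F t) = [(x.N : ℤ), (2 * x.N : ℕ)] := rfl
  rw [← add_zero ε]
  refine Achieves.seq (Achieves.mono (Achieves.call (hammingDistances κ) (x.call hκ L F t) hp
    h8₃ hw (t := τ₀) (B := B) ?_ ?_ ?_ ?_ ?_) le_rfl hε fun _ h => h) ?_
  · rw [abs_of_nonneg hO0]; linarith
  · intro r _
    rw [hargs]
    rcases r with _ | _ | r
    · exact hI₃.r0
    · exact hI₃.r12
    · simpa using hI₃.r9
  · intro r _
    rw [hargs]
    rcases r with _ | _ | r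
    · show |(x.N : ℤ)| < B
      rw [abs_of_nonneg (by positivity)]; linarith
    · show |((2 * x.N : ℕ) : ℤ)| < B
      rw [abs_of_nonneg (by positivity)]; push_cast; linarith
    · simpa using (by linarith : 0 < B)
  · intro a ha
    rw [hI₃.mem G a ha, hW₃]
    have := hdata a ha
    rw [zero_add a] at this
    exact this
  · rw [hlen, hdlen]; push_cast; linarith
  rintro σ₄ ⟨hreg, hans, hout⟩
  set W₄ := Function.update W₃ G fun a => σ₄.mem (O + a) with hW₄
  have hI₄ : x.Layout L D B W₄ σ₄ := hI₃.congr (fun r _ => by rw [hreg]) (fun g a ha => by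
    by_cases hg : g = G
    · subst hg; rw [hW₄, Function.update_self]
    · rw [hW₄, Function.update_of_ne hg, hout _ (le_abs_sub_of_ne hBD hg ha), hI₃.mem g a ha])
  have h8₄ : σ₄.reg 8 = O := by rw [hreg, h8₃]
  have h6₄ : σ₄.reg 6 = t := by rw [hreg, h6₃]
  have hW₄0 : W₄ 0 = W 0 := by rw [hW₄, Function.update_of_ne (by omega), hW₃o _ (by omega)]
  have hW₄G (c : ℕ) (hc : c < x.N) : W₄ G (3 * x.N + c) = x.N - (x.callMatches L F c t : ℤ) := by
    rw [hW₄, Function.update_self]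
    have h := hans c (by omega)
    rw [hdlen, x.answer_call hκ L F t (by omega) hc] at h
    rw [← h]; push_cast; rfl
  -- the output
  set ov : ℕ → ℤ := fun c => ∑ t' ∈ Finset.range (t + 1), (x.callMatches L F c t' : ℤ) with hov
  have R₅ (n : ℕ) (hn : n ≤ x.N) : Regions D B (filled σ₄.mem (2 * x.N : ℕ) n ov)
      (Function.update W₄ 0 (filled (W₄ 0) (2 * x.N : ℕ) n ov)) := by
    have := hI₄.mem.filled hBD 0 (a := (2 * x.N : ℕ)) (by positivity) (n := n)
      (by push_cast; omega) ov
    rwa [Nat.cast_zero, zero_mul, zero_add] at this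
  refine (Achieves.fill_of_val hwide 150 hI₄.r0 (by linarith) (2 * x.N : ℕ) ov
    fun j hj ρ hρ => ?_).mono le_rfl le_rfl ?_
  · have hρI : x.Layout L D B (Function.update W₄ 0 (filled (W₄ 0) (2 * x.N : ℕ) j ov)) ρ :=
      hI₄.congr (fun r hr => by
        rw [hρ]
        exact Function.update_of_ne (by rintro rfl; exact absurd hr (by decide)) _ _)
        (by rw [hρ]; exact R₅ j hj.le)
    have e2 : ρ.reg 2 = j := by simp [hρ]
    have e8 : ρ.reg 8 = O := by simpa [hρ] using h8₄
    have hj' : (j : ℤ) < x.N := by exact_mod_cast hj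
    have v := (v12 hρI).add (v2 (by omega : j < 2 * x.N) e2)
    have hm := callMatches_le x L F j t
    have vs : (Expr.load (.reg 12 + .reg 2)).Val X ρ
        (∑ t' ∈ Finset.range t, (x.callMatches L F j t' : ℤ)) := by
      refine hρI.load_val_zero v (by rw [abs_of_nonneg (by positivity)]; push_cast; linarith) ?_
        (hF.abs_le_of_lt ?_)
      · rw [Function.update_self, filled_not_mem _ _ (Or.inr le_rfl), hW₄0, hW.zero,
          filled_mem _ _ hj]
      · rw [abs_of_nonneg (by positivity)]
        have h1 : ∑ t' ∈ Finset.range t, (x.callMatches L F j t' : ℤ) ≤ t * x.N := by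
          refine (Finset.sum_le_card_nsmul _ _ (x.N : ℤ) fun t' _ => ?_).trans (by simp)
          exact_mod_cast callMatches_le x L F j t'
        have h2 : (t : ℤ) ≤ 4 * (L * L) := by exact_mod_cast (by omega : t ≤ 4 * (L * L))
        have h3 := mul_le_mul_of_nonneg_right h2 (by positivity : (0 : ℤ) ≤ x.N)
        have h4 : (0 : ℤ) ≤ L * x.N := by positivity
        linarith [hF.sum_le]
    have va : (Expr.load (.reg 8 + (.lit 3 * .reg 0 + .reg 2))).Val X ρ
        (x.N - (x.callMatches L F j t : ℤ)) := by
      refine hρI.load_val (g := G) (a := 3 * x.N + j) (((v8 e8).add (Expr.Val.add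
        ((hF.val_lit 3).mul (hρI.val_zero hF)) (v2 (by omega) e2)))) ?_ ?_
        (hF.abs_val_le ⟨by omega, by omega⟩)
      · rw [abs_of_nonneg (by positivity)]; linarith
      · rw [Function.update_of_ne (by omega), hW₄G j hj]
    refine ⟨v, (vs.add ((hρI.val_zero hF).sub va)).of_eq ?_⟩
    rw [hov]
    simp only
    rw [Finset.sum_range_succ]; ring
  · rintro _ rfl
    refine ⟨by simpa using h6₄, _, ⟨?_, ?_, ?_, ?_⟩,
      hI₄.congr (fun r hr => Function.update_of_ne (by rintro rfl; exact absurd hr (by decide)) _ _)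
      (R₅ _ le_rfl)⟩
    · rw [Function.update_self, hW₄0, hW.zero, filled_filled]
    · rw [Function.update_of_ne (by omega), hW₄, Function.update_of_ne (by omega),
        hW₃o _ (by omega), hW.left]
    · intro d hd
      rw [Function.update_of_ne (by omega), hW₄, Function.update_of_ne (by omega),
        hW₃o _ (by omega), hW.right d hd]
    · intro g hg
      rw [Function.update_of_ne (by omega), hW₄, Function.update_of_ne (by omega),
        hW₃o _ (by omega), hW.high g (by omega)]

end ThreeSumInst

/-! ### From 3SUM to Hamming distances: the algorithm -/

/-- Solve 3SUM with the program `p` for Hamming distances. -/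
def threeSumProg (K k R : ℕ) (p : Prog) : Prog :=
  .seq (powerProg k)
  (.seq (assignReg 10 (.lit K * .reg 4))
  (.seq (assignReg 11 (.reg 0 - .lit 1))
  (.seq (assignReg 12 (.lit 2 * .reg 0))
  (.seq (assignReg 7 (.lit 4 * (.reg 10 * .reg 10)))
  (.seq (forDo 2 0 (drawMem (.reg 5 + .reg 2) 11))
  (.seq tablesProg
  (forDo 6 7 (matchesProg R p))))))))

namespace ThreeSumInst

variable {x : ThreeSumInst} {B D X : ℤ} {w : ℕ}

/-- The input ends before the first region begins, so all regions but the zeroth start empty. -/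
theorem regions_input {L : ℕ} (hF : x.Fits L B D X w) :
    Regions D B x.input (Function.update 0 0 x.input) := by
  intro g a ha
  rcases g with _ | g
  · simp
  · rw [Function.update_of_ne (by omega)]
    refine Problem.inputMem_of_le rangeThreeSum x ?_
    have hlen : (rangeThreeSum.data x).length = x.N + x.N := by simp [rangeThreeSum]
    have h1 := hF.scales.B_le
    have h2 := hF.N_le
    have h3 : (0 : ℤ) ≤ g * D := mul_nonneg (by positivity) (by linarith [hF.B_pos])
    have h4 := (abs_lt.1 ha).1
    rw [hlen]; push_cast; linarith [hF.N_pos]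

-- The shifts are drawn once and shared by all calls. As the bound `ε` holds for every `F` and `t`,
-- no independence is needed: the errors of the draw and of the `4 * L ^ 2` calls simply add up.
open scoped Classical in
set_option maxHeartbeats 1000000 in
theorem achieves_threeSumProg {κ : ℕ} (hκ : 2 ≤ κ) {p : Prog} {R : ℕ} (hp : p.UsesBelow R)
    {K k : ℕ} (hK : 1 ≤ K) (hk : 1 ≤ k)
    (hF : x.Fits (K * x.N.size) B (2 ^ (k * x.N.size)) X w) (hkw : k * x.N.size + 3 ≤ w)
    {w₀ τ₀ : ℕ} (hw : (2 : ℤ) ^ w₀ ≤ B) {ε : ENNReal}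
    (hε : ∀ F t, (hammingDistances κ).failProb p w₀ τ₀ (x.call hκ (K * x.N.size) F t) ≤ ε)
    (hτ₀ : x.N ≤ τ₀) :
    Achieves w ((4 * K ^ 2 * (1357 + 4 * R) + 1700) * τ₀ * x.N.size ^ 2)
      ((Finset.univ.filter fun F => ¬ x.LowLoad (K * x.N.size) F).card / (x.N : ENNReal) ^ x.N +
        (2 * (2 * (K * x.N.size * (K * x.N.size))) : ℕ) * ε)
      (threeSumProg K k R p)
      ⟨fun r => (rangeThreeSum.args x).getD r 0, x.input⟩
      fun τ => ∀ c < x.N, τ.mem ((2 * x.N : ℕ) + c) = pairCount x.a x.b c := by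
  have hN := hF.N_pos
  have hNB := hF.N_le
  have hB := hF.B_pos
  have hBD := hF.scales.B_le
  have hwide := hF.scales.wide
  have hs : 1 ≤ x.N.size := Nat.size_pos.2 x.N_pos
  set D : ℤ := 2 ^ (k * x.N.size) with hD
  set L : ℕ := K * x.N.size with hL
  have hLL : (L : ℤ) ≤ L * x.N := le_mul_of_one_le_right (by positivity) hN
  have hLLN : (L : ℤ) * L ≤ L * L * x.N := le_mul_of_one_le_right (by positivity) hN
  have hLL0 : (0 : ℤ) ≤ (L : ℤ) * L := by positivity
  have hsum := hF.sum_le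
  have hLB : (L : ℤ) < B := by linarith
  have hKL : K ≤ L := Nat.le_mul_of_pos_right _ hs
  have hsL : x.N.size ≤ L := Nat.le_mul_of_pos_left _ hK
  set σ₀ : AState := ⟨fun r => (rangeThreeSum.args x).getD r 0, x.input⟩ with hσ₀
  set σ₁ := ((σ₀.set 4 x.N.size).set 2 x.N).set 5 D with hσ₁
  have e0 : σ₁.reg 0 = x.N := by simp [hσ₁, hσ₀, AState.set_reg, rangeThreeSum]
  have e4 : σ₁.reg 4 = x.N.size := by simp [hσ₁, AState.set_reg]
  have e5 : σ₁.reg 5 = D := by simp [hσ₁, AState.set_reg]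
  have e9 : σ₁.reg 9 = 0 := by simp [hσ₁, hσ₀, AState.set_reg, rangeThreeSum]
  have em : σ₁.mem = x.input := rfl
  have hpow : Achieves w (100 * x.N) 0 (powerProg k) σ₀ (· = σ₁) :=
    Achieves.powerProg hk x.N_pos rfl hkw
  clear_value σ₁ D
  have bN : |(x.N : ℤ)| ≤ X := hF.natCast_le (by linarith)
  refine Achieves.mono (t₁ := 100 * x.N + (15 + (15 + (15 + (20 +
    ((x.N * 37 + loopOverhead) + ((x.N * 1300 + 4 * loopOverhead + 3) +
      ((2 * (2 * (L * L))) * (matchesTime R x.N τ₀ + loopOverhead) + loopOverhead) + 1) + 1) +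
        1) + 1) + 1) + 1) + 1) ?_ ?_ le_rfl fun _ h => h
  swap
  · have hs2 : 1 ≤ x.N.size ^ 2 := Nat.one_le_pow _ _ hs
    have h1 : τ₀ ≤ τ₀ * x.N.size ^ 2 := Nat.le_mul_of_pos_right _ hs2
    have h2 : matchesTime R x.N τ₀ + loopOverhead ≤ (1357 + 4 * R) * τ₀ := by
      have : R ≤ R * τ₀ := Nat.le_mul_of_pos_right _ (by have := x.N_pos; omega)
      have := x.N_pos
      simp only [matchesTime, loopOverhead]
      linarith
    -- The number of calls, with `L = K * N.size`, is the source of the two logarithmic factors.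
    have h3 := Nat.mul_le_mul_left (4 * (L * L)) h2
    have h4 : 4 * (L * L) * ((1357 + 4 * R) * τ₀) =
        4 * K ^ 2 * (1357 + 4 * R) * τ₀ * x.N.size ^ 2 := by rw [hL]; ring
    rw [h4] at h3
    have := x.N_pos
    simp only [loopOverhead] at h3 ⊢
    linarith
  refine Achieves.seq_eq (τ := σ₁) hpow ?_
  set σ₂ := σ₁.set 10 L with hσ₂
  set σ₃ := σ₂.set 11 ((x.N : ℤ) - 1) with hσ₃
  set σ₄ := σ₃.set 12 (2 * x.N : ℕ) with hσ₄
  set σ₅ := σ₄.set 7 (2 * (2 * (L * L)) : ℕ) with hσ₅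
  refine Achieves.seq_eq (τ := σ₂) (Achieves.assign_of_val hwide 15 (Expr.Val.of_eq
    ((Expr.Val.lit (v := (K : ℤ)) (hF.natCast_le (by linarith [(by exact_mod_cast hKL :
      (K : ℤ) ≤ L)]))).mul (.reg e4 (hF.natCast_le (by linarith [(by exact_mod_cast hsL :
      (x.N.size : ℤ) ≤ L)])))) (by rw [hL]; push_cast; rfl)) (by simp [Expr.leaves])
      (by simp [Expr.time])) ?_
  refine Achieves.seq_eq (τ := σ₃) (Achieves.assign_of_val hwide 15
    ((Expr.Val.reg (by simp [hσ₂, AState.set_reg, e0]) bN).sub (hF.val_lit 1))) ?_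
  refine Achieves.seq_eq (τ := σ₄) (Achieves.assign_of_val hwide 15
    (((hF.val_lit 2).mul (Expr.Val.reg (v := x.N) (by simp [hσ₃, hσ₂, AState.set_reg, e0])
      bN)).of_eq (by push_cast; rfl))) ?_
  have v10 : (Expr.reg 10).Val X σ₄ L :=
    .reg (by simp [hσ₄, hσ₃, hσ₂, AState.set_reg]) (hF.natCast_le hLB)
  refine Achieves.seq_eq (τ := σ₅) (Achieves.assign_of_val hwide 20
    (((hF.val_lit 4).mul (v10.mul v10)).of_eq (by push_cast; ring))) ?_
  have hm₅ : σ₅.mem = x.input := em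
  have hI : x.Layout L D B (Function.update 0 0 x.input) σ₅ := by
    refine ⟨?_, ?_, ?_, ?_, ?_, ?_, ?_, hm₅ ▸ regions_input hF⟩ <;>
      simp [hσ₅, hσ₄, hσ₃, hσ₂, AState.set_reg, e0, e5, e9]
  clear_value σ₅
  have hND : (x.N : ℤ) < B := by linarith
  have hrand := Achieves.randFill (i := 2) (a := .reg 5 + .reg 2) x.N_pos (by decide) (by decide)
    (hF.loop_lt hND) hI.r0 hI.r11 D (x.LowLoad L) fun j hj v τ hτ => ?_
  swap
  · have h2 : τ.reg 2 = j := by simp [hτ]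
    have h5 : τ.reg 5 = D := by simpa [hτ] using hI.r5
    have := (Expr.Val.reg h5 hF.abs_D_le).add
      (Expr.Val.reg h2 (hF.abs_le_of_lt (hF.abs_lt_of_lt hj)))
    exact ⟨this.1.fits_of_wide hwide, this.2⟩
  have htime : (Expr.reg 5 + Expr.reg 2).time + 4 + loopOverhead = 37 := by decide
  rw [htime] at hrand
  refine Achieves.seq hrand ?_
  rintro σ₆ ⟨F, hLow, hσ₆⟩
  have hI₆ : x.Layout L D B (Function.update (Function.update 0 0 x.input) 1 (shifts F)) σ₆ := by
    rw [hσ₆]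
    refine hI.congr (fun r hr => Function.update_of_ne (by rintro rfl; exact absurd hr (by decide))
      _ _) ?_
    have := hI.mem.filled hBD 1 le_rfl (n := x.N) (by linarith) (extendFin F)
    rw [Nat.cast_one, one_mul, add_zero] at this
    rwa [Function.update_of_ne (by decide : (1 : ℕ) ≠ 0)] at this
  refine Achieves.seq_det (achieves_tablesProg hF hLow hI₆ (by simp) (by simp) fun g hg => ?_) ?_
  · rw [Function.update_of_ne (by omega), Function.update_of_ne (by omega)]; rfl
  rintro σ₇ ⟨W, hW, hI₇⟩
  have hloop := Achieves.forLoop (w := w) (tb := matchesTime R x.N τ₀) (nn := 2 * (2 * (L * L)))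
    (ε := ε) (i := 6) (n := 7) (p := matchesProg R p) (σ := σ₇) (by decide)
    (Inv := fun t τ => ∃ W, x.Layered L F t W ∧ x.Layout L D B W τ)
    (hF.loop_lt (by push_cast; linarith))
    (fun t ht τ h6 _ ⟨W, hW, hI⟩ =>
      (achieves_matchesProg hκ hp hF hw ht hW hI h6 (hε F t)).mono le_rfl le_rfl
        fun τ' ⟨h6', W', hW', hI'⟩ => ⟨h6', hI'.r7, W', hW', hI'.set 6 _⟩)
    hI₇.r7 ⟨W, hW, hI₇.set 6 0⟩
  refine hloop.mono le_rfl le_rfl ?_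
  rintro τ ⟨W', hW', hI'⟩ c hc
  have hc' : (c : ℤ) < x.N := by exact_mod_cast hc
  have := hI'.mem 0 ((2 * x.N : ℕ) + c) (by
    rw [abs_of_nonneg (by positivity)]; push_cast; linarith)
  rw [Nat.cast_zero, zero_mul, zero_add] at this
  rw [this, hW'.zero, filled_mem _ _ hc]
  exact_mod_cast x.sum_callMatches (Nat.mul_pos hK hs) hLow hc

end ThreeSumInst

/-! ### Parameters and failure probability of the 3SUM algorithm. -/

theorem two_pow_le_factorial_succ (n : ℕ) : 2 ^ n ≤ (n + 1).factorial := by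
  induction n with
  | zero => simp
  | succ n ih =>
    rw [pow_succ, Nat.factorial_succ, mul_comm]
    exact Nat.mul_le_mul (by omega) ih

namespace ThreeSumInst

/-- With `L! ≥ 2 ^ (L - 1)`, one bit length pays for `N`, another `c + 1` for the power, and the
remaining five for the factor `9 ≤ 2 ^ 4` and the loss of one in the exponent. -/
theorem mul_pow_le_factorial {N : ℕ} (hN : 1 ≤ N) (c : ℕ) :
    9 * N * (N + 1) ^ (c + 1) ≤ ((c + 7) * N.size).factorial := by
  have hs : 1 ≤ N.size := Nat.size_pos.2 hN
  have h1 : N ≤ 2 ^ N.size := (Nat.lt_size_self N).le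
  have h2 := two_pow_size_le_succ_pow N (c + 1)
  have h3 : 9 ≤ 2 ^ 4 := by norm_num
  obtain ⟨m, hm⟩ : ∃ m, (c + 7) * N.size = m + 1 :=
    Nat.exists_eq_succ_of_ne_zero (Nat.mul_pos (by omega) hs).ne'
  rw [hm]
  refine le_trans ?_ (two_pow_le_factorial_succ m)
  calc 9 * N * (N + 1) ^ (c + 1) ≤ 2 ^ 4 * 2 ^ N.size * 2 ^ ((c + 1) * N.size) := by gcongr
    _ = 2 ^ (4 + N.size + (c + 1) * N.size) := by rw [pow_add, pow_add]
    _ ≤ 2 ^ m := Nat.pow_le_pow_right (by norm_num) (by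
      have : (c + 7) * N.size = (c + 1) * N.size + 6 * N.size := by ring
      omega)

open scoped Classical in
theorem card_not_lowLoad_div_le (x : ThreeSumInst) (c : ℕ) :
    ((Finset.univ.filter fun F => ¬ x.LowLoad ((c + 7) * x.N.size) F).card : ENNReal) /
      (x.N : ENNReal) ^ x.N ≤ (((x.N : ENNReal) + 1) ^ (c + 1))⁻¹ := by
  have hN := x.N_pos
  have hs : 1 ≤ x.N.size := Nat.size_pos.2 hN
  have h1 := x.card_not_lowLoad_mul_factorial_le (L := (c + 7) * x.N.size)
    (Nat.mul_pos (by omega) hs)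
  have h2 := mul_pow_le_factorial hN c
  have h3 : (Finset.univ.filter fun F => ¬ x.LowLoad ((c + 7) * x.N.size) F).card *
      (x.N + 1) ^ (c + 1) ≤ x.N ^ x.N := by
    have h4 := (Nat.mul_le_mul_left _ h2).trans h1
    have h5 : 0 < 9 * x.N := by omega
    refine le_of_mul_le_mul_left ?_ h5
    linarith
  have hN0 : (x.N : ENNReal) ≠ 0 := by simp; omega
  rw [ENNReal.div_le_iff (pow_ne_zero _ hN0) (by finiteness), mul_comm (_⁻¹), ← div_eq_mul_inv,
    ENNReal.le_div_iff_mul_le (Or.inl (by positivity)) (Or.inl (by finiteness))]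
  exact_mod_cast h3

/-- Two units of the exponent absorb `N.size ^ 2 ≤ (N + 1) ^ 2`, and `4 * K ^ 2` units absorb the
constant. -/
theorem calls_mul_le {N : ℕ} (hN : 1 ≤ N) (K c : ℕ) :
    ((2 * (2 * (K * N.size * (K * N.size))) : ℕ) : ENNReal) *
      (((N : ENNReal) + 1) ^ (c + (4 * K ^ 2) + 2))⁻¹ ≤ (((N : ENNReal) + 1) ^ c)⁻¹ := by
  have h1 : N.size ≤ N + 1 := by
    have h2 : N.size ≤ N := Nat.size_le.2 Nat.lt_two_pow_self
    omega
  have h2 : 2 * (2 * (K * N.size * (K * N.size))) ≤ 4 * K ^ 2 * (N + 1) ^ 2 := by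
    calc 2 * (2 * (K * N.size * (K * N.size))) = 4 * K ^ 2 * N.size ^ 2 := by ring
      _ ≤ _ := by gcongr
  have h3 : ((2 * (2 * (K * N.size * (K * N.size))) : ℕ) : ENNReal) ≤
      ((4 * K ^ 2 : ℕ) : ENNReal) * ((N : ENNReal) + 1) ^ 2 := by exact_mod_cast h2
  refine (mul_le_mul_left h3 _).trans ?_
  refine le_trans (le_of_eq ?_) (const_mul_inv_pow_le hN (4 * K ^ 2) c)
  generalize 4 * K ^ 2 = m
  rw [pow_add _ (c + m) 2, ENNReal.mul_inv (Or.inr (by finiteness)) (Or.inr (by positivity)),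
    mul_assoc, mul_left_comm (((N : ENNReal) + 1) ^ 2),
    ENNReal.mul_inv_cancel (by positivity) (by finiteness), mul_one]

theorem fits_of_size (x : ThreeSumInst) {u K a T₀ : ℕ} (hK : 1 ≤ K)
    (hx : rangeThreeSum.PolyBounded u x) (ha : u ≤ a) (hT : 2 * K + 5 ≤ T₀) :
    x.Fits (K * x.N.size) (2 ^ ((a + T₀ + 1) * x.N.size)) (2 ^ ((a + T₀ + 2) * x.N.size))
      (2 ^ ((a + 2 * T₀ + 5) * x.N.size)) (41 * (a + 2 * T₀ + 5) * x.N.size) := by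
  have hs : 1 ≤ x.N.size := Nat.size_pos.2 x.N_pos
  have hL : 1 ≤ K * x.N.size := Nat.mul_pos hK hs
  refine ⟨?_, hL, fun y => ?_⟩
  · refine Scales.of_size 0 x.N_pos ?_
    have h1 : K * x.N.size ≤ 2 ^ (K * x.N.size) := Nat.lt_two_pow_self.le
    have h2 : 4 * (K * x.N.size * (K * x.N.size)) + 4 * (K * x.N.size) + 10 ≤
        2 ^ 5 * (2 ^ (K * x.N.size) * 2 ^ (K * x.N.size)) := by nlinarith
    refine h2.trans ?_
    rw [← pow_add, ← pow_add]
    refine Nat.pow_le_pow_right (by norm_num) ?_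
    calc 5 + (K * x.N.size + K * x.N.size) ≤ (2 * K + 5) * x.N.size := by nlinarith
      _ ≤ _ := Nat.mul_le_mul_right _ hT
  · have h1 : |x.input y| ≤ ((x.N : ℤ) + 1) ^ u := Problem.abs_inputMem_le hx y
    have h2 : ((x.N : ℤ) + 1) ^ u ≤ 2 ^ (u * x.N.size) := by
      exact_mod_cast two_pow_size_le_succ_pow x.N u
    have h3 : (1 : ℤ) ≤ 2 ^ (u * x.N.size) := one_le_pow₀ (by norm_num)
    have h4 : (2 : ℤ) ^ (u * x.N.size) * 2 ^ 2 ≤ 2 ^ ((a + T₀ + 1) * x.N.size) := by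
      rw [← pow_add]
      refine pow_le_pow_right₀ (by norm_num) ?_
      calc u * x.N.size + 2 ≤ (u + 2) * x.N.size := by nlinarith
        _ ≤ _ := Nat.mul_le_mul_right _ (by omega)
    linarith

end ThreeSumInst

theorem rangeThreeSum_of_hammingDistances_randomized {f : ℕ → ℝ} {κ : ℕ} (hκ : 2 ≤ κ)
    (h : (hammingDistances κ).HasRandomizedAlgorithm f) :
    rangeThreeSum.HasRandomizedAlgorithm fun N => f N * Real.log ((N : ℝ) + 2) ^ 2 := by
  intro u c
  set K := c + 7 with hK
  -- The last summands pay for the number of calls, see `calls_mul_le`. The extra one allows adding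
  -- two errors of size `(N + 1) ^ (-(c + 1))`, by `2 ≤ N + 1`.
  set c' := c + 1 + 4 * K ^ 2 + 2 with hc'
  obtain ⟨p, k, C, hp⟩ := h 1 c'
  obtain ⟨R, hR⟩ := p.exists_usesBelow
  set a := u + k with ha
  set T₀ := 2 * K + 5 with hT₀
  refine ⟨threeSumProg K (a + T₀ + 2) R p, 41 * (a + 2 * T₀ + 5),
    3 ^ 2 * (4 * K ^ 2 * (1357 + 4 * R) + 1700) * C, fun x hx => ?_⟩
  have hN := x.N_pos
  have hs : 1 ≤ x.N.size := Nat.size_pos.2 hN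
  have hF := x.fits_of_size (K := K) (by omega) hx (by omega : u ≤ a) hT₀.ge
  set τ₀ := ⌊C * f x.N⌋₊ with hτ₀
  have hNτ : x.N ≤ τ₀ := hammingDistances_size_le hκ (p := p) (u := 1) (w := k * x.N.size) hN
    fun y hy hb => by
      have h1 := hp y hb
      have h2 : (hammingDistances κ).size y = x.N := hy
      rw [h2] at h1
      exact h1.trans_lt (inv_pow_lt_one hN (by omega))
  have hkw : (a + T₀ + 2) * x.N.size + 3 ≤ 41 * (a + 2 * T₀ + 5) * x.N.size := by nlinarith
  have hA := ThreeSumInst.achieves_threeSumProg hκ hR (by omega) (by omega) hF hkw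
    (w₀ := k * x.N.size) (τ₀ := τ₀) (ε := (((x.N : ENNReal) + 1) ^ c')⁻¹)
    (pow_le_pow_right₀ (by norm_num) (Nat.mul_le_mul_right _ (by omega)))
    (fun F t => hp (x.call hκ _ F t) (x.polyBounded_call hκ _ F t)) hNτ
  refine failProb_le_of_achieves (Q := rangeThreeSum) (hA.mono
    (le_floor_of_le_mul (e := 2) hτ₀ (by omega) (Nat.size_le_log hN) le_rfl) ?_ fun _ h => h)
    fun τ hτ i hi => ?_
  · refine (add_le_add (x.card_not_lowLoad_div_le c)
      (ThreeSumInst.calls_mul_le hN K (c + 1))).trans ?_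
    show _ ≤ (((x.N : ENNReal) + 1) ^ c)⁻¹
    rw [← two_mul]
    have h2 : (2 : ENNReal) ≤ (x.N : ENNReal) + 1 := by exact_mod_cast (by omega : 2 ≤ x.N + 1)
    rw [pow_succ, ENNReal.mul_inv (Or.inr (by finiteness)) (Or.inr (by positivity)),
      mul_left_comm]
    refine (mul_le_mul_right (mul_le_mul_left h2 _) _).trans (le_of_eq ?_)
    rw [ENNReal.mul_inv_cancel (by positivity) (by finiteness), mul_one]
  · have hlen : (rangeThreeSum.data x).length = 2 * x.N := by
      simp only [rangeThreeSum, List.length_append, List.length_ofFn]; omega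
    have hi' : i < x.N := by simpa [rangeThreeSum] using hi
    rw [hlen, hτ i hi']
    simp only [rangeThreeSum, List.getElem_ofFn]
    rw [card_filter_map_product]

theorem theorem6 (f : ℕ → ℝ) (κ : ℕ) (hκ : 2 ≤ κ) :
    (rangeThreeSum.HasRandomizedAlgorithm f →
      ∃ e : ℕ, (hammingDistances κ).HasRandomizedAlgorithm
        fun m => f m * Real.log ((m : ℝ) + 2) ^ e) ∧
    (rangeThreeSum.HasDeterministicAlgorithm f →
      ∃ e : ℕ, (hammingDistances κ).HasDeterministicAlgorithm
        fun m => f m * Real.log ((m : ℝ) + 2) ^ e) ∧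
    ((hammingDistances κ).HasRandomizedAlgorithm f →
      ∃ e : ℕ, rangeThreeSum.HasRandomizedAlgorithm
        fun N => f N * Real.log ((N : ℝ) + 2) ^ e) := by
  refine ⟨fun h => ⟨0, hammingDistances_of_rangeThreeSum_randomized hκ h⟩,
    fun h => ⟨0, hammingDistances_of_rangeThreeSum_deterministic hκ h⟩,
    fun h => ⟨2, rangeThreeSum_of_hammingDistances_randomized hκ h⟩⟩
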